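/- Fix $b>0$ and $z\in\mathbb{C}$. Let $L_{z,b}$ be the operator on $L^2(\mathbb{R})$ formally given by $$L_{z,b}\,y=-y''+\Big(\frac{x^2}{4}-\frac12\Big)y+z\,[\delta(x-b)-\delta(x+b)]\,y,$$ that is, the operator associated with the sesquilinear form $$t_{z,b}(f,g)=\langle f',g'\rangle+\tfrac14\langle xf,xg\rangle-\tfrac12\langle f,g\rangle+z\big(f(b)\overline{g(b)}-f(-b)\overline{g(-b)}\big)$$ with domain $\mathrm{Dom}(t)=\{f\in H^1(\mathbb{R}): xf\in L^2(\mathbb{R})\}$: $f\in\mathrm{Dom}(L_{z,b})$ and $L_{z,b}f=h$ if and only if $f\in\mathrm{Dom}(t)$, $h\in L^2(\mathbb{R})$ and $t_{z,b}(f,g)=\langle h,g\rangle$ for all $g\in\mathrm{Dom}(t)$. (Here $\langle f,g\rangle=\int_{\mathbb R} f\overline{g}\,dx$, and elements of $H^1(\mathbb R)$ are identified with their continuous representatives.) For $\nu,x\in\mathbb{C}$ let $$y_{\rm even}(\nu,x)=e^{-x^2/4}\sum_{k\ge0}\Big(\prod_{j=0}^{k-1}(2j-\nu)\Big)\frac{x^{2k}}{(2k)!},\qquad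 y_{\rm odd}(\nu,x)=e^{-x^2/4}\sum_{k\ge0}\Big(\prod_{j=0}^{k-1}(2j+1-\nu)\Big)\frac{x^{2k+1}}{(2k+1)!},$$ $$D_\nu(x)=\frac{2^{\nu/2}\sqrt\pi}{\Gamma\left(\frac{1-\nu}{2}\right)}\,y_{\rm even}(\nu,x)-\frac{2^{(\nu+1)/2}\sqrt\pi}{\Gamma\left(-\frac{\nu}{2}\right)}\,y_{\rm odd}(\nu,x)$$ (the parabolic cylinder function), where $1/\Gamma$ denotes the entire reciprocal Gamma function, and for $\nu\in\mathbb{C}\setminus\mathbb{N}_0$ let $$M(\nu;b)=\sqrt{\tfrac{2}{\pi}}\;\Gamma(-\nu)\,D_\nu(b)^2\,y_{\rm even}(\nu,b)\,y_{\rm odd}(\nu,b).$$ Then: 1. For every $\nu\in\mathbb{C}$, $\nu$ belongs to the spectrum of $L_{z,b}$ if and only if $$\frac{1}{\Gamma(-\nu)}-z^2D_\nu(b)^2\,\sqrt{\tfrac{2}{\pi}}\;y_{\rm even}(\nu,b)\,y_{\rm odd}(\nu,b)=0,$$ and $\nu$ is an eigenvalue of $L_{z,b}$ if and only if the same equation holds.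 2. For every $\nu\in\mathbb{C}\setminus\mathbb{N}_0$, $\nu$ belongs to the spectrum of $L_{z,b}$ if and only if $z\neq0$ and $M(\nu;b)=1/z^2$, and $\nu$ is an eigenvalue of $L_{z,b}$ if and only if $z\ne0$ and $M(\nu;b)=1/z^2$. 3. The function $M(\cdot\,;b)$ has a non-removable pole at $\nu=0$; in particular, it is not constant on $\mathbb{C}\setminus\mathbb{N}_0$. 4. If $\nu\in\mathbb{R}\setminus\mathbb{N}_0$, then $M(\nu;b)$ is real. -/

import Mathlib

open MeasureTheory
open scoped ContDiff ComplexConjugate ENNReal Topology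

noncomputable section

namespace PointInteraction

/-! ### Unbounded operators: eigenvalues and spectrum -/

section Operators

variable {H : Type*} [NormedAddCommGroup H] [NormedSpace ℂ H]

/-- `ν` is an eigenvalue of the (unbounded) operator `T`. -/
def IsEigenvalue (T : H →ₗ.[ℂ] H) (ν : ℂ) : Prop :=
  ∃ x : T.domain, (x : H) ≠ 0 ∧ T x = ν • (x : H)

/-- The resolvent set of `T`: those `ν` for which `T - ν : dom T → H` is a bijection with bounded
(everywhere defined) inverse `R`. -/
def resolventSet (T : H →ₗ.[ℂ] H) : Set ℂ :=
  {ν | ∃ R : H →L[ℂ] H,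
    (∀ h : H, ∃ x : T.domain, (x : H) = R h ∧ T x - ν • (x : H) = h) ∧
    ∀ x : T.domain, R (T x - ν • (x : H)) = x}

/-- The spectrum of `T`. -/
def spectrum (T : H →ₗ.[ℂ] H) : Set ℂ := (resolventSet T)ᶜ

end Operators

/-! ### The form domain `{f ∈ H¹(ℝ) : x f ∈ L²(ℝ)}` -/

/-- `g` is a weak (distributional) derivative of `f` on `ℝ`. -/
def IsWeakDeriv (f g : ℝ → ℂ) : Prop :=
  ∀ φ : ℝ → ℝ, ContDiff ℝ ∞ φ → HasCompactSupport φ →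
    ∫ x, deriv φ x • f x = - ∫ x, φ x • g x

/-- `f` has a weak derivative in `L²(ℝ)`. -/
def HasL2WeakDeriv (f : ℝ → ℂ) : Prop :=
  ∃ g : ℝ → ℂ, MemLp g 2 volume ∧ IsWeakDeriv f g

open Classical in
/-- The weak derivative in `L²(ℝ)` (unique up to a null set); `0` if there is none. -/
def weakDeriv (f : ℝ → ℂ) : ℝ → ℂ :=
  if h : HasL2WeakDeriv f then h.choose else 0

/-- A test function against a function in `L²(ℝ)` is integrable. -/
theorem integrable_test_smul {f : ℝ → ℂ} (hf : MemLp f 2 volume) {φ : ℝ → ℝ}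
    (hφ : Continuous φ) (hc : HasCompactSupport φ) : Integrable fun x => φ x • f x :=
  (hf.locallyIntegrable (by norm_num)).integrable_smul_left_of_hasCompactSupport hφ hc

theorem IsWeakDeriv.add {f₁ f₂ g₁ g₂ : ℝ → ℂ}
    (hf₁ : MemLp f₁ 2 volume) (hf₂ : MemLp f₂ 2 volume)
    (hg₁ : MemLp g₁ 2 volume) (hg₂ : MemLp g₂ 2 volume)
    (h₁ : IsWeakDeriv f₁ g₁) (h₂ : IsWeakDeriv f₂ g₂) : IsWeakDeriv (f₁ + f₂) (g₁ + g₂) := by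
  intro φ hφ hc
  have hd : Continuous (deriv φ) := hφ.continuous_deriv (by simp)
  simp only [Pi.add_apply, smul_add]
  rw [integral_add (integrable_test_smul hf₁ hd hc.deriv) (integrable_test_smul hf₂ hd hc.deriv),
    integral_add (integrable_test_smul hg₁ hφ.continuous hc)
      (integrable_test_smul hg₂ hφ.continuous hc), h₁ φ hφ hc, h₂ φ hφ hc]
  ring

theorem IsWeakDeriv.smul {f g : ℝ → ℂ} (c : ℂ) (h : IsWeakDeriv f g) :
    IsWeakDeriv (c • f) (c • g) := by
  intro φ hφ hc
  have h' := h φ hφ hc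
  simp only [Pi.smul_apply, smul_comm _ c]
  rw [integral_smul, integral_smul, h', smul_neg]

theorem isWeakDeriv_zero : IsWeakDeriv 0 0 := by
  intro φ _ _
  simp

/-- The form domain. Elements of `H¹(ℝ)` are identified with their continuous representatives,
so that point values make sense. -/
def formDomain : Submodule ℂ (ℝ → ℂ) where
  carrier := {f | Continuous f ∧ MemLp f 2 volume ∧ HasL2WeakDeriv f ∧
    MemLp (fun x : ℝ => (x : ℂ) * f x) 2 volume}
  zero_mem' := ⟨continuous_zero, MemLp.zero, ⟨0, MemLp.zero, isWeakDeriv_zero⟩, by simp⟩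
  add_mem' := by
    rintro f g ⟨hf, hf2, ⟨f', hf', hw⟩, hfx⟩ ⟨hg, hg2, ⟨g', hg', hv⟩, hgx⟩
    refine ⟨hf.add hg, hf2.add hg2, ⟨f' + g', hf'.add hg', hw.add hf2 hg2 hf' hg' hv⟩, ?_⟩
    have := hfx.add hgx
    refine this.congr_norm ?_ ?_
    · exact ((Complex.continuous_ofReal.mul (hf.add hg))).aestronglyMeasurable
    · exact Filter.Eventually.of_forall fun x => by simp [mul_add]
  smul_mem' := by
    rintro c f ⟨hf, hf2, ⟨f', hf', hw⟩, hfx⟩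
    refine ⟨hf.const_smul c, hf2.const_smul c, ⟨c • f', hf'.const_smul c, hw.smul c⟩, ?_⟩
    have := hfx.const_smul c
    refine this.congr_norm ?_ ?_
    · exact ((Complex.continuous_ofReal.mul (hf.const_smul c))).aestronglyMeasurable
    · exact Filter.Eventually.of_forall fun x => by simp [mul_left_comm]

theorem weakDeriv_spec {f : ℝ → ℂ} (hf : HasL2WeakDeriv f) :
    MemLp (weakDeriv f) 2 volume ∧ IsWeakDeriv f (weakDeriv f) := by
  rw [weakDeriv, dif_pos hf]
  exact hf.choose_spec

theorem weakDeriv_ae_eq {f g : ℝ → ℂ} (hg : MemLp g 2 volume) (h : IsWeakDeriv f g) :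
    weakDeriv f =ᵐ[volume] g := by
  have hs := weakDeriv_spec ⟨g, hg, h⟩
  refine ae_eq_of_integral_contDiff_smul_eq (hs.1.locallyIntegrable (by norm_num))
    (hg.locallyIntegrable (by norm_num)) fun φ hφ hc => ?_
  exact neg_injective ((hs.2 φ hφ hc).symm.trans (h φ hφ hc))

/-! ### The form and the operator -/

/-- The sesquilinear form of `-y'' + (x²/4 - 1/2) y + z (δ(x - b) - δ(x + b)) y`. -/
def form (z : ℂ) (b : ℝ) (f g : ℝ → ℂ) : ℂ :=
  (∫ x, weakDeriv f x * conj (weakDeriv g x))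
    + (1 / 4) * (∫ x : ℝ, ((x : ℂ) * f x) * conj ((x : ℂ) * g x))
    - (1 / 2) * (∫ x, f x * conj (g x))
    + z * (f b * conj (g b) - f (-b) * conj (g (-b)))

theorem integrable_mul_conj {f g : ℝ → ℂ} (hf : MemLp f 2 volume) (hg : MemLp g 2 volume) :
    Integrable fun x => f x * conj (g x) :=
  hf.integrable_mul hg.star

theorem form_add_left (z : ℂ) (b : ℝ) {f₁ f₂ g : ℝ → ℂ} (h₁ : f₁ ∈ formDomain)
    (h₂ : f₂ ∈ formDomain) (hg : g ∈ formDomain) :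
    form z b (f₁ + f₂) g = form z b f₁ g + form z b f₂ g := by
  obtain ⟨-, h₁l, h₁d, h₁x⟩ := h₁
  obtain ⟨-, h₂l, h₂d, h₂x⟩ := h₂
  obtain ⟨-, hgl, hgd, hgx⟩ := hg
  have s₁ := weakDeriv_spec h₁d
  have s₂ := weakDeriv_spec h₂d
  have sg := weakDeriv_spec hgd
  have hd := weakDeriv_ae_eq (s₁.1.add s₂.1) (s₁.2.add h₁l h₂l s₁.1 s₂.1 s₂.2)
  have e₁ : ∫ x, weakDeriv (f₁ + f₂) x * conj (weakDeriv g x)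
      = (∫ x, weakDeriv f₁ x * conj (weakDeriv g x))
        + ∫ x, weakDeriv f₂ x * conj (weakDeriv g x) := by
    rw [← integral_add (integrable_mul_conj s₁.1 sg.1) (integrable_mul_conj s₂.1 sg.1)]
    refine integral_congr_ae ?_
    filter_upwards [hd] with x hx
    rw [hx, Pi.add_apply, add_mul]
  have e₂ : ∫ x : ℝ, ((x : ℂ) * (f₁ + f₂) x) * conj ((x : ℂ) * g x)
      = (∫ x : ℝ, ((x : ℂ) * f₁ x) * conj ((x : ℂ) * g x))
        + ∫ x : ℝ, ((x : ℂ) * f₂ x) * conj ((x : ℂ) * g x) := by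
    rw [← integral_add (integrable_mul_conj h₁x hgx) (integrable_mul_conj h₂x hgx)]
    refine integral_congr_ae (Filter.Eventually.of_forall fun x => ?_)
    simp only [Pi.add_apply]
    ring
  have e₃ : ∫ x, (f₁ + f₂) x * conj (g x)
      = (∫ x, f₁ x * conj (g x)) + ∫ x, f₂ x * conj (g x) := by
    rw [← integral_add (integrable_mul_conj h₁l hgl) (integrable_mul_conj h₂l hgl)]
    refine integral_congr_ae (Filter.Eventually.of_forall fun x => ?_)
    simp only [Pi.add_apply]
    ring
  unfold form
  rw [e₁, e₂, e₃]
  simp only [Pi.add_apply]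
  ring

theorem form_smul_left (z : ℂ) (b : ℝ) (c : ℂ) {f g : ℝ → ℂ} (hf : f ∈ formDomain) :
    form z b (c • f) g = c * form z b f g := by
  obtain ⟨-, -, hd, -⟩ := hf
  have s := weakDeriv_spec hd
  have hd := weakDeriv_ae_eq (s.1.const_smul c) (s.2.smul c)
  have e₁ : ∫ x, weakDeriv (c • f) x * conj (weakDeriv g x)
      = c * ∫ x, weakDeriv f x * conj (weakDeriv g x) := by
    rw [← integral_const_mul]
    refine integral_congr_ae ?_
    filter_upwards [hd] with x hx
    rw [hx, Pi.smul_apply, smul_eq_mul, mul_assoc]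
  have e₂ : ∫ x : ℝ, ((x : ℂ) * (c • f) x) * conj ((x : ℂ) * g x)
      = c * ∫ x : ℝ, ((x : ℂ) * f x) * conj ((x : ℂ) * g x) := by
    rw [← integral_const_mul]
    refine integral_congr_ae (Filter.Eventually.of_forall fun x => ?_)
    simp only [Pi.smul_apply, smul_eq_mul]
    ring
  have e₃ : ∫ x, (c • f) x * conj (g x) = c * ∫ x, f x * conj (g x) := by
    rw [← integral_const_mul]
    refine integral_congr_ae (Filter.Eventually.of_forall fun x => ?_)
    simp only [Pi.smul_apply, smul_eq_mul]
    ring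
  unfold form
  rw [e₁, e₂, e₃]
  simp only [Pi.smul_apply, smul_eq_mul]
  ring

/-- The Hilbert space `L²(ℝ)`. -/
abbrev L2 : Type := Lp ℂ 2 (volume : Measure ℝ)

/-- The graph of the operator associated with the form: `(f, h)` belongs to it when `f` lies in
the form domain and `t(f, g) = ⟨h, g⟩` for all `g` in the form domain. -/
def operatorGraph (z : ℂ) (b : ℝ) : Submodule ℂ (L2 × L2) where
  carrier := {p | ∃ f ∈ formDomain, p.1 =ᵐ[volume] f ∧
    ∀ g ∈ formDomain, form z b f g = ∫ x, p.2 x * conj (g x)}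
  zero_mem' := by
    refine ⟨0, formDomain.zero_mem, Lp.coeFn_zero _ _ _, fun g _ => ?_⟩
    have h := form_smul_left z b 0 (g := g) formDomain.zero_mem
    rw [zero_smul, zero_mul] at h
    rw [h]
    symm
    apply integral_eq_zero_of_ae
    filter_upwards [Lp.coeFn_zero ℂ 2 (volume : Measure ℝ)] with x hx
    simp only [Prod.snd_zero, hx, Pi.zero_apply, zero_mul]
  add_mem' := by
    rintro p q ⟨f₁, h₁, e₁, t₁⟩ ⟨f₂, h₂, e₂, t₂⟩
    refine ⟨f₁ + f₂, formDomain.add_mem h₁ h₂, (Lp.coeFn_add _ _).trans (e₁.add e₂),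
      fun g hg => ?_⟩
    rw [form_add_left z b h₁ h₂ hg, t₁ g hg, t₂ g hg,
      ← integral_add (integrable_mul_conj (Lp.memLp _) hg.2.1)
        (integrable_mul_conj (Lp.memLp _) hg.2.1)]
    refine integral_congr_ae ?_
    filter_upwards [Lp.coeFn_add p.2 q.2] with x hx
    rw [Prod.snd_add, hx, Pi.add_apply, add_mul]
  smul_mem' := by
    rintro c p ⟨f, h, e, t⟩
    refine ⟨c • f, formDomain.smul_mem c h, (Lp.coeFn_smul _ _).trans (e.const_smul c),
      fun g hg => ?_⟩
    rw [form_smul_left z b c h, t g hg, ← integral_const_mul]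
    refine integral_congr_ae ?_
    filter_upwards [Lp.coeFn_smul c p.2] with x hx
    rw [Prod.smul_snd, hx, Pi.smul_apply, smul_eq_mul, mul_assoc]

/-- The operator `L_{z,b} = -d²/dx² + (x²/4 - 1/2) + z (δ(x - b) - δ(x + b))` on `L²(ℝ)`, defined
by its form. -/
def operator (z : ℂ) (b : ℝ) : L2 →ₗ.[ℂ] L2 := (operatorGraph z b).toLinearPMap

theorem test_mem_formDomain {φ : ℝ → ℝ} (hφ : ContDiff ℝ ∞ φ) (hc : HasCompactSupport φ) :
    (fun x => (φ x : ℂ)) ∈ formDomain := by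
  have hC : Continuous fun x => (φ x : ℂ) := Complex.continuous_ofReal.comp hφ.continuous
  have hcC : HasCompactSupport fun x => (φ x : ℂ) := hc.comp_left Complex.ofReal_zero
  have hd : Continuous (deriv φ) := hφ.continuous_deriv (by simp)
  have hdC : Continuous fun x => ((deriv φ x : ℝ) : ℂ) := Complex.continuous_ofReal.comp hd
  refine ⟨hC, hC.memLp_of_hasCompactSupport hcC, ⟨fun x => ((deriv φ x : ℝ) : ℂ),
    hdC.memLp_of_hasCompactSupport (hc.deriv.comp_left Complex.ofReal_zero), ?_⟩, ?_⟩
  · intro ψ hψ hψc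
    have hψd : Continuous (deriv ψ) := hψ.continuous_deriv (by simp)
    have key := integral_mul_deriv_eq_deriv_mul_of_integrable (u := φ) (v := ψ)
      (u' := deriv φ) (v' := deriv ψ)
      (fun x _ => (hφ.differentiable (by simp) x).hasDerivAt)
      (fun x _ => (hψ.differentiable (by simp) x).hasDerivAt)
      ((hφ.continuous.mul hψd).integrable_of_hasCompactSupport hc.mul_right)
      ((hd.mul hψ.continuous).integrable_of_hasCompactSupport hc.deriv.mul_right)
      ((hφ.continuous.mul hψ.continuous).integrable_of_hasCompactSupport hc.mul_right)
    have e₁ : ∫ x, deriv ψ x • (φ x : ℂ) = ((∫ x, φ x * deriv ψ x : ℝ) : ℂ) := by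
      rw [← integral_complex_ofReal]
      refine integral_congr_ae (Filter.Eventually.of_forall fun x => ?_)
      simp [mul_comm]
    have e₂ : ∫ x, ψ x • ((deriv φ x : ℝ) : ℂ) = ((∫ x, deriv φ x * ψ x : ℝ) : ℂ) := by
      rw [← integral_complex_ofReal]
      refine integral_congr_ae (Filter.Eventually.of_forall fun x => ?_)
      simp [mul_comm]
    rw [e₁, e₂, key, Complex.ofReal_neg]
  · exact (Complex.continuous_ofReal.mul hC).memLp_of_hasCompactSupport hcC.mul_left

/-- The graph is single-valued, so `operator z b` really has graph `operatorGraph z b`. -/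
theorem operator_graph (z : ℂ) (b : ℝ) : (operator z b).graph = operatorGraph z b := by
  refine Submodule.toLinearPMap_graph_eq _ ?_
  rintro ⟨p, h⟩ ⟨f, hf, e, t⟩ hp
  simp only at hp e t
  subst hp
  have hf0 : f = 0 := by
    refine (hf.1.ae_eq_iff_eq volume continuous_zero).1 ?_
    exact e.symm.trans (Lp.coeFn_zero _ _ _)
  subst hf0
  have ht : ∀ g ∈ formDomain, ∫ x, h x * conj (g x) = 0 := fun g hg => by
    have h0 := form_smul_left z b 0 (g := g) formDomain.zero_mem
    rw [zero_smul, zero_mul] at h0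
    rw [← t g hg, h0]
  rw [Lp.eq_zero_iff_ae_eq_zero]
  refine ae_eq_zero_of_integral_contDiff_smul_eq_zero
    ((Lp.memLp h).locallyIntegrable (by norm_num)) fun φ hφ hc => ?_
  rw [← ht _ (test_mem_formDomain hφ hc)]
  refine integral_congr_ae (Filter.Eventually.of_forall fun x => ?_)
  simp [mul_comm]

/-! ### Parabolic cylinder functions -/

/-- The even solution of `-y'' + (x²/4 - 1/2) y = ν y` with `y(0) = 1`. -/
def yEven (ν x : ℂ) : ℂ :=
  Complex.exp (-x ^ 2 / 4) *
    ∑' k : ℕ, (∏ j ∈ Finset.range k, (-ν + 2 * (j : ℂ))) * (x ^ (2 * k) / ((2 * k).factorial : ℂ))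

/-- The odd solution of `-y'' + (x²/4 - 1/2) y = ν y` with `y'(0) = 1`. -/
def yOdd (ν x : ℂ) : ℂ :=
  Complex.exp (-x ^ 2 / 4) *
    ∑' k : ℕ, (∏ j ∈ Finset.range k, (-ν + (2 * (j : ℂ) + 1))) *
      (x ^ (2 * k + 1) / ((2 * k + 1).factorial : ℂ))

/-- The parabolic cylinder function `D_ν(x)`: the solution of `-y'' + (x²/4 - 1/2) y = ν y` with
`y(0) = 2^{ν/2} √π / Γ((1-ν)/2)` and `y'(0) = -2^{(ν+1)/2} √π / Γ(-ν/2)`. The quotient by `Γ` is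
`0` at the poles of `Γ`, in accordance with `1/Γ` being entire. -/
def parabolicD (ν x : ℂ) : ℂ :=
  (2 : ℂ) ^ (ν / 2) * (√Real.pi : ℂ) / Complex.Gamma (-ν / 2 + 1 / 2) * yEven ν x
    - (2 : ℂ) ^ ((ν + 1) / 2) * (√Real.pi : ℂ) / Complex.Gamma (-ν / 2) * yOdd ν x

/-- `M(ν; b) = √(2/π) Γ(-ν) D_ν(b)² y_even(ν, b) y_odd(ν, b)`, meaningful for `ν ∉ ℕ₀`. -/
def M (ν : ℂ) (b : ℝ) : ℂ :=
  (√(2 / Real.pi) : ℂ) * Complex.Gamma (-ν) * parabolicD ν b ^ 2 * yEven ν b * yOdd ν b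

end PointInteraction

end

/-! Away from `±b` an eigenfunction solves `-y'' + (x²/4 - 1/2) y = ν y`, and one expects it to be a
multiple of `D_ν(-x)` left of `-b` and of `D_ν(x)` right of `b`. The form encodes continuity and the
derivative jumps `-z y(-b)` at `-b` and `z y(b)` at `b`. Continue `D_ν(-x)` through both jumps:
matching `D_ν` beyond `b` means that a Wronskian vanishes. `wronskian_eq_charFun` computes it in the
basis `yEven`, `yOdd`, whose Wronskian is `1`. The part free of `z` is `2 dEven dOdd = √(2π) /
Γ(-ν)` by Legendre duplication, the terms linear in `z` cancel because the two strengths are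
opposite, and the quadratic term is `-2 z² D_ν(b)² yEven yOdd`. Altogether this is `√(2π) ·
charFun`.

If `charFun` vanishes, the glued function is an eigenfunction (`exists_eigenfunction`). It lies in
the form domain because `D_ν` and its derivative decay at `+∞`: for `Re ν < 0` an integral
representation bounds `D_ν`, and the three-term recurrence carries the bound to all `ν`.

If `charFun` does not vanish, a Green function with kink at any `y ≠ ±b` can be glued from the
decaying solutions. Testing the weak eigenvalue equation for `f` against its conjugate leaves `f(y)
· w = 0` with `w ≠ 0`, hence `f = 0` (`eq_zero_of_form_eq`). No knowledge of growing solutions is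
needed.

Injectivity gives surjectivity by a Fredholm argument. On the Hilbert space of triples `(f, f', x
f)`, the shifted form is coercive on functions vanishing at `±b` and on a fine finite grid
(`exists_grid`), a subspace of finite codimension, so `surjective_of_coercive_on_ker` applies. Thus
the spectrum lies in the zero set of `charFun`, which lies in the set of eigenvalues, which lies in
the spectrum.

For `ν ∉ ℕ₀`, multiplication by `Γ(-ν)` turns `charFun` into `1 - z² M`. The pole of `M` at `0` is
that of `Γ(-ν)`, since the remaining factor is entire and nonzero there. Reality follows from
invariance under conjugation. -/

noncomputable section

namespace PointInteraction

/-! ### The power series of the parabolic cylinder functions -/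

/-- The product `∏_{j<k} (2j - ν)`. -/
def evenCoeff (ν : ℂ) (k : ℕ) : ℂ := ∏ j ∈ Finset.range k, (-ν + 2 * (j : ℂ))

/-- The polynomial factor of `yEven`. -/
def evenSeries (ν x : ℂ) : ℂ :=
  ∑' k : ℕ, evenCoeff ν k * (x ^ (2 * k) / ((2 * k).factorial : ℂ))

/-- The polynomial factor of `yOdd`. -/
def oddSeries (ν x : ℂ) : ℂ :=
  ∑' k : ℕ, evenCoeff (ν - 1) k * (x ^ (2 * k + 1) / ((2 * k + 1).factorial : ℂ))

theorem yEven_eq (ν x : ℂ) : yEven ν x = Complex.exp (-x ^ 2 / 4) * evenSeries ν x := rfl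

theorem yOdd_eq (ν x : ℂ) : yOdd ν x = Complex.exp (-x ^ 2 / 4) * oddSeries ν x := by
  unfold yOdd oddSeries evenCoeff
  congr 1
  refine tsum_congr fun k => ?_
  congr 1
  refine Finset.prod_congr rfl fun j _ => ?_
  ring

theorem evenCoeff_zero (ν : ℂ) : evenCoeff ν 0 = 1 := by simp [evenCoeff]

theorem evenCoeff_succ (ν : ℂ) (k : ℕ) :
    evenCoeff ν (k + 1) = evenCoeff ν k * (-ν + 2 * k) := by
  simp [evenCoeff, Finset.prod_range_succ]

/-- Splitting off the first factor instead of the last shifts `ν` by 2. This shift is what produces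
the ladder and recurrence relations. -/
theorem evenCoeff_succ' (ν : ℂ) (k : ℕ) :
    evenCoeff ν (k + 1) = -ν * evenCoeff (ν - 2) k := by
  rw [evenCoeff, Finset.prod_range_succ', mul_comm, evenCoeff]
  congr 1
  · simp
  · refine Finset.prod_congr rfl fun j _ => ?_
    push_cast
    ring

/-- Each new factor of the product grows like `2k`, while `(2k)!` gains `(2k+1)(2k+2)`. The bound is
uniform for `ν` in a disc, so it serves both differentiation in `x` and holomorphy in `ν`. -/
theorem norm_evenCoeff_div_le {ν : ℂ} {r : ℝ} (hν : ‖ν‖ ≤ r) (k : ℕ) :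
    ‖evenCoeff ν k‖ / ((2 * k).factorial : ℝ) ≤ (r + 1) ^ k / (k.factorial : ℝ) := by
  have hr : 0 ≤ r := (norm_nonneg ν).trans hν
  induction k with
  | zero => simp [evenCoeff_zero]
  | succ k ih =>
    have h1 : ‖-ν + 2 * (k : ℂ)‖ ≤ r + 2 * k := by
      refine (norm_add_le _ _).trans ?_
      simp only [norm_neg, norm_mul, Complex.norm_ofNat, Complex.norm_natCast]
      linarith
    have h2 : ‖-ν + 2 * (k : ℂ)‖ / ((2 * k + 1) * (2 * k + 2)) ≤ (r + 1) / (k + 1) := by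
      rw [div_le_div_iff₀ (by positivity) (by positivity)]
      have hk : (0 : ℝ) ≤ k := by positivity
      calc ‖-ν + 2 * (k : ℂ)‖ * (k + 1) ≤ (r + 2 * k) * (k + 1) := by gcongr
        _ ≤ (r + 1) * ((2 * k + 1) * (2 * k + 2)) := by nlinarith [mul_nonneg hr hk]
    have h3 := mul_le_mul ih h2 (by positivity) (by positivity)
    have hf : (((2 * (k + 1)).factorial : ℕ) : ℝ)
        = (2 * k).factorial * ((2 * k + 1) * (2 * k + 2)) := by
      rw [show 2 * (k + 1) = (2 * k + 1) + 1 by ring, Nat.factorial_succ, Nat.factorial_succ]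
      push_cast
      ring
    have hg : (((k + 1).factorial : ℕ) : ℝ) = k.factorial * (k + 1) := by
      rw [Nat.factorial_succ]
      push_cast
      ring
    rw [evenCoeff_succ, norm_mul, hf, hg, pow_succ, mul_div_mul_comm, mul_div_mul_comm]
    exact h3

theorem norm_even_term_le {ν x : ℂ} {r R : ℝ} (hν : ‖ν‖ ≤ r) (hx : ‖x‖ ≤ R) (k : ℕ) :
    ‖evenCoeff ν k * (x ^ (2 * k) / ((2 * k).factorial : ℂ))‖
      ≤ ((r + 1) * R ^ 2) ^ k / (k.factorial : ℝ) := by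
  have h := norm_evenCoeff_div_le hν k
  have hp : ‖x‖ ^ (2 * k) ≤ (R ^ 2) ^ k := by
    rw [pow_mul]
    gcongr
  have hr : 0 ≤ r := (norm_nonneg ν).trans hν
  calc ‖evenCoeff ν k * (x ^ (2 * k) / ((2 * k).factorial : ℂ))‖
      = ‖evenCoeff ν k‖ / ((2 * k).factorial : ℝ) * ‖x‖ ^ (2 * k) := by
        rw [norm_mul, norm_div, norm_pow, Complex.norm_natCast]
        ring
    _ ≤ (r + 1) ^ k / (k.factorial : ℝ) * (R ^ 2) ^ k := by gcongr
    _ = _ := by rw [mul_pow]; ring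

theorem norm_odd_term_le {ν x : ℂ} {r R : ℝ} (hν : ‖ν‖ ≤ r) (hx : ‖x‖ ≤ R) (k : ℕ) :
    ‖evenCoeff ν k * (x ^ (2 * k + 1) / ((2 * k + 1).factorial : ℂ))‖
      ≤ R * (((r + 1) * R ^ 2) ^ k / (k.factorial : ℝ)) := by
  have h := norm_even_term_le hν hx k
  have hR : 0 ≤ R := (norm_nonneg x).trans hx
  have hr : 0 ≤ r := (norm_nonneg ν).trans hν
  have hfac : (((2 * k).factorial : ℕ) : ℝ) ≤ ((2 * k + 1).factorial : ℕ) := by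
    exact_mod_cast Nat.factorial_le (by omega)
  calc ‖evenCoeff ν k * (x ^ (2 * k + 1) / ((2 * k + 1).factorial : ℂ))‖
      = ‖evenCoeff ν k‖ * (‖x‖ ^ (2 * k) / ((2 * k + 1).factorial : ℝ)) * ‖x‖ := by
        rw [norm_mul, norm_div, norm_pow, Complex.norm_natCast]
        ring
    _ ≤ ‖evenCoeff ν k‖ * (‖x‖ ^ (2 * k) / ((2 * k).factorial : ℝ)) * R := by gcongr
    _ = ‖evenCoeff ν k * (x ^ (2 * k) / ((2 * k).factorial : ℂ))‖ * R := by
        rw [norm_mul, norm_div, norm_pow, Complex.norm_natCast]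
    _ ≤ _ := by
        rw [mul_comm R]
        gcongr

theorem summable_even (ν x : ℂ) :
    Summable fun k : ℕ => evenCoeff ν k * (x ^ (2 * k) / ((2 * k).factorial : ℂ)) :=
  Summable.of_norm_bounded (Real.summable_pow_div_factorial _)
    (norm_even_term_le le_rfl le_rfl)

theorem summable_odd (ν x : ℂ) :
    Summable fun k : ℕ => evenCoeff ν k * (x ^ (2 * k + 1) / ((2 * k + 1).factorial : ℂ)) :=
  Summable.of_norm_bounded ((Real.summable_pow_div_factorial _).mul_left _)
    (norm_odd_term_le le_rfl le_rfl)

theorem hasDerivAt_oddSeries (ν x : ℂ) :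
    HasDerivAt (oddSeries ν) (evenSeries (ν - 1) x) x := by
  refine hasDerivAt_tsum_of_isPreconnected (t := Metric.ball 0 (‖x‖ + 1)) (y₀ := x)
    (g' := fun k y => evenCoeff (ν - 1) k * (y ^ (2 * k) / ((2 * k).factorial : ℂ)))
    (Real.summable_pow_div_factorial ((‖ν - 1‖ + 1) * (‖x‖ + 1) ^ 2)) Metric.isOpen_ball
    (convex_ball _ _).isPreconnected (fun k y _ => ?_) (fun k y hy => ?_) (by simp)
    (summable_odd _ _) (by simp)
  · have h := ((hasDerivAt_pow (2 * k + 1) y).div_const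
      (((2 * k + 1).factorial : ℕ) : ℂ)).const_mul (evenCoeff (ν - 1) k)
    convert! h using 2
    rw [Nat.factorial_succ]
    have : ((2 * k + 1 : ℕ) : ℂ) ≠ 0 := Nat.cast_ne_zero.2 (by omega)
    have h2 : ((2 * k).factorial : ℂ) ≠ 0 := Nat.cast_ne_zero.2 (Nat.factorial_ne_zero _)
    simp only [Nat.add_sub_cancel, Nat.cast_mul]
    field_simp
  · exact norm_even_term_le le_rfl (by simpa using (Metric.mem_ball.1 hy).le) k

/-- The constant term is removed before differentiating, so that the derivatives of the remaining
terms are, index by index, the terms of an odd series with `ν` lowered by 1. -/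
theorem hasDerivAt_evenSeries (ν x : ℂ) :
    HasDerivAt (evenSeries ν) (-ν * oddSeries (ν - 1) x) x := by
  have hshift : evenSeries ν = fun y => 1 + ∑' k : ℕ,
      -ν * (evenCoeff (ν - 2) k * (y ^ (2 * k + 2) / ((2 * k + 2).factorial : ℂ))) := by
    funext y
    rw [evenSeries, (summable_even ν y).tsum_eq_zero_add]
    congr 1
    · simp [evenCoeff_zero]
    · refine tsum_congr fun k => ?_
      rw [evenCoeff_succ', mul_assoc]
      rfl
  rw [hshift, oddSeries, ← tsum_mul_left]
  refine HasDerivAt.const_add 1 ?_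
  have hsum : Summable fun k : ℕ =>
      -ν * (evenCoeff (ν - 2) k * (x ^ (2 * k + 2) / ((2 * k + 2).factorial : ℂ))) := by
    refine ((summable_nat_add_iff 1).2 (summable_even ν x)).congr fun k => ?_
    rw [evenCoeff_succ', mul_assoc]
    rfl
  refine hasDerivAt_tsum_of_isPreconnected (t := Metric.ball 0 (‖x‖ + 1)) (y₀ := x)
    (g' := fun k y => -ν * (evenCoeff (ν - 1 - 1) k *
      (y ^ (2 * k + 1) / ((2 * k + 1).factorial : ℂ))))
    (((Real.summable_pow_div_factorial ((‖ν - 1 - 1‖ + 1) * (‖x‖ + 1) ^ 2)).mul_left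
      (‖x‖ + 1)).mul_left ‖ν‖) Metric.isOpen_ball
    (convex_ball _ _).isPreconnected (fun k y _ => ?_) (fun k y hy => ?_) (by simp)
    hsum (by simp)
  · have h := (((hasDerivAt_pow (2 * k + 2) y).div_const
      (((2 * k + 2).factorial : ℕ) : ℂ)).const_mul (evenCoeff (ν - 2) k)).const_mul (-ν)
    convert! h using 2
    rw [sub_sub, one_add_one_eq_two, Nat.factorial_succ (2 * k + 1)]
    have : ((2 * k + 1 + 1 : ℕ) : ℂ) ≠ 0 := Nat.cast_ne_zero.2 (by omega)
    have h2 : ((2 * k + 1).factorial : ℂ) ≠ 0 := Nat.cast_ne_zero.2 (Nat.factorial_ne_zero _)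
    simp only [show 2 * k + 2 - 1 = 2 * k + 1 by omega, show 2 * k + 2 = 2 * k + 1 + 1 by omega,
      Nat.cast_mul]
    field_simp
  · rw [norm_mul, norm_neg]
    gcongr
    exact norm_odd_term_le le_rfl (by simpa using (Metric.mem_ball.1 hy).le) k

/-- Coefficientwise, `-ν + 2k` from the first series and `1 + ν` from the second add up to `2k + 1`,
which turns `(2k+1)!` into `(2k)!`. -/
theorem evenSeries_recurrence (ν x : ℂ) :
    x * evenSeries ν x = -ν * oddSeries (ν - 1) x + (1 + ν) * oddSeries (ν + 1) x := by
  simp only [evenSeries, oddSeries, ← tsum_mul_left, add_sub_cancel_right]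
  rw [← ((summable_odd _ _).mul_left _).tsum_add ((summable_odd _ _).mul_left _)]
  refine tsum_congr fun k => ?_
  rw [← mul_assoc (-ν), sub_sub, one_add_one_eq_two, ← evenCoeff_succ', evenCoeff_succ,
    Nat.factorial_succ]
  have : ((2 * k + 1 : ℕ) : ℂ) ≠ 0 := Nat.cast_ne_zero.2 (by omega)
  have h2 : ((2 * k).factorial : ℂ) ≠ 0 := Nat.cast_ne_zero.2 (Nat.factorial_ne_zero _)
  simp only [Nat.cast_mul]
  field_simp
  push_cast
  ring

/-- The constant terms cancel. For the others, one product is expanded at its last factor and one at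
its first; the difference `(1 - ν + 2k) + (ν + 1) = 2k + 2` cancels against the factorial. -/
theorem oddSeries_recurrence (ν x : ℂ) :
    x * oddSeries ν x = evenSeries (ν - 1) x - evenSeries (ν + 1) x := by
  simp only [evenSeries, oddSeries, ← tsum_mul_left]
  rw [← (summable_even _ _).tsum_sub (summable_even _ _),
    ((summable_even (ν - 1) x).sub (summable_even (ν + 1) x)).tsum_eq_zero_add]
  simp only [evenCoeff_zero, sub_self, zero_add]
  refine tsum_congr fun k => ?_
  rw [evenCoeff_succ, evenCoeff_succ', show ν + 1 - 2 = ν - 1 by ring,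
    show 2 * (k + 1) = 2 * k + 1 + 1 by ring, Nat.factorial_succ (2 * k + 1)]
  have : ((2 * k + 1 + 1 : ℕ) : ℂ) ≠ 0 := Nat.cast_ne_zero.2 (by omega)
  have h2 : ((2 * k + 1).factorial : ℂ) ≠ 0 := Nat.cast_ne_zero.2 (Nat.factorial_ne_zero _)
  simp only [Nat.cast_mul]
  field_simp
  push_cast
  ring

theorem differentiable_evenCoeff (k : ℕ) : Differentiable ℂ fun ν => evenCoeff ν k := by
  unfold evenCoeff
  fun_prop

theorem differentiable_evenSeries (x : ℂ) : Differentiable ℂ fun ν => evenSeries ν x := by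
  intro ν
  refine DifferentiableOn.differentiableAt (s := Metric.ball 0 (‖ν‖ + 1)) ?_
    (Metric.isOpen_ball.mem_nhds (by simp))
  exact Complex.differentiableOn_tsum_of_summable_norm (Real.summable_pow_div_factorial _)
    (fun k => ((differentiable_evenCoeff k).mul_const _).differentiableOn) Metric.isOpen_ball
    fun k w hw => norm_even_term_le (by simpa using (Metric.mem_ball.1 hw).le) le_rfl k

theorem differentiable_oddSeries (x : ℂ) : Differentiable ℂ fun ν => oddSeries ν x := by
  have h : Differentiable ℂ fun ν : ℂ =>
      ∑' k : ℕ, evenCoeff ν k * (x ^ (2 * k + 1) / ((2 * k + 1).factorial : ℂ)) := by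
    intro ν
    refine DifferentiableOn.differentiableAt (s := Metric.ball 0 (‖ν‖ + 1)) ?_
      (Metric.isOpen_ball.mem_nhds (by simp))
    exact Complex.differentiableOn_tsum_of_summable_norm
      ((Real.summable_pow_div_factorial _).mul_left _)
      (fun k => ((differentiable_evenCoeff k).mul_const _).differentiableOn) Metric.isOpen_ball
      fun k w hw => norm_odd_term_le (by simpa using (Metric.mem_ball.1 hw).le) le_rfl k
  exact h.comp (differentiable_id.sub_const 1)

/-! ### Ladder relations and values -/

theorem hasDerivAt_gaussian (x : ℂ) :
    HasDerivAt (fun y : ℂ => Complex.exp (-y ^ 2 / 4)) (-(x / 2) * Complex.exp (-x ^ 2 / 4)) x := by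
  have h := (((hasDerivAt_pow 2 x).neg).div_const 4).cexp
  convert! h using 1
  simp
  ring

theorem hasDerivAt_yEven (ν x : ℂ) :
    HasDerivAt (yEven ν) (-(x / 2) * yEven ν x - ν * yOdd (ν - 1) x) x := by
  have h := (hasDerivAt_gaussian x).mul (hasDerivAt_evenSeries ν x)
  convert! h using 1
  rw [yEven_eq, yOdd_eq]
  ring

theorem hasDerivAt_yOdd (ν x : ℂ) :
    HasDerivAt (yOdd ν) (-(x / 2) * yOdd ν x + yEven (ν - 1) x) x := by
  have h := (hasDerivAt_gaussian x).mul (hasDerivAt_oddSeries ν x)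
  rw [show yOdd ν = (fun y : ℂ => Complex.exp (-y ^ 2 / 4)) * oddSeries ν from
    funext fun y => yOdd_eq ν y]
  convert! h using 1
  simp only [yEven_eq, Pi.mul_apply]
  ring

theorem yEven_recurrence (ν x : ℂ) :
    x * yEven ν x = -ν * yOdd (ν - 1) x + (1 + ν) * yOdd (ν + 1) x := by
  simp only [yEven_eq, yOdd_eq]
  linear_combination Complex.exp (-x ^ 2 / 4) * evenSeries_recurrence ν x

theorem yOdd_recurrence (ν x : ℂ) : x * yOdd ν x = yEven (ν - 1) x - yEven (ν + 1) x := by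
  simp only [yEven_eq, yOdd_eq]
  linear_combination Complex.exp (-x ^ 2 / 4) * oddSeries_recurrence ν x

theorem yEven_zero (ν : ℂ) : yEven ν 0 = 1 := by
  rw [yEven_eq, evenSeries, tsum_eq_single 0]
  · simp [evenCoeff_zero]
  · intro k hk
    simp [hk]

theorem yOdd_zero (ν : ℂ) : yOdd ν 0 = 0 := by
  simp [yOdd_eq, oddSeries]

theorem yEven_neg (ν x : ℂ) : yEven ν (-x) = yEven ν x := by
  simp [yEven, pow_mul]

theorem yOdd_neg (ν x : ℂ) : yOdd ν (-x) = -yOdd ν x := by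
  simp only [yOdd_eq, oddSeries, neg_sq, ← mul_neg, ← tsum_neg]
  congr 1
  refine tsum_congr fun k => ?_
  rw [(odd_two_mul_add_one k).neg_pow]
  ring

theorem conj_yEven (ν : ℂ) (x : ℝ) : conj (yEven ν x) = yEven (conj ν) x := by
  simp only [yEven_eq, evenSeries, evenCoeff, map_mul, Complex.conj_tsum, ← Complex.exp_conj,
    map_prod, map_div₀, map_pow, map_neg, map_add, Complex.conj_ofReal, Complex.conj_natCast,
    Complex.conj_ofNat]

theorem conj_yOdd (ν : ℂ) (x : ℝ) : conj (yOdd ν x) = yOdd (conj ν) x := by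
  simp only [yOdd_eq, oddSeries, evenCoeff, map_mul, Complex.conj_tsum, ← Complex.exp_conj,
    map_prod, map_div₀, map_pow, map_neg, map_add, map_sub, map_one, Complex.conj_ofReal,
    Complex.conj_natCast, Complex.conj_ofNat]

/-! ### The parabolic cylinder function -/

/-- The value `D_ν(0)`. -/
def dEven (ν : ℂ) : ℂ :=
  (2 : ℂ) ^ (ν / 2) * (√Real.pi : ℂ) / Complex.Gamma (-ν / 2 + 1 / 2)

/-- The value `-D_ν'(0)`. -/
def dOdd (ν : ℂ) : ℂ :=
  (2 : ℂ) ^ ((ν + 1) / 2) * (√Real.pi : ℂ) / Complex.Gamma (-ν / 2)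

theorem parabolicD_eq (ν x : ℂ) : parabolicD ν x = dEven ν * yEven ν x - dOdd ν * yOdd ν x := rfl

theorem dEven_add_one (ν : ℂ) : dEven (ν + 1) = dOdd ν := by
  rw [dEven, dOdd, show -(ν + 1) / 2 + 1 / 2 = -ν / 2 by ring]

/-- The functional equation is used for `1/Γ`, where it holds without exception, so poles of `Γ`
need no separate treatment. -/
theorem dOdd_add_one (ν : ℂ) : dOdd (ν + 1) = -(1 + ν) * dEven ν := by
  have h := Complex.one_div_Gamma_eq_self_mul_one_div_Gamma_add_one (-(ν + 1) / 2)
  rw [show -(ν + 1) / 2 + 1 = -ν / 2 + 1 / 2 by ring] at h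
  rw [dOdd, dEven, show (ν + 1 + 1) / 2 = ν / 2 + 1 by ring,
    Complex.cpow_add _ _ two_ne_zero, Complex.cpow_one, div_eq_mul_inv, h]
  ring

theorem dEven_eq (ν : ℂ) : dEven ν = dOdd (ν - 1) := by
  simpa using dEven_add_one (ν - 1)

theorem dOdd_eq (ν : ℂ) : dOdd ν = -ν * dEven (ν - 1) := by
  simpa using dOdd_add_one (ν - 1)

/-- Both vanish only if `-ν/2` and `-ν/2 + 1/2` are both nonpositive integers; they differ by `1/2`,
which doubling turns into a parity contradiction. -/
theorem dEven_ne_zero_or (ν : ℂ) : dEven ν ≠ 0 ∨ dOdd ν ≠ 0 := by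
  have hpi : (√Real.pi : ℂ) ≠ 0 := by
    exact_mod_cast (Real.sqrt_pos.2 Real.pi_pos).ne'
  have h2 : ∀ w : ℂ, (2 : ℂ) ^ w ≠ 0 := fun w => by simp [Complex.cpow_eq_zero_iff]
  by_contra! h
  simp only [dEven, dOdd, div_eq_zero_iff, mul_eq_zero, hpi, h2, or_false, false_or,
    Complex.Gamma_eq_zero_iff] at h
  obtain ⟨⟨m, hm⟩, n, hn⟩ := h
  have h1 : ((2 * m + 1 : ℤ) : ℂ) = ((2 * n : ℤ) : ℂ) := by
    push_cast
    linear_combination 2 * hm - 2 * hn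
  have := Int.cast_injective h1
  omega

/-- Legendre's duplication formula at `-ν/2`. It stays valid at poles of `Γ`, where the default
value `0` makes the inverses vanish, and it is the origin of `1/Γ(-ν)` in the eigenvalue equation.
-/
theorem sqrt_two_pi_mul_inv_Gamma (ν : ℂ) :
    (√(2 * Real.pi) : ℂ) * (Complex.Gamma (-ν))⁻¹ = 2 * (dEven ν * dOdd ν) := by
  have h := Complex.Gamma_mul_Gamma_add_half (-ν / 2)
  rw [show 2 * (-ν / 2) = -ν by ring] at h
  have hpi : (√Real.pi : ℂ) * (√Real.pi : ℂ) = Real.pi := by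
    exact_mod_cast Real.mul_self_sqrt Real.pi_pos.le
  have hpi0 : (√Real.pi : ℂ) ≠ 0 := by
    exact_mod_cast (Real.sqrt_pos.2 Real.pi_pos).ne'
  have hs : ((√(2 * Real.pi) : ℝ) : ℂ) = (2 : ℂ) ^ (1 / 2 : ℂ) * (√Real.pi : ℂ) := by
    rw [Real.sqrt_mul zero_le_two, Real.sqrt_eq_rpow 2, Complex.ofReal_mul,
      Complex.ofReal_cpow zero_le_two]
    norm_num
  have h2 : ∀ w : ℂ, (2 : ℂ) ^ w ≠ 0 := fun w => by simp [Complex.cpow_eq_zero_iff]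
  have e1 : (2 : ℂ) ^ ((ν + 1) / 2) = 2 ^ (ν / 2) * 2 ^ (1 / 2 : ℂ) := by
    rw [← Complex.cpow_add _ _ two_ne_zero]
    ring_nf
  have e2 : (2 : ℂ) ^ (1 - -ν) = 2 * (2 ^ (ν / 2) * 2 ^ (ν / 2)) := by
    rw [← Complex.cpow_add _ _ two_ne_zero, sub_neg_eq_add, Complex.cpow_add _ _ two_ne_zero,
      Complex.cpow_one]
    ring_nf
  have hinv : (Complex.Gamma (-ν / 2))⁻¹ * (Complex.Gamma (-ν / 2 + 1 / 2))⁻¹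
      = (Complex.Gamma (-ν))⁻¹ * (2 ^ (1 - -ν))⁻¹ * (√Real.pi : ℂ)⁻¹ := by
    rw [← mul_inv, h, mul_inv, mul_inv]
  calc (√(2 * Real.pi) : ℂ) * (Complex.Gamma (-ν))⁻¹
      = 2 * 2 ^ (ν / 2) * 2 ^ ((ν + 1) / 2) * ((√Real.pi : ℂ) * (√Real.pi : ℂ)) *
        ((Complex.Gamma (-ν))⁻¹ * (2 ^ (1 - -ν))⁻¹ * (√Real.pi : ℂ)⁻¹) := by
        rw [hs, e1, e2]
        have := h2 (ν / 2)
        field_simp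
    _ = _ := by
        rw [← hinv, dEven, dOdd, div_eq_mul_inv, div_eq_mul_inv]
        ring

theorem hasDerivAt_parabolicD (ν x : ℂ) :
    HasDerivAt (parabolicD ν) (-(x / 2) * parabolicD ν x + ν * parabolicD (ν - 1) x) x := by
  have h := ((hasDerivAt_yEven ν x).const_mul (dEven ν)).sub
    ((hasDerivAt_yOdd ν x).const_mul (dOdd ν))
  convert! h using 1
  rw [parabolicD_eq, parabolicD_eq, ← dEven_eq]
  linear_combination yEven (ν - 1) x * dOdd_eq ν

theorem parabolicD_add_one (ν x : ℂ) :
    parabolicD (ν + 1) x = x * parabolicD ν x - ν * parabolicD (ν - 1) x := by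
  simp only [parabolicD_eq, dEven_add_one, dOdd_add_one, ← dEven_eq]
  linear_combination (-dEven ν) * yEven_recurrence ν x + dOdd ν * yOdd_recurrence ν x
    + yEven (ν - 1) x * dOdd_eq ν

/-! ### Integral representation and decay -/

/-- Each step of `Γ(w + 1) = w Γ(w)`, with its factor 2, contributes `2 (s/2 + k) = s + 2k`. Thus
Gaussian moments reproduce the power series coefficients. -/
theorem two_cpow_mul_Gamma_add_nat {s : ℂ} (hs : 0 < s.re) (k : ℕ) :
    (2 : ℂ) ^ (s / 2 + k) * Complex.Gamma (s / 2 + k)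
      = 2 ^ (s / 2) * Complex.Gamma (s / 2) * evenCoeff (-s) k := by
  induction k with
  | zero => simp [evenCoeff_zero]
  | succ k ih =>
    have hne : s / 2 + k ≠ 0 := by
      intro h0
      have h1 := congrArg Complex.re h0
      have h2 : (s / 2 + (k : ℂ)).re = s.re / 2 + k := by simp
      rw [h2] at h1
      have : (0 : ℝ) ≤ k := by positivity
      simp only [Complex.zero_re] at h1
      linarith
    rw [evenCoeff_succ, ← mul_assoc, ← ih, Nat.cast_succ, ← add_assoc, Complex.Gamma_add_one _ hne,
      Complex.cpow_add _ _ two_ne_zero, Complex.cpow_one]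
    ring

/-- The Gamma integral with rate `1/2`, after the substitution of `t ^ 2` for the variable. -/
theorem integral_cpow_mul_gaussian {s : ℂ} (hs : 0 < s.re) :
    ∫ t : ℝ in Set.Ioi 0, (t : ℂ) ^ (s - 1) * Complex.exp (-(t : ℂ) ^ 2 / 2)
      = 1 / 2 * ((2 : ℂ) ^ (s / 2) * Complex.Gamma (s / 2)) := by
  have h1 := Complex.integral_cpow_mul_exp_neg_mul_Ioi (a := s / 2) (r := 1 / 2)
    (by simpa using hs) (by norm_num)
  rw [← integral_comp_rpow_Ioi (p := 2) _ two_ne_zero] at h1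
  have h2 : (1 / ((1 / 2 : ℝ) : ℂ)) = 2 := by norm_num
  rw [h2] at h1
  rw [← h1, ← integral_const_mul]
  refine setIntegral_congr_fun measurableSet_Ioi fun t ht => ?_
  have ht' : (t : ℂ) ≠ 0 := Complex.ofReal_ne_zero.2 (ne_of_gt ht)
  have e1 : ((t ^ (2 : ℝ) : ℝ) : ℂ) = (t : ℂ) ^ 2 := by norm_num
  have e2 : ((t : ℂ) ^ 2) ^ (s / 2 - 1) = (t : ℂ) ^ (s - 2) := by
    rw [pow_two, Complex.mul_cpow_ofReal_nonneg (le_of_lt ht) (le_of_lt ht),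
      ← Complex.cpow_add _ _ ht']
    ring_nf
  simp only [e1, e2]
  rw [show s - 1 = (s - 2) + 1 by ring, Complex.cpow_add _ _ ht', Complex.cpow_one,
    Complex.real_smul]
  norm_num
  ring_nf

theorem integrableOn_rpow_mul_gaussian {σ : ℝ} (hσ : 0 < σ) (a : ℝ) :
    IntegrableOn (fun t : ℝ => t ^ (σ - 1) * Real.exp (a * t - t ^ 2 / 2)) (Set.Ioi 0) := by
  have h := (Real.GammaIntegral_convergent hσ).const_mul (Real.exp ((a + 1) ^ 2 / 2))
  refine Integrable.mono' h ?_ ?_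
  · refine ContinuousOn.aestronglyMeasurable ?_ measurableSet_Ioi
    refine ContinuousOn.mul (fun t ht => ?_) (by fun_prop)
    exact (Real.continuousAt_rpow_const _ _ (Or.inl (ne_of_gt ht))).continuousWithinAt
  · refine (ae_restrict_iff' measurableSet_Ioi).2 (Filter.Eventually.of_forall fun t ht => ?_)
    have ht0 : 0 ≤ t ^ (σ - 1) := Real.rpow_nonneg (le_of_lt ht) _
    rw [Real.norm_of_nonneg (by positivity)]
    calc t ^ (σ - 1) * Real.exp (a * t - t ^ 2 / 2)
        ≤ t ^ (σ - 1) * Real.exp ((a + 1) ^ 2 / 2 + -t) := by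
          gcongr
          -- Completing the square: `a t - t²/2 ≤ (a+1)²/2 - t`, so a Gamma integrand dominates.
          nlinarith [sq_nonneg (t - (a + 1))]
      _ = _ := by
          rw [Real.exp_add]
          ring

theorem norm_cpow_mul_gaussian {s : ℂ} {t : ℝ} (ht : 0 < t) :
    ‖(t : ℂ) ^ (s - 1) * Complex.exp (-(t : ℂ) ^ 2 / 2)‖
      = t ^ (s.re - 1) * Real.exp (-t ^ 2 / 2) := by
  rw [norm_mul, Complex.norm_cpow_eq_rpow_re_of_pos ht, Complex.norm_exp]
  norm_cast

theorem aestronglyMeasurable_cpow_mul_gaussian (s : ℂ) :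
    AEStronglyMeasurable (fun t : ℝ => (t : ℂ) ^ (s - 1) * Complex.exp (-(t : ℂ) ^ 2 / 2))
      (volume.restrict (Set.Ioi 0)) := by
  refine ContinuousOn.aestronglyMeasurable ?_ measurableSet_Ioi
  refine ContinuousOn.mul (fun t ht => ?_) (by fun_prop)
  exact (Complex.continuousAt_ofReal_cpow_const t _ (Or.inr (ne_of_gt ht))).continuousWithinAt

/-- Expand `exp(-x t)` under the integral; the absolute values of the terms sum to a Gaussian times
`exp(|x| t)`, which is still integrable. -/
theorem hasSum_integral_cpow_mul_gaussian_mul_exp {s : ℂ} (hs : 0 < s.re) (x : ℝ) :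
    HasSum (fun k : ℕ => (-x : ℂ) ^ k / (k.factorial : ℂ) *
        ∫ t : ℝ in Set.Ioi 0, (t : ℂ) ^ (s + k - 1) * Complex.exp (-(t : ℂ) ^ 2 / 2))
      (∫ t : ℝ in Set.Ioi 0, (t : ℂ) ^ (s - 1) * Complex.exp (-(t : ℂ) ^ 2 / 2) *
        Complex.exp (-x * t)) := by
  simp_rw [← integral_const_mul]
  refine hasSum_integral_of_dominated_convergence
    (fun k t => t ^ (s.re - 1) * Real.exp (-t ^ 2 / 2) * ((|x| * t) ^ k / k.factorial))
    (fun k => ?_) (fun k => ?_) ?_ ?_ ?_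
  · exact (aestronglyMeasurable_cpow_mul_gaussian (s + k)).const_mul _
  · refine (ae_restrict_iff' measurableSet_Ioi).2 (Filter.Eventually.of_forall fun t ht => ?_)
    have ht0 : (0 : ℝ) < t := ht
    rw [norm_mul, norm_cpow_mul_gaussian ht, norm_div, norm_pow, norm_neg, Complex.norm_real,
      Complex.norm_natCast, Real.norm_eq_abs]
    have e : (s + k).re - 1 = (s.re - 1) + k := by
      simp
      ring
    rw [e, Real.rpow_add ht0, Real.rpow_natCast, mul_pow]
    apply le_of_eq
    ring
  · exact Filter.Eventually.of_forall fun t => (Real.summable_pow_div_factorial _).mul_left _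
  · refine (integrableOn_rpow_mul_gaussian hs |x|).congr
      (Filter.Eventually.of_forall fun t => ?_)
    simp only [tsum_mul_left]
    rw [(NormedSpace.expSeries_div_hasSum_exp (|x| * t)).tsum_eq, ← Real.exp_eq_exp_ℝ, mul_assoc,
      ← Real.exp_add]
    ring_nf
  · refine (ae_restrict_iff' measurableSet_Ioi).2 (Filter.Eventually.of_forall fun t ht => ?_)
    have ht' : (t : ℂ) ≠ 0 := Complex.ofReal_ne_zero.2 (ne_of_gt ht)
    have h := (NormedSpace.expSeries_div_hasSum_exp (𝔸 := ℂ) (-x * t)).mul_left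
      ((t : ℂ) ^ (s - 1) * Complex.exp (-(t : ℂ) ^ 2 / 2))
    rw [← Complex.exp_eq_exp_ℂ] at h
    convert! h using 2 with k
    rw [show s + k - 1 = (s - 1) + k by ring, Complex.cpow_add _ _ ht', Complex.cpow_natCast,
      mul_pow]
    ring

theorem integral_cpow_mul_gaussian_mul_exp {s : ℂ} (hs : 0 < s.re) (x : ℝ) :
    ∫ t : ℝ in Set.Ioi 0, (t : ℂ) ^ (s - 1) * Complex.exp (-(t : ℂ) ^ 2 / 2) *
        Complex.exp (-x * t)
      = 1 / 2 * ((2 : ℂ) ^ (s / 2) * Complex.Gamma (s / 2)) * evenSeries (-s) x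
        - 1 / 2 * ((2 : ℂ) ^ ((s + 1) / 2) * Complex.Gamma ((s + 1) / 2)) * oddSeries (-s) x := by
  have h := hasSum_integral_cpow_mul_gaussian_mul_exp hs x
  have hk : ∀ k : ℕ, 0 < (s + k).re := fun k => by
    have : (0 : ℝ) ≤ k := by positivity
    simp only [Complex.add_re, Complex.natCast_re]
    linarith
  simp_rw [fun k : ℕ => integral_cpow_mul_gaussian (hk k)] at h
  refine h.unique ?_
  rw [sub_eq_add_neg]
  refine HasSum.even_add_odd ?_ ?_
  · have he := ((summable_even (-s) x).hasSum).mul_left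
      (1 / 2 * ((2 : ℂ) ^ (s / 2) * Complex.Gamma (s / 2)))
    refine he.congr_fun fun k => ?_
    have e : (s + ((2 * k : ℕ) : ℂ)) / 2 = s / 2 + k := by
      push_cast
      ring
    rw [e, two_cpow_mul_Gamma_add_nat hs, (even_two_mul k).neg_pow]
    ring
  · have ho := (((summable_odd (-s - 1) x).hasSum).mul_left
      (1 / 2 * ((2 : ℂ) ^ ((s + 1) / 2) * Complex.Gamma ((s + 1) / 2)))).neg
    refine ho.congr_fun fun k => ?_
    have e : (s + ((2 * k + 1 : ℕ) : ℂ)) / 2 = (s + 1) / 2 + k := by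
      push_cast
      ring
    rw [e, two_cpow_mul_Gamma_add_nat (by simpa using hk 1), (odd_two_mul_add_one k).neg_pow,
      neg_add']
    ring

/-- The even and odd terms of the expanded integral give the two series; duplication identifies
their prefactors with `Γ(-ν) dEven ν` and `Γ(-ν) dOdd ν`. The decay of `D_ν`, invisible in its power
series, becomes visible here. -/
theorem Gamma_mul_parabolicD {ν : ℂ} (hν : ν.re < 0) (x : ℝ) :
    Complex.Gamma (-ν) * parabolicD ν x = Complex.exp (-(x : ℂ) ^ 2 / 4) *
      ∫ t : ℝ in Set.Ioi 0, (t : ℂ) ^ (-ν - 1) * Complex.exp (-(t : ℂ) ^ 2 / 2) *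
        Complex.exp (-x * t) := by
  have hs : 0 < (-ν).re := by simpa using hν
  rw [integral_cpow_mul_gaussian_mul_exp hs, parabolicD_eq, yEven_eq, yOdd_eq, neg_neg]
  have h := Complex.Gamma_mul_Gamma_add_half (-ν / 2)
  rw [show 2 * (-ν / 2) = -ν by ring] at h
  have g1 : Complex.Gamma (-ν / 2) ≠ 0 :=
    Complex.Gamma_ne_zero_of_re_pos (by simpa using hν)
  have g2 : Complex.Gamma (-ν / 2 + 1 / 2) ≠ 0 :=
    Complex.Gamma_ne_zero_of_re_pos (by simp; linarith)
  have e2 : (2 : ℂ) ^ (1 - -ν) = 2 * (2 ^ (ν / 2) * 2 ^ (ν / 2)) := by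
    rw [← Complex.cpow_add _ _ two_ne_zero, sub_neg_eq_add, Complex.cpow_add _ _ two_ne_zero,
      Complex.cpow_one]
    ring_nf
  have e3 : (2 : ℂ) ^ (ν / 2) * 2 ^ (-ν / 2) = 1 := by
    rw [← Complex.cpow_add _ _ two_ne_zero]
    ring_nf
    simp
  have e4 : (2 : ℂ) ^ ((ν + 1) / 2) = 2 ^ (ν / 2) * 2 ^ (1 / 2 : ℂ) := by
    rw [← Complex.cpow_add _ _ two_ne_zero]
    ring_nf
  have e5 : (2 : ℂ) ^ ((-ν + 1) / 2) = 2 ^ (-ν / 2) * 2 ^ (1 / 2 : ℂ) := by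
    rw [← Complex.cpow_add _ _ two_ne_zero]
    ring_nf
  have k1 : Complex.Gamma (-ν) * dEven ν
      = 1 / 2 * ((2 : ℂ) ^ (-ν / 2) * Complex.Gamma (-ν / 2)) := by
    rw [dEven, mul_div_assoc', div_eq_iff g2, mul_assoc, mul_assoc, h, e2]
    linear_combination (-Complex.Gamma (-ν) * 2 ^ (ν / 2) * (√Real.pi : ℂ)) * e3
  have k2 : Complex.Gamma (-ν) * dOdd ν
      = 1 / 2 * ((2 : ℂ) ^ ((-ν + 1) / 2) * Complex.Gamma ((-ν + 1) / 2)) := by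
    rw [dOdd, mul_div_assoc', div_eq_iff g1, show (-ν + 1) / 2 = -ν / 2 + 1 / 2 by ring, mul_assoc,
      mul_assoc, mul_comm (Complex.Gamma (-ν / 2 + 1 / 2)), h, e2, e4,
      show -ν / 2 + 1 / 2 = (-ν + 1) / 2 by ring, e5]
    linear_combination (-Complex.Gamma (-ν) * 2 ^ (ν / 2) * 2 ^ (1 / 2 : ℂ) * (√Real.pi : ℂ)) * e3
  rw [← k1, ← k2]
  ring

/-- For `x ≥ 0` the factor `exp(-x t)` is at most 1, so the integral is bounded by its absolute
version at `x = 0`. -/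
theorem exists_parabolicD_bound_of_re_neg {ν : ℂ} (hν : ν.re < 0) :
    ∃ C : ℝ, ∀ x : ℝ, 0 ≤ x → ‖parabolicD ν x‖ ≤ C * Real.exp (-x ^ 2 / 4) := by
  have hs : 0 < (-ν).re := by simpa using hν
  have hG : Complex.Gamma (-ν) ≠ 0 := Complex.Gamma_ne_zero_of_re_pos hs
  have hG' : 0 < ‖Complex.Gamma (-ν)‖ := norm_pos_iff.2 hG
  have hint := integrableOn_rpow_mul_gaussian hs 0
  refine ⟨(∫ t : ℝ in Set.Ioi 0, t ^ ((-ν).re - 1) * Real.exp (0 * t - t ^ 2 / 2)) /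
    ‖Complex.Gamma (-ν)‖, fun x hx => ?_⟩
  have h := congrArg norm (Gamma_mul_parabolicD hν x)
  rw [norm_mul, norm_mul, Complex.norm_exp] at h
  have he : (-(x : ℂ) ^ 2 / 4).re = -x ^ 2 / 4 := by
    norm_cast
  rw [he] at h
  have hle : ‖∫ t : ℝ in Set.Ioi 0, (t : ℂ) ^ (-ν - 1) * Complex.exp (-(t : ℂ) ^ 2 / 2) *
        Complex.exp (-x * t)‖
      ≤ ∫ t : ℝ in Set.Ioi 0, t ^ ((-ν).re - 1) * Real.exp (0 * t - t ^ 2 / 2) := by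
    refine norm_integral_le_of_norm_le hint ?_
    refine (ae_restrict_iff' measurableSet_Ioi).2 (Filter.Eventually.of_forall fun t ht => ?_)
    have ht0 : (0 : ℝ) < t := ht
    rw [norm_mul, norm_cpow_mul_gaussian ht, Complex.norm_exp]
    have hre : (-(x : ℂ) * t).re = -(x * t) := by
      simp
    have h1 : Real.exp (-(x * t)) ≤ 1 := Real.exp_le_one_iff.2 (by nlinarith)
    have h0 : 0 ≤ t ^ ((-ν).re - 1) := Real.rpow_nonneg ht0.le _
    rw [hre, zero_mul, zero_sub, neg_div]
    exact mul_le_of_le_one_right (by positivity) h1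
  rw [div_mul_eq_mul_div, le_div_iff₀ hG', mul_comm, h, mul_comm]
  gcongr

/-- Induction on an integer above `Re ν`: the recurrence expresses `D_ν` through `D_{ν-1}` and
`D_{ν-2}`, at the price of one more power of `1 + x`. -/
theorem exists_parabolicD_bound (ν : ℂ) :
    ∃ (C : ℝ) (n : ℕ), ∀ x : ℝ, 0 ≤ x →
      ‖parabolicD ν x‖ ≤ C * (1 + x) ^ n * Real.exp (-x ^ 2 / 4) := by
  suffices H : ∀ (N : ℕ) (ν : ℂ), ν.re < N → ∃ (C : ℝ) (n : ℕ), ∀ x : ℝ, 0 ≤ x →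
      ‖parabolicD ν x‖ ≤ C * (1 + x) ^ n * Real.exp (-x ^ 2 / 4) by
    obtain ⟨N, hN⟩ := exists_nat_gt ν.re
    exact H N ν hN
  intro N
  induction N with
  | zero =>
    intro ν hν
    obtain ⟨C, hC⟩ := exists_parabolicD_bound_of_re_neg (by simpa using hν)
    exact ⟨C, 0, by simpa using hC⟩
  | succ N ih =>
    intro ν hν
    push_cast at hν
    obtain ⟨C, n, h1⟩ := ih (ν - 1) (by simp; linarith)
    obtain ⟨C', n', h2⟩ := ih (ν - 1 - 1) (by simp; linarith)
    refine ⟨|C| + ‖ν - 1‖ * |C'|, n + n' + 1, fun x hx => ?_⟩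
    have h := parabolicD_add_one (ν - 1) x
    rw [sub_add_cancel] at h
    have hx1 : 1 ≤ 1 + x := by linarith
    have b1 : ‖(x : ℂ) * parabolicD (ν - 1) x‖
        ≤ |C| * (1 + x) ^ (n + n' + 1) * Real.exp (-x ^ 2 / 4) := by
      rw [norm_mul, Complex.norm_real, Real.norm_of_nonneg hx]
      calc x * ‖parabolicD (ν - 1) x‖ ≤ (1 + x) * (|C| * (1 + x) ^ n * Real.exp (-x ^ 2 / 4)) := by
            gcongr
            · linarith
            · exact (h1 x hx).trans (by gcongr; exact le_abs_self C)
        _ = |C| * (1 + x) ^ (n + 1) * Real.exp (-x ^ 2 / 4) := by ring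
        _ ≤ _ := by
            gcongr ?_ * ?_ * _
            exact pow_le_pow_right₀ hx1 (by omega)
    have b2 : ‖(ν - 1) * parabolicD (ν - 1 - 1) x‖
        ≤ ‖ν - 1‖ * |C'| * (1 + x) ^ (n + n' + 1) * Real.exp (-x ^ 2 / 4) := by
      rw [norm_mul, mul_assoc, mul_assoc]
      gcongr
      calc ‖parabolicD (ν - 1 - 1) x‖ ≤ |C'| * (1 + x) ^ n' * Real.exp (-x ^ 2 / 4) :=
            (h2 x hx).trans (by gcongr; exact le_abs_self C')
        _ ≤ |C'| * (1 + x) ^ (n + n' + 1) * Real.exp (-x ^ 2 / 4) := by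
            gcongr ?_ * ?_ * _
            exact pow_le_pow_right₀ hx1 (by omega)
        _ = _ := by ring
    rw [h]
    calc _ ≤ _ := norm_sub_le _ _
      _ ≤ _ := add_le_add b1 b2
      _ = _ := by ring

/-- `u` decays at `+∞` fast enough for `u` and `x u` to be square integrable there. -/
def DecaysRight (u : ℝ → ℂ) : Prop :=
  ∀ p : ℝ, ∃ C : ℝ, ∀ x : ℝ, p ≤ x → ‖u x‖ * (1 + x ^ 2) ^ 2 ≤ C

theorem DecaysRight.const_mul {u : ℝ → ℂ} (h : DecaysRight u) (c : ℂ) :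
    DecaysRight fun x => c * u x := by
  intro p
  obtain ⟨C, hC⟩ := h p
  refine ⟨‖c‖ * C, fun x hx => ?_⟩
  rw [norm_mul, mul_assoc]
  gcongr
  exact hC x hx

theorem DecaysRight.of_bound {u : ℝ → ℂ} (hu : Continuous u) {C : ℝ} {n : ℕ}
    (h : ∀ x : ℝ, 0 ≤ x → ‖u x‖ ≤ C * (1 + x) ^ n * Real.exp (-x ^ 2 / 4)) : DecaysRight u := by
  intro p
  have hc : Continuous fun x : ℝ => ‖u x‖ * (1 + x ^ 2) ^ 2 := by fun_prop
  obtain ⟨B, hB⟩ := (isCompact_Icc (a := p) (b := 0)).exists_bound_of_continuousOn hc.continuousOn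
  -- `B` handles the compact part `[p, 0]`. For `x ≥ 0`, `(1+x)^(n+4) ≤ (n+4)! exp(1+x)` and `1 + x
  -- - x²/4 = 2 - (x/2 - 1)²`.
  refine ⟨max B (|C| * ((n + 4).factorial * Real.exp 2)), fun x hx => ?_⟩
  rcases le_total x 0 with h0 | h0
  · exact ((le_abs_self _).trans (hB x ⟨hx, h0⟩)).trans (le_max_left _ _)
  · refine le_trans ?_ (le_max_right _ _)
    have hf := Real.pow_div_factorial_le_exp (1 + x) (by linarith) (n + 4)
    rw [div_le_iff₀ (by positivity)] at hf
    calc ‖u x‖ * (1 + x ^ 2) ^ 2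
        ≤ (|C| * (1 + x) ^ n * Real.exp (-x ^ 2 / 4)) * ((1 + x) ^ 2) ^ 2 := by
          gcongr
          · exact (h x h0).trans (by gcongr; exact le_abs_self C)
          · nlinarith
      _ = |C| * ((1 + x) ^ (n + 4) * Real.exp (-x ^ 2 / 4)) := by ring
      _ ≤ |C| * ((Real.exp (1 + x) * (n + 4).factorial) * Real.exp (-x ^ 2 / 4)) := by gcongr
      _ = |C| * ((n + 4).factorial * Real.exp (1 + x + -x ^ 2 / 4)) := by
          rw [Real.exp_add (1 + x)]
          ring
      _ ≤ |C| * ((n + 4).factorial * Real.exp 2) := by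
          gcongr
          nlinarith [sq_nonneg (x / 2 - 1)]

theorem continuous_parabolicD (ν : ℂ) : Continuous (parabolicD ν) :=
  continuous_iff_continuousAt.2 fun x => (hasDerivAt_parabolicD ν x).continuousAt

theorem decaysRight_parabolicD (ν : ℂ) : DecaysRight fun x : ℝ => parabolicD ν x := by
  obtain ⟨C, n, h⟩ := exists_parabolicD_bound ν
  exact DecaysRight.of_bound ((continuous_parabolicD ν).comp Complex.continuous_ofReal) h

/-- The derivative of `D_ν`. -/
def parabolicD' (ν x : ℂ) : ℂ := -(x / 2) * parabolicD ν x + ν * parabolicD (ν - 1) x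

theorem decaysRight_parabolicD' (ν : ℂ) : DecaysRight fun x : ℝ => parabolicD' ν x := by
  obtain ⟨C, n, h1⟩ := exists_parabolicD_bound ν
  obtain ⟨C', n', h2⟩ := exists_parabolicD_bound (ν - 1)
  have hc : Continuous fun x : ℝ => parabolicD' ν x := by
    have i1 := continuous_parabolicD ν
    have i2 := continuous_parabolicD (ν - 1)
    unfold parabolicD'
    fun_prop
  refine DecaysRight.of_bound hc (C := |C| + ‖ν‖ * |C'|) (n := n + n' + 1) fun x hx => ?_
  have hx1 : 1 ≤ 1 + x := by linarith
  have b1 : ‖-((x : ℂ) / 2) * parabolicD ν x‖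
      ≤ |C| * (1 + x) ^ (n + n' + 1) * Real.exp (-x ^ 2 / 4) := by
    rw [norm_mul, norm_neg, norm_div, Complex.norm_real, Real.norm_of_nonneg hx, Complex.norm_ofNat]
    calc x / 2 * ‖parabolicD ν x‖ ≤ (1 + x) * (|C| * (1 + x) ^ n * Real.exp (-x ^ 2 / 4)) := by
          gcongr
          · linarith
          · exact (h1 x hx).trans (by gcongr; exact le_abs_self C)
      _ = |C| * (1 + x) ^ (n + 1) * Real.exp (-x ^ 2 / 4) := by ring
      _ ≤ _ := by
          gcongr ?_ * ?_ * _
          exact pow_le_pow_right₀ hx1 (by omega)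
  have b2 : ‖ν * parabolicD (ν - 1) x‖
      ≤ ‖ν‖ * |C'| * (1 + x) ^ (n + n' + 1) * Real.exp (-x ^ 2 / 4) := by
    rw [norm_mul, mul_assoc, mul_assoc]
    gcongr
    calc ‖parabolicD (ν - 1) x‖ ≤ |C'| * (1 + x) ^ n' * Real.exp (-x ^ 2 / 4) :=
          (h2 x hx).trans (by gcongr; exact le_abs_self C')
      _ ≤ |C'| * (1 + x) ^ (n + n' + 1) * Real.exp (-x ^ 2 / 4) := by
          gcongr ?_ * ?_ * _
          exact pow_le_pow_right₀ hx1 (by omega)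
      _ = _ := by ring
  calc _ ≤ _ := norm_add_le _ _
    _ ≤ _ := add_le_add b1 b2
    _ = _ := by ring

/-! ### Solutions of the homogeneous equation -/

/-- `u` solves `-u'' + (x²/4 - 1/2) u = ν u` on `ℝ`, with derivative `u'`. -/
structure IsSol (ν : ℂ) (u u' : ℝ → ℂ) : Prop where
  hasDerivAt : ∀ x, HasDerivAt u (u' x) x
  hasDerivAt' : ∀ x : ℝ, HasDerivAt u' (((x : ℂ) ^ 2 / 4 - 1 / 2 - ν) * u x) x

theorem IsSol.continuous {ν : ℂ} {u u' : ℝ → ℂ} (h : IsSol ν u u') : Continuous u :=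
  continuous_iff_continuousAt.2 fun x => (h.hasDerivAt x).continuousAt

theorem IsSol.continuous' {ν : ℂ} {u u' : ℝ → ℂ} (h : IsSol ν u u') : Continuous u' :=
  continuous_iff_continuousAt.2 fun x => (h.hasDerivAt' x).continuousAt

theorem IsSol.const_mul {ν : ℂ} {u u' : ℝ → ℂ} (h : IsSol ν u u') (c : ℂ) :
    IsSol ν (fun x => c * u x) (fun x => c * u' x) where
  hasDerivAt x := (h.hasDerivAt x).const_mul c
  hasDerivAt' x := by
    convert! (h.hasDerivAt' x).const_mul c using 1
    ring

theorem IsSol.add {ν : ℂ} {u u' v v' : ℝ → ℂ} (h : IsSol ν u u') (k : IsSol ν v v') :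
    IsSol ν (fun x => u x + v x) (fun x => u' x + v' x) where
  hasDerivAt x := (h.hasDerivAt x).add (k.hasDerivAt x)
  hasDerivAt' x := by
    convert! (h.hasDerivAt' x).add (k.hasDerivAt' x) using 1
    ring

theorem IsSol.comp_neg {ν : ℂ} {u u' : ℝ → ℂ} (h : IsSol ν u u') :
    IsSol ν (fun x => u (-x)) (fun x => -u' (-x)) where
  hasDerivAt x := by
    simpa [Function.comp_def] using (h.hasDerivAt (-x)).scomp x (hasDerivAt_neg x)
  hasDerivAt' x := by
    convert! ((h.hasDerivAt' (-x)).scomp x (hasDerivAt_neg x)).neg using 1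
    simp

theorem IsSol.wronskian_eq {ν : ℂ} {u u' v v' : ℝ → ℂ} (h : IsSol ν u u') (k : IsSol ν v v')
    (x y : ℝ) : u x * v' x - u' x * v x = u y * v' y - u' y * v y := by
  have hd : ∀ t, HasDerivAt (fun t => u t * v' t - u' t * v t) 0 t := fun t => by
    convert! ((h.hasDerivAt t).mul (k.hasDerivAt' t)).sub
      ((h.hasDerivAt' t).mul (k.hasDerivAt t)) using 1
    ring
  exact is_const_of_deriv_eq_zero (fun t => (hd t).differentiableAt) (fun t => (hd t).deriv) x y

/-- The derivative of `yEven`. -/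
def yEven' (ν x : ℂ) : ℂ := -(x / 2) * yEven ν x - ν * yOdd (ν - 1) x

/-- The derivative of `yOdd`. -/
def yOdd' (ν x : ℂ) : ℂ := -(x / 2) * yOdd ν x + yEven (ν - 1) x

theorem isSol_yEven (ν : ℂ) : IsSol ν (fun x => yEven ν x) (fun x => yEven' ν x) where
  hasDerivAt x := (hasDerivAt_yEven ν x).comp_ofReal
  hasDerivAt' x := by
    have h := ((((hasDerivAt_id (x : ℂ)).div_const 2).neg).mul (hasDerivAt_yEven ν x)).sub
      ((hasDerivAt_yOdd (ν - 1) x).const_mul ν)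
    convert! h.comp_ofReal using 1
    simp only [Pi.neg_apply, id_eq]
    linear_combination (-ν * yOdd_recurrence (ν - 1) x) +
      ν * congrArg (fun w => yEven w x) (show ν - 1 + 1 = ν by ring)

theorem isSol_yOdd (ν : ℂ) : IsSol ν (fun x => yOdd ν x) (fun x => yOdd' ν x) where
  hasDerivAt x := (hasDerivAt_yOdd ν x).comp_ofReal
  hasDerivAt' x := by
    have h := ((((hasDerivAt_id (x : ℂ)).div_const 2).neg).mul (hasDerivAt_yOdd ν x)).add
      (hasDerivAt_yEven (ν - 1) x)
    convert! h.comp_ofReal using 1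
    simp only [Pi.neg_apply, id_eq]
    linear_combination yEven_recurrence (ν - 1) x +
      ν * congrArg (fun w => yOdd w x) (show ν - 1 + 1 = ν by ring)

theorem isSol_parabolicD (ν : ℂ) :
    IsSol ν (fun x => parabolicD ν x) (fun x => parabolicD' ν x) where
  hasDerivAt x := (hasDerivAt_parabolicD ν x).comp_ofReal
  hasDerivAt' x := by
    have h := ((((hasDerivAt_id (x : ℂ)).div_const 2).neg).mul (hasDerivAt_parabolicD ν x)).add
      ((hasDerivAt_parabolicD (ν - 1) x).const_mul ν)
    convert! h.comp_ofReal using 1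
    have e := parabolicD_add_one (ν - 1) x
    rw [sub_add_cancel] at e
    simp only [Pi.neg_apply, id_eq]
    linear_combination (-ν) * e

theorem parabolicD'_eq_combination (ν : ℂ) (x : ℝ) :
    parabolicD' ν x = dEven ν * yEven' ν x - dOdd ν * yOdd' ν x := by
  have h := ((hasDerivAt_yEven ν x).const_mul (dEven ν)).sub
    ((hasDerivAt_yOdd ν x).const_mul (dOdd ν))
  exact (hasDerivAt_parabolicD ν x).unique h

theorem yEven'_neg (ν x : ℂ) : yEven' ν (-x) = -yEven' ν x := by
  simp only [yEven', yEven_neg, yOdd_neg]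
  ring

theorem yOdd'_neg (ν x : ℂ) : yOdd' ν (-x) = yOdd' ν x := by
  simp only [yOdd', yEven_neg, yOdd_neg]
  ring

theorem wronskian_yEven_yOdd (ν : ℂ) (x : ℝ) :
    yEven ν x * yOdd' ν x - yEven' ν x * yOdd ν x = 1 := by
  rw [(isSol_yEven ν).wronskian_eq (isSol_yOdd ν) x 0]
  simp [yEven', yOdd', yEven_zero, yOdd_zero]

/-- Cramer's rule in the basis `yEven`, `yOdd`, whose Wronskian is 1. -/
theorem exists_isSol (ν : ℂ) (p : ℝ) (a a' : ℂ) :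
    ∃ u u' : ℝ → ℂ, IsSol ν u u' ∧ u p = a ∧ u' p = a' := by
  refine ⟨_, _, ((isSol_yEven ν).const_mul (a * yOdd' ν p - a' * yOdd ν p)).add
    ((isSol_yOdd ν).const_mul (a' * yEven ν p - a * yEven' ν p)), ?_, ?_⟩
  · linear_combination a * wronskian_yEven_yOdd ν p
  · linear_combination a' * wronskian_yEven_yOdd ν p

/-- The constant Wronskians of `u` with `yEven` and `yOdd` vanish at `p`, and these two numbers
determine `u`. -/
theorem IsSol.eq_zero {ν : ℂ} {u u' : ℝ → ℂ} (h : IsSol ν u u') {p : ℝ} (hp : u p = 0)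
    (hp' : u' p = 0) (x : ℝ) : u x = 0 := by
  have h1 := h.wronskian_eq (isSol_yEven ν) x p
  have h2 := h.wronskian_eq (isSol_yOdd ν) x p
  rw [hp, hp'] at h1 h2
  linear_combination (-u x) * wronskian_yEven_yOdd ν x + yEven ν x * h2 - yOdd ν x * h1

/-- A solution with vanishing Wronskian against a nonzero solution is a multiple of it. -/
theorem IsSol.eq_const_mul {ν : ℂ} {u u' v v' : ℝ → ℂ} (h : IsSol ν u u') (k : IsSol ν v v')
    {p : ℝ} (hw : u p * v' p - u' p * v p = 0) (hu : ∃ x, u x ≠ 0) :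
    ∃ c : ℂ, ∀ x, v x = c * u x ∧ v' x = c * u' x := by
  obtain ⟨y, hy⟩ := hu
  have hwy := (h.wronskian_eq k y p).trans hw
  -- This combination vanishes at `y` by the choice of the factor, and so does its derivative since
  -- the Wronskian is zero.
  have hs := k.add (h.const_mul (-(v y / u y)))
  have h0 : ∀ x, v x + -(v y / u y) * u x = 0 := hs.eq_zero (p := y)
    (by field_simp; ring) (by field_simp; linear_combination hwy)
  refine ⟨v y / u y, fun x => ⟨by linear_combination h0 x, ?_⟩⟩
  have hd := hs.hasDerivAt x
  rw [show (fun x => v x + -(v y / u y) * u x) = fun _ => 0 from funext h0] at hd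
  linear_combination hd.unique (hasDerivAt_const x 0)

theorem exists_parabolicD_ne_zero (ν : ℂ) : ∃ x : ℝ, parabolicD ν x ≠ 0 := by
  by_contra! h
  have h0 := h 0
  have h1 := (isSol_parabolicD ν).hasDerivAt 0
  rw [show (fun x : ℝ => parabolicD ν x) = fun _ => 0 from funext h] at h1
  have h2 := h1.unique (hasDerivAt_const 0 0)
  rw [parabolicD'_eq_combination] at h2
  rw [parabolicD_eq] at h0
  simp only [yEven', yOdd', Complex.ofReal_zero, yEven_zero, yOdd_zero] at h0 h2
  rcases dEven_ne_zero_or ν with h3 | h3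
  · exact h3 (by simpa using h0)
  · exact h3 (by simpa using h2)

/-- The function whose zeros are the eigenvalues. -/
def charFun (z ν : ℂ) (b : ℝ) : ℂ :=
  (Complex.Gamma (-ν))⁻¹ - z ^ 2 * parabolicD ν b ^ 2 *
    ((√(2 / Real.pi) : ℂ) * yEven ν b * yOdd ν b)

/-- The Wronskian of `D_ν` with the solution that continues `D_ν(-x)` through the point
interactions at `-b` and `b`. -/
theorem wronskian_eq_charFun {z ν : ℂ} {b : ℝ} {u u' : ℝ → ℂ} (h : IsSol ν u u')
    (hu : u (-b) = parabolicD ν b) (hu' : u' (-b) = -parabolicD' ν b - z * parabolicD ν b) :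
    parabolicD ν b * (u' b + z * u b) - parabolicD' ν b * u b
      = (√(2 * Real.pi) : ℂ) * charFun z ν b := by
  have h1 := (isSol_yEven ν).wronskian_eq h b (-b)
  have h2 := (isSol_yOdd ν).wronskian_eq h b (-b)
  have hW := wronskian_yEven_yOdd ν b
  have hD := parabolicD_eq ν b
  have hD' := parabolicD'_eq_combination ν b
  simp only [Complex.ofReal_neg, yEven_neg, yOdd_neg, yEven'_neg, yOdd'_neg, hu, hu'] at h1 h2
  have hsq : (√(2 * Real.pi) : ℂ) * (√(2 / Real.pi) : ℂ) = 2 := by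
    rw [← Complex.ofReal_mul, ← Real.sqrt_mul (by positivity)]
    rw [show 2 * Real.pi * (2 / Real.pi) = 2 ^ 2 by field_simp]
    rw [Real.sqrt_sq (by norm_num)]
    norm_num
  have hA : parabolicD ν b * yOdd' ν b - parabolicD' ν b * yOdd ν b = dEven ν := by
    rw [hD, hD']
    linear_combination dEven ν * hW
  have hB : parabolicD ν b * yEven' ν b - parabolicD' ν b * yEven ν b = dOdd ν := by
    rw [hD, hD']
    linear_combination dOdd ν * hW
  have ce : yOdd ν b * u' b - yOdd' ν b * u b
      = -(dEven ν - z * parabolicD ν b * yOdd ν b) := by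
    rw [h2, ← hA]
    ring
  have co : yEven ν b * u' b - yEven' ν b * u b
      = dOdd ν - z * parabolicD ν b * yEven ν b := by
    rw [h1, ← hB]
    ring
  -- The coordinates of `u` in the basis are its Wronskians with `yOdd` and `yEven`, transported
  -- from `-b`, where the data of `u` are prescribed, by parity.
  have hL : u b = (dEven ν - z * parabolicD ν b * yOdd ν b) * yEven ν b
      + (dOdd ν - z * parabolicD ν b * yEven ν b) * yOdd ν b := by
    rw [← co, ← neg_eq_iff_eq_neg.2 ce]
    linear_combination (-u b) * hW
  have hL' : u' b = (dEven ν - z * parabolicD ν b * yOdd ν b) * yEven' ν b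
      + (dOdd ν - z * parabolicD ν b * yEven ν b) * yOdd' ν b := by
    rw [← co, ← neg_eq_iff_eq_neg.2 ce]
    linear_combination (-u' b) * hW
  rw [charFun, mul_sub, sqrt_two_pi_mul_inv_Gamma, hL, hL']
  -- On expansion the terms linear in `z` cancel, leaving `2 dEven dOdd - 2 z² D_ν(b)² yEven yOdd`.
  linear_combination (dEven ν - z * parabolicD ν b * yOdd ν b) * hB
    + (dOdd ν - z * parabolicD ν b * yEven ν b) * hA
    + z ^ 2 * parabolicD ν b ^ 2 * (yEven ν b * yOdd ν b) * hsq

/-! ### Primitives and integration by parts -/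

theorem absolutelyContinuousOnInterval_integral {g : ℝ → ℂ}
    (hg : ∀ a b, IntervalIntegrable g volume a b) (a b : ℝ) :
    AbsolutelyContinuousOnInterval (fun x => ∫ v in a..x, g v) a b := by
  have hre : ∀ a b, IntervalIntegrable (fun x => (g x).re) volume a b := fun a b =>
    ⟨(hg a b).1.re, (hg a b).2.re⟩
  have him : ∀ a b, IntervalIntegrable (fun x => (g x).im) volume a b := fun a b =>
    ⟨(hg a b).1.im, (hg a b).2.im⟩
  have hconst : ∀ c : ℂ, AbsolutelyContinuousOnInterval (fun _ : ℝ => c) a b := fun c =>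
    (contDiff_const.contDiffOn).absolutelyContinuousOnInterval
  have h1 := ((hre a b).absolutelyContinuousOnInterval_intervalIntegral
    Set.left_mem_uIcc).fun_smul (hconst 1)
  have h2 := ((him a b).absolutelyContinuousOnInterval_intervalIntegral
    Set.left_mem_uIcc).fun_smul (hconst Complex.I)
  convert! h1.fun_add h2 using 2 with x
  have e1 : ((∫ v in a..x, (g v).re : ℝ) : ℂ) = ∫ v in a..x, ((g v).re : ℂ) :=
    (intervalIntegral.integral_ofReal).symm
  have e2 : ((∫ v in a..x, (g v).im : ℝ) : ℂ) = ∫ v in a..x, ((g v).im : ℂ) :=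
    (intervalIntegral.integral_ofReal).symm
  rw [Complex.real_smul, Complex.real_smul, mul_one, e1, e2,
    ← intervalIntegral.integral_mul_const, ← intervalIntegral.integral_add]
  · simp [Complex.re_add_im]
  · exact ⟨(hre a x).1.ofReal, (hre a x).2.ofReal⟩
  · exact IntervalIntegrable.mul_const ⟨(him a x).1.ofReal, (him a x).2.ofReal⟩ _

/-- `f` is a primitive of the locally integrable function `g`. -/
structure IsPrimitive (f g : ℝ → ℂ) : Prop where
  intervalIntegrable : ∀ a b, IntervalIntegrable g volume a b
  sub_eq : ∀ s t, f t - f s = ∫ x in s..t, g x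

theorem IsPrimitive.eq {f g : ℝ → ℂ} (h : IsPrimitive f g) (s t : ℝ) :
    f t = f s + ∫ x in s..t, g x := by
  rw [← h.sub_eq s t]
  ring

theorem IsPrimitive.continuous {f g : ℝ → ℂ} (h : IsPrimitive f g) : Continuous f := by
  have e : f = fun t => f 0 + ∫ x in (0 : ℝ)..t, g x := funext fun t => h.eq 0 t
  rw [e]
  exact continuous_const.add (intervalIntegral.continuous_primitive h.intervalIntegrable 0)

/-- Since `g` is only locally integrable, the product rule holds merely almost everywhere. The
difference between `f u` and the integral is absolutely continuous with zero derivative almost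
everywhere, hence constant. -/
theorem IsPrimitive.integral_mul_add {f g u u' : ℝ → ℂ} (h : IsPrimitive f g)
    (hu : ∀ x, HasDerivAt u (u' x) x) (hu' : Continuous u') (s t : ℝ) :
    ∫ x in s..t, (g x * u x + f x * u' x) = f t * u t - f s * u s := by
  have hf := h.continuous
  have huc : Continuous u := continuous_iff_continuousAt.2 fun x => (hu x).continuousAt
  have hint : ∀ a b, IntervalIntegrable (fun x => g x * u x + f x * u' x) volume a b := fun a b =>
    ((h.intervalIntegrable a b).mul_continuousOn huc.continuousOn).add
      ((hf.mul hu').intervalIntegrable a b)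
  have hconst : AbsolutelyContinuousOnInterval (fun _ : ℝ => f s) s t :=
    (contDiff_const.contDiffOn).absolutelyContinuousOnInterval
  have hfac : AbsolutelyContinuousOnInterval f s t := by
    have := hconst.fun_add (absolutelyContinuousOnInterval_integral h.intervalIntegrable s t)
    exact (funext fun x => h.eq s x : f = _) ▸ this
  have huac : AbsolutelyContinuousOnInterval u s t := by
    refine ContDiffOn.absolutelyContinuousOnInterval (ContDiff.contDiffOn ?_)
    refine contDiff_one_iff_deriv.2 ⟨fun x => (hu x).differentiableAt, ?_⟩
    rwa [show deriv u = u' from funext fun x => (hu x).deriv]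
  have hac := (hfac.fun_smul huac).sub (absolutelyContinuousOnInterval_integral hint s t)
  obtain ⟨C, hC⟩ := hac.const_of_ae_hasDerivAt_zero (by
    filter_upwards [(h.intervalIntegrable s t).ae_hasDerivAt_integral,
      (hint s t).ae_hasDerivAt_integral] with x h1 h2 hx
    have d1 : HasDerivAt f (g x) x := by
      have := (h1 hx s Set.left_mem_uIcc).const_add (f s)
      exact (funext fun x => h.eq s x : f = _) ▸ this
    have d2 := h2 hx s Set.left_mem_uIcc
    convert! (d1.mul (hu x)).sub d2 using 1
    ring)
  have e1 := hC s Set.left_mem_uIcc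
  have e2 := hC t Set.right_mem_uIcc
  simp only [Pi.sub_apply, smul_eq_mul, intervalIntegral.integral_same, sub_zero] at e1 e2
  linear_combination e1 - e2

theorem exists_support_subset_Ioo {φ : ℝ → ℝ} (hc : HasCompactSupport φ) :
    ∃ A : ℝ, 0 < A ∧ tsupport φ ⊆ Set.Ioo (-A) A := by
  obtain ⟨A, hA, h⟩ := hc.isCompact.isBounded.subset_ball_lt 0 0
  refine ⟨A, hA, h.trans ?_⟩
  rw [Real.ball_eq_Ioo, zero_sub, zero_add]

theorem IsPrimitive.isWeakDeriv {f g : ℝ → ℂ} (h : IsPrimitive f g) : IsWeakDeriv f g := by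
  intro φ hφ hc
  obtain ⟨A, hA, hs⟩ := exists_support_subset_Ioo hc
  have hd : Continuous (deriv φ) := hφ.continuous_deriv (by simp)
  have h0 : ∀ x, x ∉ Set.Ioo (-A) A → φ x = 0 := fun x hx =>
    image_eq_zero_of_notMem_tsupport fun hx' => hx (hs hx')
  have key := h.integral_mul_add (u := fun x => (φ x : ℂ)) (u' := fun x => ((deriv φ x : ℝ) : ℂ))
    (fun x => (hφ.differentiable (by simp) x).hasDerivAt.ofReal_comp)
    (Complex.continuous_ofReal.comp hd) (-A) A
  have s1 : (Function.support fun x => φ x • g x) ⊆ Set.Ioc (-A) A := fun x hx => by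
    refine Set.Ioo_subset_Ioc_self (by_contra fun hx' => hx ?_)
    simp [h0 x hx']
  have s2 : (Function.support fun x => deriv φ x • f x) ⊆ Set.Ioc (-A) A := fun x hx => by
    refine Set.Ioo_subset_Ioc_self (hs (support_deriv_subset fun hx' => hx ?_))
    simp [hx']
  rw [← intervalIntegral.integral_eq_integral_of_support_subset s1,
    ← intervalIntegral.integral_eq_integral_of_support_subset s2]
  have i1 : IntervalIntegrable (fun x => g x * (φ x : ℂ)) volume (-A) A :=
    (h.intervalIntegrable _ _).mul_continuousOn
      (Complex.continuous_ofReal.comp hφ.continuous).continuousOn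
  have i2 : IntervalIntegrable (fun x => f x * ((deriv φ x : ℝ) : ℂ)) volume (-A) A :=
    (h.continuous.mul (Complex.continuous_ofReal.comp hd)).intervalIntegrable _ _
  rw [intervalIntegral.integral_add i1 i2, h0 A (by simp), h0 (-A) (by simp)] at key
  simp only [Complex.real_smul]
  simp only [mul_comm (_ : ℂ) (f _), mul_comm (_ : ℂ) (g _)]
  simp only [Complex.ofReal_zero, mul_zero, sub_self] at key
  linear_combination key

/-- A smooth compactly supported function of integral zero is the derivative of such a function. -/
theorem exists_test_deriv_eq {ψ : ℝ → ℝ} (hψ : ContDiff ℝ ∞ ψ) (hc : HasCompactSupport ψ)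
    (h0 : ∫ x, ψ x = 0) :
    ∃ φ : ℝ → ℝ, ContDiff ℝ ∞ φ ∧ HasCompactSupport φ ∧ deriv φ = ψ := by
  obtain ⟨A, hA, hs⟩ := exists_support_subset_Ioo hc
  have hz : ∀ x, x ∉ Set.Ioo (-A) A → ψ x = 0 := fun x hx =>
    image_eq_zero_of_notMem_tsupport fun hx' => hx (hs hx')
  have hd : ∀ x, HasDerivAt (fun x => ∫ t in (-A)..x, ψ t) (ψ x) x := fun x =>
    intervalIntegral.integral_hasDerivAt_right (hψ.continuous.intervalIntegrable _ _)
      hψ.continuous.stronglyMeasurable.stronglyMeasurableAtFilter hψ.continuous.continuousAt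
  have hder : deriv (fun x => ∫ t in (-A)..x, ψ t) = ψ := funext fun x => (hd x).deriv
  refine ⟨fun x => ∫ t in (-A)..x, ψ t, ?_, ?_, hder⟩
  · rw [contDiff_infty_iff_deriv, hder]
    exact ⟨fun x => (hd x).differentiableAt, hψ⟩
  · refine HasCompactSupport.intro (isCompact_Icc (a := -A) (b := A)) fun x hx => ?_
    rcases lt_or_ge x (-A) with h | h
    · rw [intervalIntegral.integral_symm, intervalIntegral.integral_zero_ae, neg_zero]
      refine Filter.Eventually.of_forall fun y hy => hz y fun hy' => ?_
      rw [Set.uIoc_of_le h.le] at hy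
      exact absurd hy'.1 (not_lt.2 hy.2)
    · have hxA : A < x := by
        by_contra hcon
        exact hx ⟨h, not_lt.1 hcon⟩
      rw [intervalIntegral.integral_eq_integral_of_support_subset, h0]
      intro y hy
      have : y ∈ Set.Ioo (-A) A := by_contra fun hy' => hy (hz y hy')
      exact ⟨this.1, (this.2.trans hxA).le⟩

/-- A locally integrable function with vanishing weak derivative is constant. -/
theorem ae_eq_const_of_integral_deriv_smul_eq_zero {h : ℝ → ℂ} (hh : LocallyIntegrable h volume)
    (h0 : ∀ φ : ℝ → ℝ, ContDiff ℝ ∞ φ → HasCompactSupport φ → ∫ x, deriv φ x • h x = 0) :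
    ∃ c : ℂ, ∀ᵐ x, h x = c := by
  let B : ContDiffBump (0 : ℝ) := ⟨1, 2, one_pos, one_lt_two⟩
  let ρ : ℝ → ℝ := B.normed volume
  have hρ : ContDiff ℝ ∞ ρ := B.contDiff_normed
  have hρc : HasCompactSupport ρ := B.hasCompactSupport_normed
  have hρ1 : ∫ x, ρ x = 1 := B.integral_normed
  have hI : ∀ φ : ℝ → ℝ, ContDiff ℝ ∞ φ → HasCompactSupport φ → Integrable fun x => φ x • h x :=
    fun φ hφ hc => hh.integrable_smul_left_of_hasCompactSupport hφ.continuous hc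
  refine ⟨∫ x, ρ x • h x, ?_⟩
  have key : ∀ᵐ x, h x - (∫ y, ρ y • h y) = 0 := by
    refine ae_eq_zero_of_integral_contDiff_smul_eq_zero
      (hh.sub (locallyIntegrable_const _)) fun φ hφ hc => ?_
    have hφi : Integrable φ := hφ.continuous.integrable_of_hasCompactSupport hc
    have hρi : Integrable ρ := hρ.continuous.integrable_of_hasCompactSupport hρc
    have hscaled : ContDiff ℝ ∞ fun x => (∫ y, φ y) * ρ x := contDiff_const.mul hρ
    have hscaledc : HasCompactSupport fun x => (∫ y, φ y) * ρ x := hρc.mul_left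
    -- Subtracting the right multiple of `ρ` makes the integral zero, so the hypothesis on
    -- derivatives of test functions applies.
    obtain ⟨Φ, hΦ, hΦc, hΦd⟩ := exists_test_deriv_eq (ψ := fun x => φ x - (∫ y, φ y) * ρ x)
      (hφ.sub hscaled) (hc.sub hscaledc) (by
        rw [integral_sub hφi (hρi.const_mul _), integral_const_mul, hρ1]
        ring)
    have := h0 Φ hΦ hΦc
    rw [hΦd] at this
    simp only [sub_smul, mul_smul] at this
    have hρs : Integrable fun x => (∫ y, φ y) • ρ x • h x :=
      (hI ρ hρ hρc).smul (∫ y, φ y)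
    rw [integral_sub (hI φ hφ hc) hρs, integral_smul] at this
    simp only [smul_sub]
    rw [integral_sub (hI φ hφ hc) (hφi.smul_const _), integral_smul_const]
    exact this
  filter_upwards [key] with x hx
  exact sub_eq_zero.1 hx

theorem intervalIntegrable_of_memLp {g : ℝ → ℂ} (hg : MemLp g 2 volume) (a b : ℝ) :
    IntervalIntegrable g volume a b :=
  intervalIntegrable_iff.2 (((hg.locallyIntegrable (by norm_num)).integrableOn_isCompact
    isCompact_uIcc).mono_set Set.uIoc_subset_uIcc)

/-- A square integrable function with square integrable weak derivative has a continuous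
representative that is a primitive of it. -/
theorem IsWeakDeriv.exists_isPrimitive {f g : ℝ → ℂ} (hf : MemLp f 2 volume)
    (hg : MemLp g 2 volume) (h : IsWeakDeriv f g) :
    ∃ F : ℝ → ℂ, f =ᵐ[volume] F ∧ IsPrimitive F g := by
  have hgi := intervalIntegrable_of_memLp hg
  have hP : IsPrimitive (fun t => ∫ x in (0 : ℝ)..t, g x) g :=
    ⟨hgi, fun s t => intervalIntegral.integral_interval_sub_left (hgi _ _) (hgi _ _)⟩
  obtain ⟨c, hc⟩ := ae_eq_const_of_integral_deriv_smul_eq_zero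
    (h := fun t => f t - ∫ x in (0 : ℝ)..t, g x)
    ((hf.locallyIntegrable (by norm_num)).sub hP.continuous.locallyIntegrable) fun φ hφ hφc => by
      have hd : Continuous (deriv φ) := hφ.continuous_deriv (by simp)
      simp only [smul_sub]
      rw [integral_sub (integrable_test_smul hf hd hφc.deriv)
        (hP.continuous.locallyIntegrable.integrable_smul_left_of_hasCompactSupport hd hφc.deriv),
        h φ hφ hφc, hP.isWeakDeriv φ hφ hφc, sub_self]
  refine ⟨fun t => c + ∫ x in (0 : ℝ)..t, g x, ?_, hgi, fun s t => ?_⟩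
  · filter_upwards [hc] with t ht
    linear_combination ht
  · rw [← hP.sub_eq s t]
    ring

/-- Two continuous functions that agree almost everywhere are equal, so `f` itself, not just some
representative, is the primitive; point values are thereby controlled by the derivative. -/
theorem isPrimitive_weakDeriv {f : ℝ → ℂ} (hf : f ∈ formDomain) :
    IsPrimitive f (weakDeriv f) := by
  obtain ⟨hc, h2, hd, -⟩ := hf
  obtain ⟨hm, hw⟩ := weakDeriv_spec hd
  obtain ⟨F, hF, hP⟩ := hw.exists_isPrimitive h2 hm
  have e := (hc.ae_eq_iff_eq volume hP.continuous).1 hF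
  exact ⟨hP.1, fun s t => by rw [congrFun e t, congrFun e s, hP.sub_eq s t]⟩

theorem IsPrimitive.conj {f g : ℝ → ℂ} (h : IsPrimitive f g) :
    IsPrimitive (fun x => conj (f x)) (fun x => conj (g x)) where
  intervalIntegrable a b := by
    have hi := h.intervalIntegrable a b
    exact ⟨(Complex.conjLIE.integrable_comp_iff).2 hi.1,
      (Complex.conjLIE.integrable_comp_iff).2 hi.2⟩
  sub_eq s t := by
    rw [← map_sub, h.sub_eq s t, intervalIntegral, intervalIntegral, map_sub, integral_conj,
      integral_conj]

theorem conj_mem_formDomain {f : ℝ → ℂ} (hf : f ∈ formDomain) :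
    (fun x => conj (f x)) ∈ formDomain := by
  obtain ⟨hc, h2, hd, hx⟩ := id hf
  have hw := (isPrimitive_weakDeriv hf).conj.isWeakDeriv
  refine ⟨Complex.continuous_conj.comp hc, h2.star, ⟨_, (weakDeriv_spec hd).1.star, hw⟩, ?_⟩
  convert! hx.star using 2 with x
  simp

theorem weakDeriv_conj {f : ℝ → ℂ} (hf : f ∈ formDomain) :
    weakDeriv (fun x => conj (f x)) =ᵐ[volume] fun x => conj (weakDeriv f x) :=
  weakDeriv_ae_eq (weakDeriv_spec hf.2.2.1).1.star (isPrimitive_weakDeriv hf).conj.isWeakDeriv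

/-! ### Growth and decay -/

/-- Cauchy–Schwarz against the indicator of the interval. -/
theorem norm_intervalIntegral_le (g : L2) {s t : ℝ} (hst : s ≤ t) :
    ‖∫ x in s..t, g x‖ ≤ √(t - s) * ‖g‖ := by
  have hμ : volume (Set.Ioc s t) ≠ ⊤ := by simp
  have h := L2.inner_indicatorConstLp_one (𝕜 := ℂ) (measurableSet_Ioc (a := s) (b := t)) hμ g
  rw [intervalIntegral.integral_of_le hst, ← h]
  refine (norm_inner_le_norm _ _).trans_eq ?_
  rw [norm_indicatorConstLp (by norm_num) (by norm_num)]
  simp [Real.sqrt_eq_rpow, measureReal_def, ENNReal.toReal_ofReal (sub_nonneg.2 hst)]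

theorem IsPrimitive.norm_sub_le {f g : ℝ → ℂ} (h : IsPrimitive f g) (hg : MemLp g 2 volume)
    (s t : ℝ) : ‖f t - f s‖ ≤ √|t - s| * ‖hg.toLp g‖ := by
  wlog hst : s ≤ t generalizing s t
  · rw [norm_sub_rev, abs_sub_comm]
    exact this t s (le_of_not_ge hst)
  rw [abs_of_nonneg (sub_nonneg.2 hst)]
  convert norm_intervalIntegral_le (hg.toLp g) hst using 2
  rw [h.sub_eq s t]
  refine intervalIntegral.integral_congr_ae ?_
  filter_upwards [hg.coeFn_toLp] with x hx _
  exact hx.symm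

/-- A crude bound suffices: it only has to lose against the decay of the glued solutions, so that
boundary terms at infinity vanish. -/
theorem IsPrimitive.exists_growth_bound {f g : ℝ → ℂ} (h : IsPrimitive f g)
    (hg : MemLp g 2 volume) : ∃ K : ℝ, ∀ t, ‖f t‖ ≤ K * (1 + t ^ 2) := by
  refine ⟨‖f 0‖ + ‖hg.toLp g‖, fun t => ?_⟩
  have h1 := h.norm_sub_le hg 0 t
  have h2 : √|t - 0| ≤ 1 + t ^ 2 := by
    rw [sub_zero]
    refine Real.sqrt_le_iff.2 ⟨by positivity, ?_⟩
    nlinarith [sq_nonneg (|t| - 1), sq_abs t, sq_nonneg (t ^ 2), abs_nonneg t]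
  have h3 : ‖f t‖ ≤ ‖f 0‖ + ‖f t - f 0‖ := by
    simpa using norm_add_le (f 0) (f t - f 0)
  have h4 : ‖f 0‖ ≤ ‖f 0‖ * (1 + t ^ 2) := le_mul_of_one_le_right (norm_nonneg _) (by nlinarith)
  have h5 : √|t - 0| * ‖hg.toLp g‖ ≤ (1 + t ^ 2) * ‖hg.toLp g‖ := by gcongr
  linarith

/-- One factor `1 + x²` absorbs multiplication by `x`; the other leaves the square integrable
majorant `C / (1 + x²)`. -/
theorem memLp_of_decay {F : ℝ → ℂ} (hm : AEStronglyMeasurable F volume) {C : ℝ}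
    (h : ∀ x, ‖F x‖ * (1 + x ^ 2) ^ 2 ≤ C) :
    MemLp F 2 volume ∧ MemLp (fun x : ℝ => (x : ℂ) * F x) 2 volume := by
  have hw : MemLp (fun x : ℝ => C * (1 + x ^ 2)⁻¹) 2 volume := by
    refine MemLp.const_mul ?_ C
    have hc : Continuous fun x : ℝ => (1 + x ^ 2)⁻¹ := by
      refine Continuous.inv₀ (by fun_prop) fun x => ?_
      positivity
    refine (memLp_two_iff_integrable_sq hc.aestronglyMeasurable).2 ?_
    refine integrable_inv_one_add_sq.mono' (hc.pow 2).aestronglyMeasurable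
      (Filter.Eventually.of_forall fun x => ?_)
    rw [Real.norm_of_nonneg (by positivity)]
    have h0 : (0 : ℝ) ≤ (1 + x ^ 2)⁻¹ := by positivity
    have h1 : (1 + x ^ 2)⁻¹ ≤ (1 : ℝ) := inv_le_one_of_one_le₀ (by nlinarith)
    nlinarith
  have hmul : ∀ x, ‖F x‖ * (1 + x ^ 2) ≤ C * (1 + x ^ 2)⁻¹ := fun x => by
    rw [← div_eq_mul_inv, le_div_iff₀ (by positivity)]
    nlinarith [h x]
  refine ⟨hw.of_le hm (Filter.Eventually.of_forall fun x => ?_), hw.of_le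
    (Complex.continuous_ofReal.aestronglyMeasurable.mul hm)
    (Filter.Eventually.of_forall fun x => ?_)⟩
  · refine le_trans ?_ ((hmul x).trans (le_abs_self _))
    exact le_mul_of_one_le_right (norm_nonneg _) (by nlinarith)
  · refine le_trans ?_ ((hmul x).trans (le_abs_self _))
    rw [norm_mul, mul_comm, Complex.norm_real, Real.norm_eq_abs]
    gcongr
    nlinarith [sq_nonneg (|x| - 1), sq_abs x]

/-- `u` decays at `-∞` fast enough for `u` and `x u` to be square integrable there. -/
def DecaysLeft (u : ℝ → ℂ) : Prop :=
  DecaysRight fun x => u (-x)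

theorem tendsto_mul_of_decaysRight {f u : ℝ → ℂ} {K : ℝ} (hf : ∀ t, ‖f t‖ ≤ K * (1 + t ^ 2))
    (hu : DecaysRight u) : Filter.Tendsto (fun t => f t * u t) Filter.atTop (𝓝 0) := by
  obtain ⟨C, hC⟩ := hu 0
  have hK : 0 ≤ K := by simpa using (norm_nonneg _).trans (hf 0)
  have ht : Filter.Tendsto (fun t : ℝ => K * C * t⁻¹) Filter.atTop (𝓝 0) := by
    simpa using tendsto_inv_atTop_zero.const_mul (K * C)
  have hC0 : 0 ≤ C := le_trans (by positivity) (hC 0 le_rfl)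
  refine squeeze_zero_norm' ?_ ht
  filter_upwards [Filter.eventually_ge_atTop 1] with t h1
  have h0 : 0 < t := by linarith
  rw [norm_mul, ← div_eq_mul_inv, le_div_iff₀ h0]
  calc ‖f t‖ * ‖u t‖ * t ≤ (K * (1 + t ^ 2)) * ‖u t‖ * (1 + t ^ 2) := by
        gcongr
        · exact hf t
        · nlinarith
    _ = K * (‖u t‖ * (1 + t ^ 2) ^ 2) := by ring
    _ ≤ K * C := by
        gcongr
        exact hC t h0.le

theorem tendsto_mul_of_decaysLeft {f u : ℝ → ℂ} {K : ℝ} (hf : ∀ t, ‖f t‖ ≤ K * (1 + t ^ 2))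
    (hu : DecaysLeft u) :
    Filter.Tendsto (fun t => f (-t) * u (-t)) Filter.atTop (𝓝 0) :=
  tendsto_mul_of_decaysRight (f := fun t => f (-t)) (fun t => by simpa using hf (-t)) hu

/-! ### Functions glued from four pieces -/

/-- The function equal to `u₀`, `u₁`, `u₂`, `u₃` between the points `p₁ ≤ p₂ ≤ p₃`. -/
def glue (p₁ p₂ p₃ : ℝ) (u₀ u₁ u₂ u₃ : ℝ → ℂ) (x : ℝ) : ℂ :=
  if x ≤ p₁ then u₀ x else if x ≤ p₂ then u₁ x else if x ≤ p₃ then u₂ x else u₃ x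

section Glue

variable {p₁ p₂ p₃ : ℝ} {u₀ u₁ u₂ u₃ : ℝ → ℂ}

theorem measurable_glue (h₀ : Continuous u₀) (h₁ : Continuous u₁) (h₂ : Continuous u₂)
    (h₃ : Continuous u₃) : Measurable (glue p₁ p₂ p₃ u₀ u₁ u₂ u₃) :=
  Measurable.ite measurableSet_Iic h₀.measurable (Measurable.ite measurableSet_Iic h₁.measurable
    (Measurable.ite measurableSet_Iic h₂.measurable h₃.measurable))

theorem continuous_glue (h12 : p₁ ≤ p₂) (h23 : p₂ ≤ p₃) (h₀ : Continuous u₀) (h₁ : Continuous u₁)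
    (h₂ : Continuous u₂) (h₃ : Continuous u₃) (c₁ : u₀ p₁ = u₁ p₁) (c₂ : u₁ p₂ = u₂ p₂)
    (c₃ : u₂ p₃ = u₃ p₃) : Continuous (glue p₁ p₂ p₃ u₀ u₁ u₂ u₃) := by
  refine Continuous.if_le h₀ (Continuous.if_le h₁ (Continuous.if_le h₂ h₃ continuous_id
    continuous_const ?_) continuous_id continuous_const ?_) continuous_id continuous_const ?_
  · rintro x rfl
    exact c₃
  · rintro x rfl
    rw [if_pos h23]
    exact c₂
  · rintro x rfl
    rw [if_pos h12]
    exact c₁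

theorem exists_glue_bound (h₁ : Continuous u₁) (h₂ : Continuous u₂) (d₀ : DecaysLeft u₀)
    (d₃ : DecaysRight u₃) :
    ∃ C : ℝ, ∀ x, ‖glue p₁ p₂ p₃ u₀ u₁ u₂ u₃ x‖ * (1 + x ^ 2) ^ 2 ≤ C := by
  obtain ⟨C₀, b₀⟩ := d₀ (-p₁)
  obtain ⟨C₃, b₃⟩ := d₃ p₃
  have k₁ : Continuous fun x : ℝ => ‖u₁ x‖ * (1 + x ^ 2) ^ 2 := by fun_prop
  have k₂ : Continuous fun x : ℝ => ‖u₂ x‖ * (1 + x ^ 2) ^ 2 := by fun_prop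
  obtain ⟨C₁, b₁⟩ :=
    (isCompact_Icc (a := p₁) (b := p₂)).exists_bound_of_continuousOn k₁.continuousOn
  obtain ⟨C₂, b₂⟩ :=
    (isCompact_Icc (a := p₂) (b := p₃)).exists_bound_of_continuousOn k₂.continuousOn
  refine ⟨max (max C₀ C₁) (max C₂ C₃), fun x => ?_⟩
  unfold glue
  split_ifs with i₁ i₂ i₃
  · have := b₀ (-x) (by linarith)
    simp only [neg_neg, neg_sq] at this
    exact this.trans ((le_max_left _ _).trans (le_max_left _ _))
  · exact ((le_abs_self _).trans (b₁ x ⟨by linarith, i₂⟩)).trans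
      ((le_max_right _ _).trans (le_max_left _ _))
  · exact ((le_abs_self _).trans (b₂ x ⟨by linarith, i₃⟩)).trans
      ((le_max_left _ _).trans (le_max_right _ _))
  · exact (b₃ x (by linarith)).trans ((le_max_right _ _).trans (le_max_right _ _))

/-- Each piece is integrated by its own primitive on the whole line, and the outer primitives vanish
at infinity. Only the mismatches at the gluing points remain. -/
theorem integral_glue (h12 : p₁ ≤ p₂) (h23 : p₂ ≤ p₃) {Q₀ Q₁ Q₂ Q₃ : ℝ → ℂ}
    (hi : Integrable (glue p₁ p₂ p₃ u₀ u₁ u₂ u₃))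
    (h₀ : ∀ s t, ∫ x in s..t, u₀ x = Q₀ t - Q₀ s) (h₁ : ∀ s t, ∫ x in s..t, u₁ x = Q₁ t - Q₁ s)
    (h₂ : ∀ s t, ∫ x in s..t, u₂ x = Q₂ t - Q₂ s) (h₃ : ∀ s t, ∫ x in s..t, u₃ x = Q₃ t - Q₃ s)
    (l₀ : Filter.Tendsto (fun t => Q₀ (-t)) Filter.atTop (𝓝 0))
    (l₃ : Filter.Tendsto Q₃ Filter.atTop (𝓝 0)) :
    ∫ x, glue p₁ p₂ p₃ u₀ u₁ u₂ u₃ x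
      = Q₀ p₁ + (Q₁ p₂ - Q₁ p₁) + (Q₂ p₃ - Q₂ p₂) - Q₃ p₃ := by
  have hlim := intervalIntegral_tendsto_integral hi Filter.tendsto_neg_atTop_atBot Filter.tendsto_id
  refine tendsto_nhds_unique hlim ?_
  have hlim' : Filter.Tendsto (fun t => (Q₀ p₁ - Q₀ (-t)) + (Q₁ p₂ - Q₁ p₁) + (Q₂ p₃ - Q₂ p₂)
      + (Q₃ t - Q₃ p₃)) Filter.atTop
      (𝓝 ((Q₀ p₁ - 0) + (Q₁ p₂ - Q₁ p₁) + (Q₂ p₃ - Q₂ p₂) + (0 - Q₃ p₃))) :=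
    (((tendsto_const_nhds.sub l₀).add tendsto_const_nhds).add tendsto_const_nhds).add
      (l₃.sub tendsto_const_nhds)
  have e : (Q₀ p₁ - 0) + (Q₁ p₂ - Q₁ p₁) + (Q₂ p₃ - Q₂ p₂) + (0 - Q₃ p₃)
      = Q₀ p₁ + (Q₁ p₂ - Q₁ p₁) + (Q₂ p₃ - Q₂ p₂) - Q₃ p₃ := by ring
  rw [e] at hlim'
  refine hlim'.congr' ?_
  filter_upwards [Filter.eventually_ge_atTop (-p₁), Filter.eventually_ge_atTop p₃] with t ht1 ht3
  have hI : ∀ a b, IntervalIntegrable (glue p₁ p₂ p₃ u₀ u₁ u₂ u₃) volume a b := fun a b =>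
    hi.intervalIntegrable
  rw [id, ← intervalIntegral.integral_add_adjacent_intervals (hI (-t) p₃) (hI p₃ t),
    ← intervalIntegral.integral_add_adjacent_intervals (hI (-t) p₂) (hI p₂ p₃),
    ← intervalIntegral.integral_add_adjacent_intervals (hI (-t) p₁) (hI p₁ p₂),
    ← h₀, ← h₁, ← h₂, ← h₃]
  congr 1
  · congr 1
    · congr 1
      · refine intervalIntegral.integral_congr_ae (Filter.Eventually.of_forall fun x hx => ?_)
        rw [Set.uIoc_of_le (by linarith)] at hx
        rw [glue, if_pos hx.2]
      · refine intervalIntegral.integral_congr_ae (Filter.Eventually.of_forall fun x hx => ?_)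
        rw [Set.uIoc_of_le h12] at hx
        rw [glue, if_neg (by linarith [hx.1]), if_pos hx.2]
    · refine intervalIntegral.integral_congr_ae (Filter.Eventually.of_forall fun x hx => ?_)
      rw [Set.uIoc_of_le h23] at hx
      rw [glue, if_neg (by linarith [hx.1]), if_neg (by linarith [hx.1]), if_pos hx.2]
  · refine intervalIntegral.integral_congr_ae (Filter.Eventually.of_forall fun x hx => ?_)
    rw [Set.uIoc_of_le ht3] at hx
    rw [glue, if_neg (by linarith [hx.1]), if_neg (by linarith [hx.1]), if_neg (by linarith [hx.1])]

end Glue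

/-- Data of a continuous, decaying function that solves the homogeneous equation off the points
`p₁ ≤ p₂ ≤ p₃`. -/
structure GlueData (ν : ℂ) (p₁ p₂ p₃ : ℝ) (u₀ u₁ u₂ u₃ u₀' u₁' u₂' u₃' : ℝ → ℂ) : Prop where
  le₁ : p₁ ≤ p₂
  le₂ : p₂ ≤ p₃
  sol₀ : IsSol ν u₀ u₀'
  sol₁ : IsSol ν u₁ u₁'
  sol₂ : IsSol ν u₂ u₂'
  sol₃ : IsSol ν u₃ u₃'
  eq₁ : u₀ p₁ = u₁ p₁
  eq₂ : u₁ p₂ = u₂ p₂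
  eq₃ : u₂ p₃ = u₃ p₃
  decays₀ : DecaysLeft u₀
  decays₀' : DecaysLeft u₀'
  decays₃ : DecaysRight u₃
  decays₃' : DecaysRight u₃'

namespace GlueData

variable {ν : ℂ} {p₁ p₂ p₃ : ℝ} {u₀ u₁ u₂ u₃ u₀' u₁' u₂' u₃' : ℝ → ℂ}

theorem memLp (h : GlueData ν p₁ p₂ p₃ u₀ u₁ u₂ u₃ u₀' u₁' u₂' u₃') :
    MemLp (glue p₁ p₂ p₃ u₀ u₁ u₂ u₃) 2 volume ∧
      MemLp (fun x : ℝ => (x : ℂ) * glue p₁ p₂ p₃ u₀ u₁ u₂ u₃ x) 2 volume := by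
  obtain ⟨C, hC⟩ := exists_glue_bound (p₁ := p₁) (p₂ := p₂) (p₃ := p₃) h.sol₁.continuous
    h.sol₂.continuous h.decays₀ h.decays₃
  exact memLp_of_decay (measurable_glue h.sol₀.continuous h.sol₁.continuous h.sol₂.continuous
    h.sol₃.continuous).aestronglyMeasurable hC

theorem memLp' (h : GlueData ν p₁ p₂ p₃ u₀ u₁ u₂ u₃ u₀' u₁' u₂' u₃') :
    MemLp (glue p₁ p₂ p₃ u₀' u₁' u₂' u₃') 2 volume := by
  obtain ⟨C, hC⟩ := exists_glue_bound (p₁ := p₁) (p₂ := p₂) (p₃ := p₃) h.sol₁.continuous'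
    h.sol₂.continuous' h.decays₀' h.decays₃'
  exact (memLp_of_decay (measurable_glue h.sol₀.continuous' h.sol₁.continuous' h.sol₂.continuous'
    h.sol₃.continuous').aestronglyMeasurable hC).1

theorem isWeakDeriv (h : GlueData ν p₁ p₂ p₃ u₀ u₁ u₂ u₃ u₀' u₁' u₂' u₃') :
    IsWeakDeriv (glue p₁ p₂ p₃ u₀ u₁ u₂ u₃) (glue p₁ p₂ p₃ u₀' u₁' u₂' u₃') := by
  intro φ hφ hc
  have hd : Continuous (deriv φ) := hφ.continuous_deriv (by simp)
  have hi1 := integrable_test_smul h.memLp.1 hd hc.deriv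
  have hi2 := integrable_test_smul h.memLp' hφ.continuous hc
  have hbound : ∃ K : ℝ, ∀ t, ‖(φ t : ℂ)‖ ≤ K * (1 + t ^ 2) := by
    obtain ⟨K, hK⟩ := hφ.continuous.bounded_above_of_compact_support hc
    refine ⟨K, fun t => ?_⟩
    rw [Complex.norm_real]
    exact (hK t).trans (le_mul_of_one_le_right ((norm_nonneg _).trans (hK t)) (by nlinarith))
  obtain ⟨K, hK⟩ := hbound
  have hH : (fun x => deriv φ x • glue p₁ p₂ p₃ u₀ u₁ u₂ u₃ x
      + φ x • glue p₁ p₂ p₃ u₀' u₁' u₂' u₃' x) = glue p₁ p₂ p₃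
        (fun x => deriv φ x • u₀ x + φ x • u₀' x) (fun x => deriv φ x • u₁ x + φ x • u₁' x)
        (fun x => deriv φ x • u₂ x + φ x • u₂' x) (fun x => deriv φ x • u₃ x + φ x • u₃' x) := by
    funext x
    unfold glue
    split_ifs <;> rfl
  have hQ : ∀ {u u' : ℝ → ℂ}, IsSol ν u u' → ∀ s t : ℝ,
      ∫ x in s..t, (deriv φ x • u x + φ x • u' x) = (φ t : ℂ) * u t - (φ s : ℂ) * u s := by
    intro u u' hu s t
    refine intervalIntegral.integral_eq_sub_of_hasDerivAt (f := fun x => (φ x : ℂ) * u x)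
      (fun x _ => ?_) ?_
    · simp only [Complex.real_smul]
      exact (hφ.differentiable (by simp) x).hasDerivAt.ofReal_comp.mul (hu.hasDerivAt x)
    · exact ((hd.smul hu.continuous).add (hφ.continuous.smul hu.continuous')).intervalIntegrable _ _
  have key := integral_glue (p₁ := p₁) (p₂ := p₂) (p₃ := p₃) h.le₁ h.le₂
    (hH ▸ hi1.add hi2) (hQ h.sol₀) (hQ h.sol₁) (hQ h.sol₂) (hQ h.sol₃)
    (tendsto_mul_of_decaysLeft (f := fun t => (φ t : ℂ)) hK h.decays₀)
    (tendsto_mul_of_decaysRight hK h.decays₃)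
  rw [← hH, integral_add hi1 hi2, ← h.eq₁, ← h.eq₂, ← h.eq₃] at key
  linear_combination key

theorem mem_formDomain (h : GlueData ν p₁ p₂ p₃ u₀ u₁ u₂ u₃ u₀' u₁' u₂' u₃') :
    glue p₁ p₂ p₃ u₀ u₁ u₂ u₃ ∈ formDomain :=
  ⟨continuous_glue h.le₁ h.le₂ h.sol₀.continuous h.sol₁.continuous h.sol₂.continuous
    h.sol₃.continuous h.eq₁ h.eq₂ h.eq₃, h.memLp.1, ⟨_, h.memLp', h.isWeakDeriv⟩, h.memLp.2⟩

theorem weakDeriv_glue (h : GlueData ν p₁ p₂ p₃ u₀ u₁ u₂ u₃ u₀' u₁' u₂' u₃') :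
    weakDeriv (glue p₁ p₂ p₃ u₀ u₁ u₂ u₃) =ᵐ[volume] glue p₁ p₂ p₃ u₀' u₁' u₂' u₃' :=
  weakDeriv_ae_eq h.memLp' h.isWeakDeriv

/-- Green's identity: only the kinks of the glued function contribute. -/
theorem green (h : GlueData ν p₁ p₂ p₃ u₀ u₁ u₂ u₃ u₀' u₁' u₂' u₃') {f : ℝ → ℂ}
    (hf : f ∈ formDomain) :
    (∫ x, weakDeriv f x * weakDeriv (glue p₁ p₂ p₃ u₀ u₁ u₂ u₃) x)
      + 1 / 4 * (∫ x : ℝ, ((x : ℂ) * f x) * ((x : ℂ) * glue p₁ p₂ p₃ u₀ u₁ u₂ u₃ x))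
      - (1 / 2 + ν) * (∫ x, f x * glue p₁ p₂ p₃ u₀ u₁ u₂ u₃ x)
      = f p₁ * (u₀' p₁ - u₁' p₁) + f p₂ * (u₁' p₂ - u₂' p₂) + f p₃ * (u₂' p₃ - u₃' p₃) := by
  have hP := isPrimitive_weakDeriv hf
  obtain ⟨hfc, hf2, hfd, hfx⟩ := hf
  have hd2 := (weakDeriv_spec hfd).1
  obtain ⟨K, hK⟩ := hP.exists_growth_bound hd2
  have e1 : ∫ x, weakDeriv f x * weakDeriv (glue p₁ p₂ p₃ u₀ u₁ u₂ u₃) x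
      = ∫ x, weakDeriv f x * glue p₁ p₂ p₃ u₀' u₁' u₂' u₃' x := by
    refine integral_congr_ae ?_
    filter_upwards [h.weakDeriv_glue] with x hx
    rw [hx]
  have i1 : Integrable fun x => weakDeriv f x * glue p₁ p₂ p₃ u₀' u₁' u₂' u₃' x :=
    hd2.integrable_mul h.memLp'
  have i2 : Integrable fun x : ℝ => ((x : ℂ) * f x) * ((x : ℂ) * glue p₁ p₂ p₃ u₀ u₁ u₂ u₃ x) :=
    hfx.integrable_mul h.memLp.2
  have i3 : Integrable fun x => f x * glue p₁ p₂ p₃ u₀ u₁ u₂ u₃ x := hf2.integrable_mul h.memLp.1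
  have i4 : Integrable fun x : ℝ => weakDeriv f x * glue p₁ p₂ p₃ u₀' u₁' u₂' u₃' x
      + 1 / 4 * (((x : ℂ) * f x) * ((x : ℂ) * glue p₁ p₂ p₃ u₀ u₁ u₂ u₃ x)) :=
    i1.add (i2.const_mul (1 / 4))
  rw [e1, ← integral_const_mul, ← integral_const_mul, ← integral_add i1 (i2.const_mul _),
    ← integral_sub i4 (i3.const_mul _)]
  have hH : (fun x : ℝ => weakDeriv f x * glue p₁ p₂ p₃ u₀' u₁' u₂' u₃' x
      + 1 / 4 * (((x : ℂ) * f x) * ((x : ℂ) * glue p₁ p₂ p₃ u₀ u₁ u₂ u₃ x))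
      - (1 / 2 + ν) * (f x * glue p₁ p₂ p₃ u₀ u₁ u₂ u₃ x)) = glue p₁ p₂ p₃
        (fun x => weakDeriv f x * u₀' x + f x * (((x : ℂ) ^ 2 / 4 - 1 / 2 - ν) * u₀ x))
        (fun x => weakDeriv f x * u₁' x + f x * (((x : ℂ) ^ 2 / 4 - 1 / 2 - ν) * u₁ x))
        (fun x => weakDeriv f x * u₂' x + f x * (((x : ℂ) ^ 2 / 4 - 1 / 2 - ν) * u₂ x))
        (fun x => weakDeriv f x * u₃' x + f x * (((x : ℂ) ^ 2 / 4 - 1 / 2 - ν) * u₃ x)) := by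
    funext x
    unfold glue
    split_ifs <;> ring
  have hQ : ∀ {u u' : ℝ → ℂ}, IsSol ν u u' → ∀ s t : ℝ,
      ∫ x in s..t, (weakDeriv f x * u' x + f x * (((x : ℂ) ^ 2 / 4 - 1 / 2 - ν) * u x))
        = f t * u' t - f s * u' s := by
    intro u u' hu s t
    have hc := hu.continuous
    exact hP.integral_mul_add hu.hasDerivAt' (by fun_prop) s t
  have hint := i4.sub (i3.const_mul (1 / 2 + ν))
  have key := integral_glue (p₁ := p₁) (p₂ := p₂) (p₃ := p₃) h.le₁ h.le₂
    (hH ▸ hint) (hQ h.sol₀) (hQ h.sol₁) (hQ h.sol₂) (hQ h.sol₃)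
    (tendsto_mul_of_decaysLeft hK h.decays₀') (tendsto_mul_of_decaysRight hK h.decays₃')
  rw [← hH] at key
  exact key.trans (by ring)

end GlueData

/-! ### Eigenfunctions and uniqueness -/

namespace GlueData

variable {ν : ℂ} {p₁ p₂ p₃ : ℝ} {u₀ u₁ u₂ u₃ u₀' u₁' u₂' u₃' : ℝ → ℂ}

/-- Conjugating the test function makes the pairing bilinear, so the glued function solves the
equation with the same `ν` and `z`, not with their conjugates. -/
theorem form_conj_right (h : GlueData ν p₁ p₂ p₃ u₀ u₁ u₂ u₃ u₀' u₁' u₂' u₃') (z : ℂ) (b : ℝ)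
    {f : ℝ → ℂ} (hf : f ∈ formDomain) :
    form z b f (fun x => conj (glue p₁ p₂ p₃ u₀ u₁ u₂ u₃ x))
      - ν * (∫ x, f x * conj (conj (glue p₁ p₂ p₃ u₀ u₁ u₂ u₃ x)))
      = f p₁ * (u₀' p₁ - u₁' p₁) + f p₂ * (u₁' p₂ - u₂' p₂) + f p₃ * (u₂' p₃ - u₃' p₃)
        + z * (f b * glue p₁ p₂ p₃ u₀ u₁ u₂ u₃ b
          - f (-b) * glue p₁ p₂ p₃ u₀ u₁ u₂ u₃ (-b)) := by
  have e : ∫ x, weakDeriv f x *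
        conj (weakDeriv (fun x => conj (glue p₁ p₂ p₃ u₀ u₁ u₂ u₃ x)) x)
      = ∫ x, weakDeriv f x * weakDeriv (glue p₁ p₂ p₃ u₀ u₁ u₂ u₃) x := by
    refine integral_congr_ae ?_
    filter_upwards [weakDeriv_conj h.mem_formDomain] with x hx
    rw [hx, Complex.conj_conj]
  rw [form, e, ← h.green hf]
  simp only [map_mul, Complex.conj_ofReal, Complex.conj_conj]
  ring

theorem form_left (h : GlueData ν p₁ p₂ p₃ u₀ u₁ u₂ u₃ u₀' u₁' u₂' u₃') (z : ℂ) (b : ℝ)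
    {g : ℝ → ℂ} (hg : g ∈ formDomain) :
    form z b (glue p₁ p₂ p₃ u₀ u₁ u₂ u₃) g
      - ν * (∫ x, glue p₁ p₂ p₃ u₀ u₁ u₂ u₃ x * conj (g x))
      = conj (g p₁) * (u₀' p₁ - u₁' p₁) + conj (g p₂) * (u₁' p₂ - u₂' p₂)
        + conj (g p₃) * (u₂' p₃ - u₃' p₃)
        + z * (glue p₁ p₂ p₃ u₀ u₁ u₂ u₃ b * conj (g b)
          - glue p₁ p₂ p₃ u₀ u₁ u₂ u₃ (-b) * conj (g (-b))) := by
  have e : ∫ x, weakDeriv (glue p₁ p₂ p₃ u₀ u₁ u₂ u₃) x * conj (weakDeriv g x)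
      = ∫ x, weakDeriv (fun x => conj (g x)) x * weakDeriv (glue p₁ p₂ p₃ u₀ u₁ u₂ u₃) x := by
    refine integral_congr_ae ?_
    filter_upwards [weakDeriv_conj hg] with x hx
    rw [hx, mul_comm]
  have k := h.green (conj_mem_formDomain hg)
  rw [form, e, ← k]
  simp only [map_mul, Complex.conj_ofReal]
  simp only [mul_comm (glue _ _ _ _ _ _ _ _) (conj _),
    mul_comm (_ * glue _ _ _ _ _ _ _ _) (_ * conj _)]
  ring

end GlueData

theorem decaysLeft_parabolicD_neg (ν : ℂ) : DecaysLeft fun x : ℝ => parabolicD ν (-x : ℝ) := by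
  simpa [DecaysLeft] using decaysRight_parabolicD ν

theorem decaysLeft_parabolicD'_neg (ν : ℂ) :
    DecaysLeft fun x : ℝ => -parabolicD' ν (-x : ℝ) := by
  simpa [DecaysLeft] using (decaysRight_parabolicD' ν).const_mul (-1)

theorem DecaysLeft.const_mul {u : ℝ → ℂ} (h : DecaysLeft u) (c : ℂ) :
    DecaysLeft fun x => c * u x :=
  DecaysRight.const_mul h c

theorem isSol_parabolicD_neg (ν : ℂ) :
    IsSol ν (fun x : ℝ => parabolicD ν (-x : ℝ)) (fun x : ℝ => -parabolicD' ν (-x : ℝ)) :=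
  (isSol_parabolicD ν).comp_neg

theorem exists_eigenfunction {z ν : ℂ} {b : ℝ} (hb : 0 < b) (h0 : charFun z ν b = 0) :
    ∃ f ∈ formDomain, f ≠ 0 ∧
      ∀ g ∈ formDomain, form z b f g = ν * ∫ x, f x * conj (g x) := by
  obtain ⟨u, u', hu, hub, hub'⟩ := exists_isSol ν (-b) (parabolicD ν b)
    (-parabolicD' ν b - z * parabolicD ν b)
  have hw := wronskian_eq_charFun hu hub hub'
  rw [h0, mul_zero] at hw
  obtain ⟨v, v', hv, hvb, hvb'⟩ := exists_isSol ν b (u b) (u' b + z * u b)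
  obtain ⟨c, hc⟩ := (isSol_parabolicD ν).eq_const_mul hv (p := b) (by rw [hvb, hvb', hw])
    (exists_parabolicD_ne_zero ν)
  -- Only two kinks are needed, so the third gluing point repeats `b` with the same solution on both
  -- sides.
  have hG : GlueData ν (-b) b b (fun x : ℝ => parabolicD ν (-x : ℝ)) u
      (fun x : ℝ => c * parabolicD ν x) (fun x : ℝ => c * parabolicD ν x)
      (fun x : ℝ => -parabolicD' ν (-x : ℝ)) u'
      (fun x : ℝ => c * parabolicD' ν x) (fun x : ℝ => c * parabolicD' ν x) :=
    { le₁ := by linarith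
      le₂ := le_rfl
      sol₀ := isSol_parabolicD_neg ν
      sol₁ := hu
      sol₂ := (isSol_parabolicD ν).const_mul c
      sol₃ := (isSol_parabolicD ν).const_mul c
      eq₁ := by rw [hub, neg_neg]
      eq₂ := by rw [← hvb, (hc b).1]
      eq₃ := rfl
      decays₀ := decaysLeft_parabolicD_neg ν
      decays₀' := decaysLeft_parabolicD'_neg ν
      decays₃ := (decaysRight_parabolicD ν).const_mul c
      decays₃' := (decaysRight_parabolicD' ν).const_mul c }
  refine ⟨_, hG.mem_formDomain, fun hzero => ?_, fun g hg => ?_⟩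
  -- If the glued function were zero, `D_ν(-x)` would vanish on a half line, hence with its
  -- derivative at an interior point, hence everywhere.
  · have hz : ∀ x : ℝ, x ≤ -b → parabolicD ν (-x : ℝ) = 0 := fun x hx => by
      have := congrFun hzero x
      rwa [glue, if_pos hx] at this
    have hd := (isSol_parabolicD_neg ν).hasDerivAt (-b - 1)
    have hev : (fun x : ℝ => parabolicD ν (-x : ℝ)) =ᶠ[𝓝 (-b - 1)] fun _ => 0 := by
      filter_upwards [Iio_mem_nhds (show -b - 1 < -b by linarith)] with x hx
      exact hz x (le_of_lt hx)
    have hd0 := (hd.congr_of_eventuallyEq hev.symm).unique (hasDerivAt_const (-b - 1) (0 : ℂ))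
    obtain ⟨x, hx⟩ := exists_parabolicD_ne_zero ν
    refine hx ?_
    have := (isSol_parabolicD_neg ν).eq_zero (hz (-b - 1) (by linarith)) hd0 (-x)
    rwa [neg_neg] at this
  · have key := hG.form_left z b hg
    have gb : glue (-b) b b (fun x : ℝ => parabolicD ν (-x : ℝ)) u
      (fun x : ℝ => c * parabolicD ν x) (fun x : ℝ => c * parabolicD ν x) b = u b := by
      rw [glue, if_neg (by linarith), if_pos le_rfl]
    have gb' : glue (-b) b b (fun x : ℝ => parabolicD ν (-x : ℝ)) u
      (fun x : ℝ => c * parabolicD ν x) (fun x : ℝ => c * parabolicD ν x) (-b)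
        = parabolicD ν b := by
      rw [glue, if_pos le_rfl, neg_neg]
    rw [gb, gb', neg_neg, hub', ← (hc b).2, hvb'] at key
    linear_combination key

/-- The functions `l`, `m` continue `D_ν(-x)` rightwards through `-b` and `b`; `r`, `s` continue
`D_ν` leftwards through `b` and `-b`. Joining the two families at `y` gives a Green function in the
form domain, and testing against it isolates `f y`. -/
theorem eq_zero_of_form_eq {z ν : ℂ} {b : ℝ} (hb : 0 < b) (h0 : charFun z ν b ≠ 0)
    {f : ℝ → ℂ} (hf : f ∈ formDomain)
    (h : ∀ g ∈ formDomain, form z b f g = ν * ∫ x, f x * conj (g x)) : f = 0 := by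
  obtain ⟨l, l', hl, hlb, hlb'⟩ := exists_isSol ν (-b) (parabolicD ν b)
    (-parabolicD' ν b - z * parabolicD ν b)
  have hw := wronskian_eq_charFun hl hlb hlb'
  obtain ⟨m, m', hm, hmb, hmb'⟩ := exists_isSol ν b (l b) (l' b + z * l b)
  obtain ⟨r, r', hr, hrb, hrb'⟩ := exists_isSol ν b (parabolicD ν b)
    (parabolicD' ν b - z * parabolicD ν b)
  obtain ⟨s, s', hs, hsb, hsb'⟩ := exists_isSol ν (-b) (r (-b)) (r' (-b) + z * r (-b))
  set w : ℂ := (√(2 * Real.pi) : ℂ) * charFun z ν b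
  have hw0 : w ≠ 0 := by
    refine mul_ne_zero ?_ h0
    exact_mod_cast (Real.sqrt_pos.2 (by positivity)).ne'
  have solL := isSol_parabolicD_neg ν
  have solR := isSol_parabolicD ν
  -- The jump conditions preserve the Wronskian, so the two continued solutions have the same
  -- nonzero Wronskian `w` on all three intervals.
  have w₂ : ∀ y : ℝ, parabolicD ν y * m' y - parabolicD' ν y * m y = w := fun y => by
    rw [solR.wronskian_eq hm y b, hmb, hmb', hw]
  have w₁ : ∀ y, r y * l' y - r' y * l y = w := fun y => by
    rw [hr.wronskian_eq hl y b, hrb, hrb', ← hw]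
    ring
  have w₀ : ∀ y : ℝ, s y * -parabolicD' ν (-y : ℝ) - s' y * parabolicD ν (-y : ℝ) = w := fun y => by
    rw [hs.wronskian_eq solL y (-b), hsb, hsb', ← w₁ (-b), hlb, hlb', neg_neg]
    ring
  have finish : ∀ y, f y * w = 0 → f y = 0 := fun y hy =>
    (mul_eq_zero.1 hy).resolve_right hw0
  have hright : ∀ y, b < y → f y = 0 := fun y hy => by
    have hG : GlueData ν (-b) b y (fun x : ℝ => parabolicD ν y * parabolicD ν (-x : ℝ))
        (fun x => parabolicD ν y * l x) (fun x => parabolicD ν y * m x)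
        (fun x : ℝ => m y * parabolicD ν x)
        (fun x : ℝ => parabolicD ν y * -parabolicD' ν (-x : ℝ)) (fun x => parabolicD ν y * l' x)
        (fun x => parabolicD ν y * m' x) (fun x : ℝ => m y * parabolicD' ν x) :=
      { le₁ := by linarith
        le₂ := hy.le
        sol₀ := solL.const_mul _
        sol₁ := hl.const_mul _
        sol₂ := hm.const_mul _
        sol₃ := solR.const_mul _
        eq₁ := by rw [hlb, neg_neg]
        eq₂ := by rw [hmb]
        eq₃ := mul_comm _ _
        decays₀ := (decaysLeft_parabolicD_neg ν).const_mul _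
        decays₀' := (decaysLeft_parabolicD'_neg ν).const_mul _
        decays₃ := (decaysRight_parabolicD ν).const_mul _
        decays₃' := (decaysRight_parabolicD' ν).const_mul _ }
    -- The kinks at `±b` cancel the point interactions; the kink at `y` contributes `f y` times the
    -- Wronskian, up to sign.
    have key := hG.form_conj_right z b hf
    rw [h _ (conj_mem_formDomain hG.mem_formDomain), sub_self] at key
    rw [glue, if_neg (by linarith), if_pos le_rfl, glue, if_pos le_rfl, neg_neg, hlb', hmb'] at key
    refine finish y ?_
    rw [← w₂ y]
    linear_combination -key
  have hmid : ∀ y, -b < y → y < b → f y = 0 := fun y hy hy' => by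
    have hG : GlueData ν (-b) y b (fun x : ℝ => r y * parabolicD ν (-x : ℝ))
        (fun x => r y * l x) (fun x => l y * r x) (fun x : ℝ => l y * parabolicD ν x)
        (fun x : ℝ => r y * -parabolicD' ν (-x : ℝ)) (fun x => r y * l' x)
        (fun x => l y * r' x) (fun x : ℝ => l y * parabolicD' ν x) :=
      { le₁ := hy.le
        le₂ := hy'.le
        sol₀ := solL.const_mul _
        sol₁ := hl.const_mul _
        sol₂ := hr.const_mul _
        sol₃ := solR.const_mul _
        eq₁ := by rw [hlb, neg_neg]
        eq₂ := mul_comm _ _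
        eq₃ := by rw [hrb]
        decays₀ := (decaysLeft_parabolicD_neg ν).const_mul _
        decays₀' := (decaysLeft_parabolicD'_neg ν).const_mul _
        decays₃ := (decaysRight_parabolicD ν).const_mul _
        decays₃' := (decaysRight_parabolicD' ν).const_mul _ }
    have key := hG.form_conj_right z b hf
    rw [h _ (conj_mem_formDomain hG.mem_formDomain), sub_self] at key
    rw [glue, if_neg (by linarith), if_neg (by linarith), if_pos le_rfl, glue, if_pos le_rfl,
      neg_neg, hlb', hrb, hrb'] at key
    refine finish y ?_
    rw [← w₁ y]
    linear_combination -key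
  have hleft : ∀ y, y < -b → f y = 0 := fun y hy => by
    have hG : GlueData ν y (-b) b (fun x : ℝ => s y * parabolicD ν (-x : ℝ))
        (fun x => parabolicD ν (-y : ℝ) * s x) (fun x => parabolicD ν (-y : ℝ) * r x)
        (fun x : ℝ => parabolicD ν (-y : ℝ) * parabolicD ν x)
        (fun x : ℝ => s y * -parabolicD' ν (-x : ℝ)) (fun x => parabolicD ν (-y : ℝ) * s' x)
        (fun x => parabolicD ν (-y : ℝ) * r' x)
        (fun x : ℝ => parabolicD ν (-y : ℝ) * parabolicD' ν x) :=
      { le₁ := hy.le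
        le₂ := by linarith
        sol₀ := solL.const_mul _
        sol₁ := hs.const_mul _
        sol₂ := hr.const_mul _
        sol₃ := solR.const_mul _
        eq₁ := mul_comm _ _
        eq₂ := by rw [hsb]
        eq₃ := by rw [hrb]
        decays₀ := (decaysLeft_parabolicD_neg ν).const_mul _
        decays₀' := (decaysLeft_parabolicD'_neg ν).const_mul _
        decays₃ := (decaysRight_parabolicD ν).const_mul _
        decays₃' := (decaysRight_parabolicD' ν).const_mul _ }
    have key := hG.form_conj_right z b hf
    rw [h _ (conj_mem_formDomain hG.mem_formDomain), sub_self] at key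
    rw [glue, if_neg (by linarith), if_neg (by linarith), if_pos le_rfl, glue,
      if_neg (by linarith), if_pos le_rfl, hsb, hsb', hrb, hrb'] at key
    refine finish y ?_
    rw [← w₀ y]
    linear_combination -key
  -- The values at `±b` follow by continuity.
  have hdense : Dense ({-b, b}ᶜ : Set ℝ) := (Set.toFinite {-b, b}).countable.dense_compl ℝ
  refine hf.1.ext_on hdense continuous_zero fun y hy => ?_
  simp only [Set.mem_compl_iff, Set.mem_insert_iff, Set.mem_singleton_iff, not_or] at hy
  rcases lt_or_gt_of_ne hy.1 with h1 | h1
  · exact hleft y h1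
  · rcases lt_or_gt_of_ne hy.2 with h2 | h2
    · exact hmid y h1 h2
    · exact hright y h2

/-! ### Operators that are coercive on a subspace of finite codimension -/

section Fredholm

variable {V : Type*} [NormedAddCommGroup V] [InnerProductSpace ℂ V] [CompleteSpace V]

/-- The Lax–Milgram argument: coercivity bounds `A` below, so its range is closed, and a vector
orthogonal to the range has zero form. -/
theorem bijective_of_coercive (A : V →L[ℂ] V) {c : ℝ} (hc : 0 < c)
    (h : ∀ v, c * ‖v‖ ^ 2 ≤ (inner ℂ v (A v)).re) : Function.Bijective A := by
  have hbound : ∀ v, ‖v‖ ≤ c⁻¹ * ‖A v‖ := fun v => by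
    rcases eq_or_ne v 0 with rfl | hv
    · simp
    have hv' : 0 < ‖v‖ := norm_pos_iff.2 hv
    have h1 : c * ‖v‖ ^ 2 ≤ ‖v‖ * ‖A v‖ :=
      (h v).trans ((Complex.re_le_norm _).trans (norm_inner_le_norm _ _))
    rw [← div_eq_inv_mul, le_div_iff₀ hc]
    have h2 : ‖v‖ * (‖v‖ * c) ≤ ‖v‖ * ‖A v‖ := by linarith
    exact le_of_mul_le_mul_left h2 hv'
  have hanti : AntilipschitzWith c⁻¹.toNNReal A := by
    refine A.antilipschitz_of_bound fun v => ?_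
    rw [Real.coe_toNNReal _ (inv_nonneg.2 hc.le)]
    exact hbound v
  have hclosed : IsClosed (A.range : Set V) := by
    rw [LinearMap.coe_range]
    exact hanti.isClosed_range A.uniformContinuous
  refine ⟨hanti.injective, ?_⟩
  have : CompleteSpace A.range := hclosed.completeSpace_coe
  refine LinearMap.range_eq_top.1 ((Submodule.orthogonal_eq_bot_iff (K := A.range)).1 ?_)
  refine (Submodule.eq_bot_iff _).2 fun w hw => ?_
  have h0 : inner ℂ w (A w) = 0 :=
    Submodule.inner_left_of_mem_orthogonal (K := A.range) (LinearMap.mem_range_self _ w) hw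
  have h1 := h w
  rw [h0, Complex.zero_re] at h1
  have h2 : ‖w‖ ^ 2 ≤ 0 := by
    by_contra! hcon
    nlinarith [mul_pos hc hcon]
  exact norm_eq_zero.1 (by nlinarith [norm_nonneg w])

/-- An injective operator whose form is coercive on the kernel of finitely many functionals is
surjective. -/
theorem surjective_of_coercive_on_ker (T : V →L[ℂ] V) {W : Type*} [NormedAddCommGroup W]
    [NormedSpace ℂ W] [FiniteDimensional ℂ W] (Φ : V →L[ℂ] W) {c : ℝ} (hc : 0 < c)
    (h : ∀ v, Φ v = 0 → c * ‖v‖ ^ 2 ≤ (inner ℂ v (T v)).re) (hT : Function.Injective T) :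
    Function.Surjective T := by
  let K : Submodule ℂ V := Φ.ker
  have hK : IsClosed (K : Set V) := Φ.isClosed_ker
  have : CompleteSpace K := hK.completeSpace_coe
  let P : V →L[ℂ] K := K.orthogonalProjectionOnto
  let A : K →L[ℂ] K := P ∘L T ∘L K.subtypeL
  have hA : Function.Bijective A := bijective_of_coercive A hc fun v => by
    have : inner ℂ v (A v) = inner ℂ (v : V) (T v) :=
      K.inner_orthogonalProjectionOnto_eq_of_mem_left v (T v)
    rw [this]
    exact h v v.2
  let e : K ≃ₗ[ℂ] K := LinearEquiv.ofBijective (A : K →ₗ[ℂ] K) hA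
  have he : ∀ k, P (T (e.symm k)) = k := fun k => e.apply_symm_apply k
  have hP : ∀ {v : V}, P v = 0 ↔ v ∈ Kᗮ := K.orthogonalProjectionOnto_eq_zero_iff
  -- A Schur complement: `w ∈ Kᗮ` is corrected by an element of `K` so that `T (m w)` has no
  -- component in `K`. The problem reduces to the finite-dimensional `Kᗮ`.
  let m : Kᗮ →ₗ[ℂ] V := Kᗮ.subtype -
    K.subtype ∘ₗ (e.symm : K →ₗ[ℂ] K) ∘ₗ (P : V →ₗ[ℂ] K) ∘ₗ (T : V →ₗ[ℂ] V) ∘ₗ Kᗮ.subtype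
  have hm : ∀ w : Kᗮ, m w = (w : V) - (e.symm (P (T w)) : K) := fun w => rfl
  have hmem : ∀ w : Kᗮ, ((T : V →ₗ[ℂ] V) ∘ₗ m) w ∈ Kᗮ := fun w => by
    refine hP.1 ?_
    simp only [LinearMap.comp_apply, hm, ContinuousLinearMap.coe_coe, map_sub, he, sub_self]
  let L : Kᗮ →ₗ[ℂ] Kᗮ := LinearMap.codRestrict Kᗮ ((T : V →ₗ[ℂ] V) ∘ₗ m) hmem
  have hfin : FiniteDimensional ℂ Kᗮ := by
    refine FiniteDimensional.of_injective ((Φ : V →ₗ[ℂ] W) ∘ₗ Kᗮ.subtype) ?_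
    refine (injective_iff_map_eq_zero _).2 fun w hw => ?_
    have hwK : (w : V) ∈ K := hw
    exact Subtype.ext (inner_self_eq_zero.1 (w.2 w hwK))
  have hLinj : Function.Injective L := by
    refine (injective_iff_map_eq_zero _).2 fun w hw => ?_
    have h1 : T (m w) = 0 := congrArg Subtype.val hw
    have h2 : m w = 0 := hT (h1.trans (map_zero T).symm)
    rw [hm, sub_eq_zero] at h2
    have hwK : (w : V) ∈ K := h2 ▸ Subtype.prop _
    exact Subtype.ext (inner_self_eq_zero.1 (w.2 w hwK))
  -- Here finite codimension is used: an injective endomorphism of `Kᗮ` is surjective.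
  have hLsurj := LinearMap.injective_iff_surjective.1 hLinj
  intro y
  obtain ⟨w, hw⟩ := hLsurj ⟨y - T (e.symm (P y)), hP.1 (by rw [map_sub, he, sub_self])⟩
  have hw' : T (m w) = y - T (e.symm (P y)) := congrArg Subtype.val hw
  exact ⟨m w + (e.symm (P y) : K), by rw [map_add, hw']; abel⟩

end Fredholm

/-! ### The form domain as a Hilbert space -/

/-- The ambient space of the triples `(f, f', x f)`. -/
abbrev Triple : Type := PiLp 2 fun _ : Fin 3 => L2

/-- The functional `w ↦ ∫ φ w` on `L²(ℝ)`. -/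
def testFunctional (φ : ℝ → ℝ) (hφ : Continuous φ) (hc : HasCompactSupport φ) : L2 →L[ℂ] ℂ :=
  innerSL ℂ (MemLp.toLp (fun x => (φ x : ℂ))
    ((Complex.continuous_ofReal.comp hφ).memLp_of_hasCompactSupport
      (hc.comp_left Complex.ofReal_zero)))

theorem inner_toLp_left {k : ℝ → ℂ} (hk : MemLp k 2 volume) (w : L2) :
    inner ℂ (hk.toLp k) w = ∫ x, conj (k x) * w x := by
  rw [L2.inner_def]
  refine integral_congr_ae ?_
  filter_upwards [hk.coeFn_toLp] with x hx
  rw [hx, RCLike.inner_apply, mul_comm]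

theorem testFunctional_apply {φ : ℝ → ℝ} (hφ : Continuous φ) (hc : HasCompactSupport φ) (w : L2) :
    testFunctional φ hφ hc w = ∫ x, φ x • w x := by
  rw [testFunctional, innerSL_apply_apply, inner_toLp_left]
  simp

/-- Smooth compactly supported functions. -/
abbrev TestFn : Type := {φ : ℝ → ℝ // ContDiff ℝ ∞ φ ∧ HasCompactSupport φ}

/-- The functional expressing that the second component is the weak derivative of the first. -/
def derivFunctional (φ : TestFn) : Triple →L[ℂ] ℂ :=
  testFunctional (deriv φ.1) (φ.2.1.continuous_deriv (by simp)) φ.2.2.deriv ∘L PiLp.proj 2 _ 0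
    + testFunctional φ.1 φ.2.1.continuous φ.2.2 ∘L PiLp.proj 2 _ 1

/-- The functional expressing that the third component is `x` times the first. -/
def mulFunctional (φ : TestFn) : Triple →L[ℂ] ℂ :=
  testFunctional φ.1 φ.2.1.continuous φ.2.2 ∘L PiLp.proj 2 _ 2
    - testFunctional (fun x => x * φ.1 x) (continuous_id.mul φ.2.1.continuous) φ.2.2.mul_left ∘L
      PiLp.proj 2 _ 0

/-- The space of the triples `(f, f', x f)` with `f` in the form domain. -/
def formSpace : Submodule ℂ Triple :=
  ⨅ φ : TestFn, (derivFunctional φ).ker ⊓ (mulFunctional φ).ker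

theorem isClosed_formSpace : IsClosed (formSpace : Set Triple) := by
  simp only [formSpace, Submodule.coe_iInf, Submodule.coe_inf]
  exact isClosed_iInter fun φ =>
    (derivFunctional φ).isClosed_ker.inter (mulFunctional φ).isClosed_ker

instance : CompleteSpace formSpace := isClosed_formSpace.completeSpace_coe

theorem mem_formSpace_iff {v : Triple} :
    v ∈ formSpace ↔ IsWeakDeriv (v 0) (v 1) ∧ ∀ φ : ℝ → ℝ, ContDiff ℝ ∞ φ → HasCompactSupport φ →
      ∫ x, φ x • v 2 x = ∫ x, (x * φ x) • v 0 x := by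
  simp only [formSpace, Submodule.mem_iInf, Submodule.mem_inf, LinearMap.mem_ker,
    ContinuousLinearMap.coe_coe, derivFunctional, mulFunctional, add_apply,
    sub_apply, ContinuousLinearMap.comp_apply, PiLp.proj_apply,
    testFunctional_apply, add_eq_zero_iff_eq_neg, sub_eq_zero]
  exact ⟨fun h => ⟨fun φ hφ hc => (h ⟨φ, hφ, hc⟩).1, fun φ hφ hc => (h ⟨φ, hφ, hc⟩).2⟩,
    fun h φ => ⟨h.1 φ.1 φ.2.1 φ.2.2, h.2 φ.1 φ.2.1 φ.2.2⟩⟩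

/-- The triple `(f, f', x f)` of a function in the form domain. -/
def toTriple {f : ℝ → ℂ} (hf : f ∈ formDomain) : Triple :=
  WithLp.toLp 2 ![hf.2.1.toLp f, (weakDeriv_spec hf.2.2.1).1.toLp (weakDeriv f),
    hf.2.2.2.toLp (fun x : ℝ => (x : ℂ) * f x)]

theorem toTriple_mem {f : ℝ → ℂ} (hf : f ∈ formDomain) : toTriple hf ∈ formSpace := by
  refine mem_formSpace_iff.2 ⟨fun φ hφ hc => ?_, fun φ hφ hc => ?_⟩
  · have e0 : ∫ x, deriv φ x • (toTriple hf 0) x = ∫ x, deriv φ x • f x := by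
      refine integral_congr_ae ?_
      filter_upwards [hf.2.1.coeFn_toLp] with x hx
      exact congrArg _ hx
    have e1 : ∫ x, φ x • (toTriple hf 1) x = ∫ x, φ x • weakDeriv f x := by
      refine integral_congr_ae ?_
      filter_upwards [(weakDeriv_spec hf.2.2.1).1.coeFn_toLp] with x hx
      exact congrArg _ hx
    rw [e0, e1, (weakDeriv_spec hf.2.2.1).2 φ hφ hc]
  · refine integral_congr_ae ?_
    filter_upwards [hf.2.1.coeFn_toLp, hf.2.2.2.coeFn_toLp] with x h0 h2
    have h0' : (toTriple hf 0) x = f x := h0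
    have h2' : (toTriple hf 2) x = (x : ℂ) * f x := h2
    rw [h0', h2']
    simp only [Complex.real_smul, Complex.ofReal_mul]
    ring

/-- The form domain inside `formSpace`. -/
def toFormSpace {f : ℝ → ℂ} (hf : f ∈ formDomain) : formSpace := ⟨toTriple hf, toTriple_mem hf⟩

/-- The closed conditions defining `formSpace` force the triple to come from a function: its first
component has a continuous representative, and testing identifies the third. Hence the form domain
is complete in this norm. -/
theorem exists_toFormSpace_eq (v : formSpace) :
    ∃ (f : ℝ → ℂ) (hf : f ∈ formDomain), toFormSpace hf = v := by
  obtain ⟨v, hv⟩ := v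
  obtain ⟨h1, h2⟩ := mem_formSpace_iff.1 hv
  obtain ⟨f, hvf, hP⟩ := h1.exists_isPrimitive (Lp.memLp _) (Lp.memLp _)
  have hx : v 2 =ᵐ[volume] fun x : ℝ => (x : ℂ) * v 0 x := by
    have hloc : LocallyIntegrable (fun x : ℝ => (x : ℂ) * v 0 x) volume := by
      refine locallyIntegrable_iff.2 fun K hK => ?_
      exact IntegrableOn.continuousOn_mul Complex.continuous_ofReal.continuousOn
        (((Lp.memLp (v 0)).locallyIntegrable (by norm_num)).integrableOn_isCompact hK) hK
    refine ae_eq_of_integral_contDiff_smul_eq ((Lp.memLp (v 2)).locallyIntegrable (by norm_num))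
      hloc fun φ hφ hc => ?_
    rw [h2 φ hφ hc]
    refine integral_congr_ae (Filter.Eventually.of_forall fun x => ?_)
    simp only [Complex.real_smul, Complex.ofReal_mul]
    ring
  have hx' : v 2 =ᵐ[volume] fun x : ℝ => (x : ℂ) * f x := by
    filter_upwards [hx, hvf] with x h3 h4
    rw [h3, h4]
  have hf : f ∈ formDomain := ⟨hP.continuous, (memLp_congr_ae hvf).1 (Lp.memLp _),
    ⟨_, Lp.memLp _, hP.isWeakDeriv⟩, (memLp_congr_ae hx').1 (Lp.memLp _)⟩
  refine ⟨f, hf, Subtype.ext ?_⟩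
  have hd := weakDeriv_ae_eq (Lp.memLp _) hP.isWeakDeriv
  ext i : 1
  fin_cases i
  · exact Lp.ext (hf.2.1.coeFn_toLp.trans hvf.symm)
  · exact Lp.ext ((weakDeriv_spec hf.2.2.1).1.coeFn_toLp.trans hd)
  · exact Lp.ext (hf.2.2.2.coeFn_toLp.trans hx'.symm)

/-! ### Components and point evaluations -/

/-- The components `f`, `f'`, `x f` of an element of `formSpace`. -/
def component (i : Fin 3) : formSpace →L[ℂ] L2 := PiLp.proj 2 (fun _ : Fin 3 => L2) i ∘L
  formSpace.subtypeL

theorem norm_sq_formSpace (v : formSpace) :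
    ‖v‖ ^ 2 = ‖component 0 v‖ ^ 2 + ‖component 1 v‖ ^ 2 + ‖component 2 v‖ ^ 2 := by
  have h := PiLp.norm_sq_eq_of_L2 (fun _ : Fin 3 => L2) (v : Triple)
  rw [Fin.sum_univ_three] at h
  exact h

theorem component_zero {f : ℝ → ℂ} (hf : f ∈ formDomain) :
    component 0 (toFormSpace hf) =ᵐ[volume] f := hf.2.1.coeFn_toLp

theorem component_one {f : ℝ → ℂ} (hf : f ∈ formDomain) :
    component 1 (toFormSpace hf) =ᵐ[volume] weakDeriv f := (weakDeriv_spec hf.2.2.1).1.coeFn_toLp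

theorem component_two {f : ℝ → ℂ} (hf : f ∈ formDomain) :
    component 2 (toFormSpace hf) =ᵐ[volume] fun x : ℝ => (x : ℂ) * f x := hf.2.2.2.coeFn_toLp

theorem inner_eq_integral {v w : L2} {f g : ℝ → ℂ} (hv : v =ᵐ[volume] f) (hw : w =ᵐ[volume] g) :
    inner ℂ w v = ∫ x, f x * conj (g x) := by
  rw [L2.inner_def]
  refine integral_congr_ae ?_
  filter_upwards [hv, hw] with x h1 h2
  rw [h1, h2, RCLike.inner_apply]

theorem memLp_indicator_Ioc {k : ℝ → ℂ} (hk : Continuous k) (s t : ℝ) :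
    MemLp ((Set.Ioc s t).indicator k) 2 volume := by
  rw [memLp_indicator_iff_restrict measurableSet_Ioc]
  obtain ⟨C, hC⟩ := (isCompact_Icc (a := s) (b := t)).exists_bound_of_continuousOn hk.continuousOn
  have : IsFiniteMeasure (volume.restrict (Set.Ioc s t)) := ⟨by simp⟩
  refine MemLp.of_bound hk.aestronglyMeasurable C ?_
  exact (ae_restrict_iff' measurableSet_Ioc).2
    (Filter.Eventually.of_forall fun x hx => hC x (Set.Ioc_subset_Icc_self hx))

theorem inner_indicator_eq {k : ℝ → ℂ} (hk : Continuous k) {s t : ℝ} (hst : s ≤ t) (w : L2) :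
    inner ℂ ((memLp_indicator_Ioc hk s t).toLp _) w = ∫ x in s..t, conj (k x) * w x := by
  rw [inner_toLp_left, intervalIntegral.integral_of_le hst, ← integral_indicator measurableSet_Ioc]
  refine integral_congr_ae (Filter.Eventually.of_forall fun x => ?_)
  by_cases hx : x ∈ Set.Ioc s t <;> simp [hx]

/-- Evaluation at `p`, written through averages of `f` and `f'` over `[p, p + 1]`. -/
def evalAt (p : ℝ) : formSpace →L[ℂ] ℂ :=
  innerSL ℂ ((memLp_indicator_Ioc (k := fun _ => 1) continuous_const p (p + 1)).toLp _) ∘L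
      component 0
    + innerSL ℂ ((memLp_indicator_Ioc (k := fun x : ℝ => (x : ℂ) - (p + 1))
      (Complex.continuous_ofReal.sub continuous_const) p (p + 1)).toLp _) ∘L component 1

/-- Integration by parts with the weight `x - (p + 1)`, which is `-1` at `p` and `0` at `p + 1`.
Point evaluation is thus continuous by construction. -/
theorem evalAt_toFormSpace (p : ℝ) {f : ℝ → ℂ} (hf : f ∈ formDomain) :
    evalAt p (toFormSpace hf) = f p := by
  have hp : p ≤ p + 1 := by linarith
  have hP := isPrimitive_weakDeriv hf
  have key := hP.integral_mul_add (u := fun x : ℝ => (x : ℂ) - (p + 1)) (u' := fun _ => 1)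
    (fun x => by simpa using ((hasDerivAt_id (x : ℂ)).comp_ofReal).sub_const ((p : ℂ) + 1))
    continuous_const p (p + 1)
  simp only [evalAt, add_apply, ContinuousLinearMap.comp_apply, innerSL_apply_apply]
  rw [inner_indicator_eq (k := fun _ => 1) continuous_const hp,
    inner_indicator_eq (k := fun x : ℝ => (x : ℂ) - (p + 1))
      (Complex.continuous_ofReal.sub continuous_const) hp]
  have e0 : ∫ x in p..p + 1, conj (1 : ℂ) * component 0 (toFormSpace hf) x
      = ∫ x in p..p + 1, f x * 1 := by
    refine intervalIntegral.integral_congr_ae ?_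
    filter_upwards [component_zero hf] with x hx _
    rw [hx, map_one, mul_comm]
  have e1 : ∫ x in p..p + 1, conj ((x : ℂ) - (p + 1)) * component 1 (toFormSpace hf) x
      = ∫ x in p..p + 1, weakDeriv f x * ((x : ℂ) - (p + 1)) := by
    refine intervalIntegral.integral_congr_ae ?_
    filter_upwards [component_one hf] with x hx _
    rw [hx]
    simp only [map_sub, map_add, map_one, Complex.conj_ofReal]
    ring
  have i1 : IntervalIntegrable (fun x => weakDeriv f x * ((x : ℂ) - (p + 1))) volume p (p + 1) :=
    (hP.intervalIntegrable _ _).mul_continuousOn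
      (Complex.continuous_ofReal.sub continuous_const).continuousOn
  have i2 : IntervalIntegrable (fun x => f x * 1) volume p (p + 1) :=
    (hf.1.mul continuous_const).intervalIntegrable _ _
  rw [intervalIntegral.integral_add i1 i2] at key
  rw [e0, e1]
  push_cast at key
  linear_combination key

/-! ### The operator of the shifted form -/

section Combination

variable {V H : Type*} [NormedAddCommGroup V] [InnerProductSpace ℂ V] [CompleteSpace V]
  [NormedAddCommGroup H] [InnerProductSpace ℂ H] [CompleteSpace H]

open ContinuousLinearMap (adjoint) in
/-- The operator of the form `⟨A₁·, A₁·⟩ + c₂⟨A₂·, A₂·⟩ - c₀⟨A₀·, A₀·⟩ + z(e ē - e' ē')`. -/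
def combinationOperator (A₀ A₁ A₂ : V →L[ℂ] H) (e e' : V →L[ℂ] ℂ) (c₀ c₂ z : ℂ) : V →L[ℂ] V :=
  adjoint A₁ ∘L A₁ + c₂ • (adjoint A₂ ∘L A₂) - c₀ • (adjoint A₀ ∘L A₀)
    + z • (adjoint e ∘L e - adjoint e' ∘L e')

theorem inner_combinationOperator (A₀ A₁ A₂ : V →L[ℂ] H) (e e' : V →L[ℂ] ℂ) (c₀ c₂ z : ℂ)
    (v w : V) :
    inner ℂ w (combinationOperator A₀ A₁ A₂ e e' c₀ c₂ z v) = inner ℂ (A₁ w) (A₁ v)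
      + c₂ * inner ℂ (A₂ w) (A₂ v) - c₀ * inner ℂ (A₀ w) (A₀ v)
      + z * (e v * conj (e w) - e' v * conj (e' w)) := by
  simp only [combinationOperator, add_apply, sub_apply, smul_apply, ContinuousLinearMap.comp_apply,
    inner_add_right, inner_sub_right, inner_smul_right, ContinuousLinearMap.adjoint_inner_right,
    RCLike.inner_apply]

end Combination

/-- The bounded operator on `formSpace` that represents the form shifted by `ν`. -/
def formOperator (z : ℂ) (b : ℝ) (ν : ℂ) : formSpace →L[ℂ] formSpace :=
  combinationOperator (component 0) (component 1) (component 2) (evalAt b) (evalAt (-b))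
    (1 / 2 + ν) (1 / 4) z

theorem inner_formOperator (z : ℂ) (b : ℝ) (ν : ℂ) (v w : formSpace) :
    inner ℂ w (formOperator z b ν v) = inner ℂ (component 1 w) (component 1 v)
      + 1 / 4 * inner ℂ (component 2 w) (component 2 v)
      - (1 / 2 + ν) * inner ℂ (component 0 w) (component 0 v)
      + z * (evalAt b v * conj (evalAt b w) - evalAt (-b) v * conj (evalAt (-b) w)) :=
  inner_combinationOperator _ _ _ _ _ _ _ _ v w

theorem inner_formOperator_toFormSpace (z : ℂ) (b : ℝ) (ν : ℂ) {f g : ℝ → ℂ} (hf : f ∈ formDomain)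
    (hg : g ∈ formDomain) :
    inner ℂ (toFormSpace hg) (formOperator z b ν (toFormSpace hf))
      = form z b f g - ν * ∫ x, f x * conj (g x) := by
  rw [inner_formOperator, inner_eq_integral (component_one hf) (component_one hg),
    inner_eq_integral (component_two hf) (component_two hg),
    inner_eq_integral (component_zero hf) (component_zero hg), form]
  simp only [evalAt_toFormSpace]
  ring

theorem formOperator_injective {z ν : ℂ} {b : ℝ} (hb : 0 < b) (h0 : charFun z ν b ≠ 0) :
    Function.Injective (formOperator z b ν) := by
  refine (injective_iff_map_eq_zero _).2 fun v hv => ?_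
  obtain ⟨f, hf, rfl⟩ := exists_toFormSpace_eq v
  have hzero : f = 0 := eq_zero_of_form_eq hb h0 hf fun g hg => by
    have := inner_formOperator_toFormSpace z b ν hf hg
    rw [hv, inner_zero_right] at this
    linear_combination -this
  subst hzero
  have hn := norm_sq_formSpace (toFormSpace hf)
  have hz : ∀ w : L2, w =ᵐ[volume] (fun _ => (0 : ℂ)) → w = 0 := fun w hw =>
    Lp.eq_zero_iff_ae_eq_zero.2 hw
  have hd : weakDeriv 0 =ᵐ[volume] (0 : ℝ → ℂ) := weakDeriv_ae_eq MemLp.zero isWeakDeriv_zero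
  rw [hz _ (component_zero hf), hz _ ((component_one hf).trans hd),
    hz _ ((component_two hf).trans (by simp))] at hn
  simpa using hn

/-! ### Coercivity on functions vanishing on a fine grid -/

theorem norm_sq_eq_integral {v : L2} {f : ℝ → ℂ} (hv : v =ᵐ[volume] f) :
    ‖v‖ ^ 2 = ∫ x, ‖f x‖ ^ 2 := by
  have h := inner_eq_integral hv hv
  rw [inner_self_eq_norm_sq_to_K] at h
  have e : ∀ x, f x * conj (f x) = ((‖f x‖ ^ 2 : ℝ) : ℂ) := fun x => by
    rw [Complex.mul_conj, Complex.normSq_eq_norm_sq]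
  simp_rw [e] at h
  rw [integral_complex_ofReal] at h
  exact Complex.ofReal_injective (by rw [Complex.ofReal_pow]; exact h)

/-- This plays the role of the compact embedding into `L²`. On `[-N, N]` every point is within `δ`
of a zero of `f`, so `|f|² ≤ δ ‖f'‖²`; outside, `|f|² ≤ N⁻² |x f|²`. -/
theorem exists_grid (K : ℝ) :
    ∃ S : Finset ℝ, ∀ v : formSpace, (∀ p ∈ S, evalAt p v = 0) →
      K * ‖component 0 v‖ ^ 2
        ≤ 1 / 2 * ‖component 1 v‖ ^ 2 + 1 / 8 * ‖component 2 v‖ ^ 2 := by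
  -- Chosen so that `|K| / N² ≤ 1/8`.
  obtain ⟨N, hN⟩ := exists_nat_ge (8 * |K| + 1)
  have hN1 : (1 : ℝ) ≤ N := by linarith [abs_nonneg K]
  have hN0 : (0 : ℝ) < N := by linarith
  -- With spacing `δ = 2N/m`, integration over `[-N, N]` costs `|K| · 2N · δ = 4 |K| N² / m ≤ 1/2`.
  obtain ⟨m, hm⟩ := exists_nat_ge (8 * |K| * N ^ 2 + 1)
  have hm0 : (0 : ℝ) < m := by
    nlinarith [mul_nonneg (abs_nonneg K) (sq_nonneg (N : ℝ))]
  set δ : ℝ := 2 * N / m with hδ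
  have hδ0 : 0 < δ := by positivity
  refine ⟨(Finset.range (m + 1)).image fun k : ℕ => -(N : ℝ) + k * δ, fun v hv => ?_⟩
  obtain ⟨f, hf, rfl⟩ := exists_toFormSpace_eq v
  have hP := isPrimitive_weakDeriv hf
  have hd2 := (weakDeriv_spec hf.2.2.1).1
  set G : ℝ := ‖component 1 (toFormSpace hf)‖ with hG
  have hloc : ∀ x ∈ Set.Icc (-(N : ℝ)) N, ‖f x‖ ^ 2 ≤ δ * G ^ 2 := fun x hx => by
    have hx0 : 0 ≤ (x + N) / δ := div_nonneg (by linarith [hx.1]) hδ0.le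
    set k : ℕ := ⌊(x + N) / δ⌋₊
    have hk1 : (k : ℝ) * δ ≤ x + N := (le_div_iff₀ hδ0).1 (Nat.floor_le hx0)
    have hk2 : x + N < (k + 1) * δ := (div_lt_iff₀ hδ0).1 (Nat.lt_floor_add_one _)
    have hkm : k ≤ m := by
      have : (k : ℝ) * δ ≤ m * δ := by
        rw [hδ, mul_div_cancel₀ _ hm0.ne', ← hδ]
        linarith [hx.2]
      exact_mod_cast le_of_mul_le_mul_right this hδ0
    have hz : f (-(N : ℝ) + k * δ) = 0 := by
      rw [← evalAt_toFormSpace _ hf]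
      exact hv _ (Finset.mem_image_of_mem _ (Finset.mem_range.2 (by omega)))
    have h1 := hP.norm_sub_le hd2 (-(N : ℝ) + k * δ) x
    rw [hz, sub_zero, abs_of_nonneg (by linarith)] at h1
    calc ‖f x‖ ^ 2 ≤ (√(x - (-(N : ℝ) + k * δ)) * G) ^ 2 := by
          gcongr
          exact h1
      _ = (x - (-(N : ℝ) + k * δ)) * G ^ 2 := by
          rw [mul_pow, Real.sq_sqrt (by linarith)]
      _ ≤ δ * G ^ 2 := by
          gcongr
          linarith
  have hpt : ∀ x : ℝ, ‖f x‖ ^ 2 ≤ (Set.Icc (-(N : ℝ)) N).indicator (fun _ => δ * G ^ 2) x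
      + ((N : ℝ) ^ 2)⁻¹ * ‖(x : ℂ) * f x‖ ^ 2 := fun x => by
    by_cases hx : x ∈ Set.Icc (-(N : ℝ)) N
    · rw [Set.indicator_of_mem hx]
      have : 0 ≤ ((N : ℝ) ^ 2)⁻¹ * ‖(x : ℂ) * f x‖ ^ 2 := by positivity
      linarith [hloc x hx]
    · rw [Set.indicator_of_notMem hx, zero_add, ← div_eq_inv_mul, le_div_iff₀ (by positivity),
        norm_mul, mul_pow, mul_comm, Complex.norm_real, Real.norm_eq_abs]
      gcongr
      by_contra! hcon
      exact hx (abs_le.1 hcon.le)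
  have i0 : Integrable fun x => ‖f x‖ ^ 2 := hf.2.1.norm.integrable_sq
  have i1 : Integrable ((Set.Icc (-(N : ℝ)) N).indicator fun _ => δ * G ^ 2) :=
    (integrable_indicator_iff measurableSet_Icc).2 (integrableOn_const (by simp))
  have i2 : Integrable fun x : ℝ => ((N : ℝ) ^ 2)⁻¹ * ‖(x : ℂ) * f x‖ ^ 2 :=
    hf.2.2.2.norm.integrable_sq.const_mul _
  have hint := integral_mono i0 (i1.add i2) hpt
  simp only [Pi.add_apply] at hint
  rw [integral_add i1 i2, integral_const_mul, integral_indicator measurableSet_Icc,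
    setIntegral_const, ← norm_sq_eq_integral (component_zero hf),
    ← norm_sq_eq_integral (component_two hf)] at hint
  have hvol : (volume : Measure ℝ).real (Set.Icc (-(N : ℝ)) N) = 2 * N := by
    rw [Real.volume_real_Icc_of_le (by linarith)]
    ring
  rw [hvol, smul_eq_mul] at hint
  have c1 : |K| * (2 * N * δ) ≤ 1 / 2 := by
    rw [hδ, mul_div_assoc', mul_div_assoc', div_le_iff₀ hm0]
    nlinarith
  have c2 : |K| * ((N : ℝ) ^ 2)⁻¹ ≤ 1 / 8 := by
    rw [← div_eq_mul_inv, div_le_iff₀ (by positivity)]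
    nlinarith [abs_nonneg K]
  calc K * ‖component 0 (toFormSpace hf)‖ ^ 2 ≤ |K| * ‖component 0 (toFormSpace hf)‖ ^ 2 := by
        gcongr
        exact le_abs_self K
    _ ≤ |K| * (2 * N * (δ * G ^ 2) + ((N : ℝ) ^ 2)⁻¹ * ‖component 2 (toFormSpace hf)‖ ^ 2) := by
        gcongr
    _ = |K| * (2 * N * δ) * G ^ 2
        + |K| * ((N : ℝ) ^ 2)⁻¹ * ‖component 2 (toFormSpace hf)‖ ^ 2 := by ring
    _ ≤ _ := by gcongr

theorem formOperator_bijective {z ν : ℂ} {b : ℝ} (hb : 0 < b) (h0 : charFun z ν b ≠ 0) :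
    Function.Bijective (formOperator z b ν) := by
  have hinj := formOperator_injective hb h0
  -- The constant exceeds `1/2 + Re ν` by at least `1/2`, so half of the positive part absorbs the
  -- shift and coercivity with `1/8` remains. Adding `±b` to the grid kills the terms with `z`.
  obtain ⟨S, hS⟩ := exists_grid (‖ν‖ + 1)
  refine ⟨hinj, surjective_of_coercive_on_ker (W := ((insert b (insert (-b) S) : Finset ℝ) → ℂ))
    (formOperator z b ν) (ContinuousLinearMap.pi fun p => evalAt p) (c := 1 / 8) (by norm_num)
    (fun v hv => ?_) hinj⟩
  have hev : ∀ p ∈ insert b (insert (-b) S), evalAt p v = 0 := fun p hp => congrFun hv ⟨p, hp⟩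
  have hgrid := hS v fun p hp => hev p (by simp [hp])
  rw [inner_formOperator, hev b (by simp), hev (-b) (by simp), norm_sq_formSpace]
  simp only [inner_self_eq_norm_sq_to_K]
  have hre : ((‖component 1 v‖ : ℂ) ^ 2 + 1 / 4 * (‖component 2 v‖ : ℂ) ^ 2
      - (1 / 2 + ν) * (‖component 0 v‖ : ℂ) ^ 2 + z * (0 * conj 0 - 0 * conj 0)).re
      = ‖component 1 v‖ ^ 2 + 1 / 4 * ‖component 2 v‖ ^ 2
        - (1 / 2 + ν.re) * ‖component 0 v‖ ^ 2 := by
    simp only [zero_mul, sub_self, mul_zero, add_zero, ← Complex.ofReal_pow]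
    simp only [Complex.add_re, Complex.sub_re, Complex.mul_re, Complex.add_im, Complex.ofReal_re,
      Complex.ofReal_im]
    norm_num
  refine le_trans ?_ (le_of_eq hre.symm)
  have hν := mul_le_mul_of_nonneg_right (Complex.re_le_norm ν) (sq_nonneg ‖component 0 v‖)
  nlinarith [sq_nonneg ‖component 1 v‖, sq_nonneg ‖component 2 v‖, sq_nonneg ‖component 0 v‖]

/-! ### Spectrum and eigenvalues -/

theorem mem_graph_iff {z : ℂ} {b : ℝ} {x y : L2} :
    (∃ t : (operator z b).domain, (t : L2) = x ∧ operator z b t = y) ↔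
      ∃ f ∈ formDomain, x =ᵐ[volume] f ∧
        ∀ g ∈ formDomain, form z b f g = ∫ s, y s * conj (g s) := by
  have h : (x, y) ∈ (operator z b).graph ↔ (x, y) ∈ operatorGraph z b := by rw [operator_graph]
  rw [LinearPMap.mem_graph_iff] at h
  exact h

theorem integral_add_smul_mul_conj (h x : L2) (ν : ℂ) {f g : ℝ → ℂ} (hx : x =ᵐ[volume] f)
    (hf : MemLp f 2 volume) (hg : MemLp g 2 volume) :
    ∫ s, (h + ν • x : L2) s * conj (g s)
      = (∫ s, h s * conj (g s)) + ν * ∫ s, f s * conj (g s) := by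
  rw [← integral_const_mul, ← integral_add (integrable_mul_conj (Lp.memLp h) hg)
    ((integrable_mul_conj hf hg).const_mul ν)]
  refine integral_congr_ae ?_
  filter_upwards [Lp.coeFn_add h (ν • x), Lp.coeFn_smul ν x, hx] with s h1 h2 h3
  rw [h1, Pi.add_apply, h2, Pi.smul_apply, h3, smul_eq_mul]
  ring

theorem mem_resolventSet {z ν : ℂ} {b : ℝ} (hb : 0 < b) (h0 : charFun z ν b ≠ 0) :
    ν ∈ resolventSet (operator z b) := by
  have hbij := formOperator_bijective hb h0
  let e : formSpace ≃L[ℂ] formSpace := ContinuousLinearEquiv.ofBijective (formOperator z b ν)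
    (LinearMap.ker_eq_bot.2 hbij.1) (LinearMap.range_eq_top.2 hbij.2)
  have he : ∀ v, formOperator z b ν (e.symm v) = v := fun v => e.apply_symm_apply v
  -- `J h` represents the functional `g ↦ ⟨h, g⟩` on the form space, so the resolvent is `component
  -- 0 ∘ e⁻¹ ∘ J`.
  let J : L2 →L[ℂ] formSpace := ContinuousLinearMap.adjoint (component 0)
  have hJ : ∀ (h : L2) {g : ℝ → ℂ} (hg : g ∈ formDomain),
      inner ℂ (toFormSpace hg) (J h) = ∫ s, h s * conj (g s) := fun h g hg => by
    rw [ContinuousLinearMap.adjoint_inner_right]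
    exact inner_eq_integral (Filter.EventuallyEq.refl _ _) (component_zero hg)
  refine ⟨component 0 ∘L (e.symm : formSpace →L[ℂ] formSpace) ∘L J, fun h => ?_, fun x => ?_⟩
  · obtain ⟨f, hf, hfe⟩ := exists_toFormSpace_eq (e.symm (J h))
    have hx : component 0 (e.symm (J h)) =ᵐ[volume] f := hfe ▸ component_zero hf
    obtain ⟨t, ht, hLt⟩ := (mem_graph_iff (z := z) (b := b) (x := component 0 (e.symm (J h)))
      (y := h + ν • component 0 (e.symm (J h)))).2 ⟨f, hf, hx, fun g hg => by
        have h1 := inner_formOperator_toFormSpace z b ν hf hg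
        rw [hfe, he, hJ h hg] at h1
        rw [integral_add_smul_mul_conj h _ ν hx hf.2.1 hg.2.1]
        linear_combination -h1⟩
    refine ⟨t, ht, ?_⟩
    rw [hLt, ht]
    abel
  · obtain ⟨f, hf, hx, hform⟩ := (mem_graph_iff (z := z) (b := b)).1 ⟨x, rfl, rfl⟩
    have hxf : component 0 (toFormSpace hf) = x := Lp.ext ((component_zero hf).trans hx.symm)
    have key : formOperator z b ν (toFormSpace hf) = J (operator z b x - ν • (x : L2)) := by
      refine ext_inner_left ℂ fun w => ?_
      obtain ⟨g, hg, rfl⟩ := exists_toFormSpace_eq w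
      have h1 := integral_add_smul_mul_conj (operator z b x - ν • (x : L2)) x ν hx hf.2.1 hg.2.1
      rw [sub_add_cancel] at h1
      rw [inner_formOperator_toFormSpace, hform g hg, hJ _ hg, h1]
      ring
    have h2 : e.symm (J (operator z b x - ν • (x : L2))) = toFormSpace hf := by
      rw [← key]
      exact e.symm_apply_apply _
    exact (congrArg (component 0) h2).trans hxf

theorem isEigenvalue_of_charFun_eq_zero {z ν : ℂ} {b : ℝ} (hb : 0 < b) (h0 : charFun z ν b = 0) :
    IsEigenvalue (operator z b) ν := by
  obtain ⟨f, hf, hne, hform⟩ := exists_eigenfunction hb h0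
  have hx : hf.2.1.toLp f =ᵐ[volume] f := hf.2.1.coeFn_toLp
  obtain ⟨t, ht, hLt⟩ := (mem_graph_iff (z := z) (b := b) (x := hf.2.1.toLp f)
    (y := 0 + ν • hf.2.1.toLp f)).2 ⟨f, hf, hx, fun g hg => by
      rw [integral_add_smul_mul_conj 0 _ ν hx hf.2.1 hg.2.1, hform g hg]
      rw [right_eq_add]
      refine integral_eq_zero_of_ae ?_
      filter_upwards [Lp.coeFn_zero ℂ 2 (volume : Measure ℝ)] with s hs
      rw [hs, Pi.zero_apply, zero_mul]⟩
  refine ⟨t, fun hz => hne ?_, ?_⟩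
  · rw [ht, Lp.eq_zero_iff_ae_eq_zero] at hz
    exact (hf.1.ae_eq_iff_eq volume continuous_zero).1 (hx.symm.trans hz)
  · rw [hLt, ht, zero_add]

theorem IsEigenvalue.mem_spectrum {H : Type*} [NormedAddCommGroup H] [NormedSpace ℂ H]
    {T : H →ₗ.[ℂ] H} {ν : ℂ} (h : IsEigenvalue T ν) : ν ∈ spectrum T := by
  rintro ⟨R, -, hR⟩
  obtain ⟨x, hx, hTx⟩ := h
  have := hR x
  rw [hTx, sub_self, map_zero] at this
  exact hx this.symm

theorem spectrum_and_eigenvalue_iff {b : ℝ} (hb : 0 < b) (z ν : ℂ) :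
    (ν ∈ spectrum (operator z b) ↔ charFun z ν b = 0) ∧
      (IsEigenvalue (operator z b) ν ↔ charFun z ν b = 0) := by
  have h1 : ν ∈ spectrum (operator z b) → charFun z ν b = 0 := fun h => by
    by_contra h0
    exact h (mem_resolventSet hb h0)
  have h2 : charFun z ν b = 0 → IsEigenvalue (operator z b) ν := isEigenvalue_of_charFun_eq_zero hb
  exact ⟨⟨h1, fun h => (h2 h).mem_spectrum⟩, ⟨fun h => h1 h.mem_spectrum, h2⟩⟩

/-! ### The function `M` -/

theorem Gamma_neg_ne_zero {ν : ℂ} (hν : ∀ n : ℕ, ν ≠ n) : Complex.Gamma (-ν) ≠ 0 :=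
  Complex.Gamma_ne_zero fun n h => hν n (neg_injective h)

theorem Gamma_mul_charFun {ν : ℂ} (hν : ∀ n : ℕ, ν ≠ n) (z : ℂ) (b : ℝ) :
    Complex.Gamma (-ν) * charFun z ν b = 1 - z ^ 2 * M ν b := by
  rw [charFun, mul_sub, mul_inv_cancel₀ (Gamma_neg_ne_zero hν), M]
  ring

theorem charFun_eq_zero_iff {ν : ℂ} (hν : ∀ n : ℕ, ν ≠ n) (z : ℂ) (b : ℝ) :
    charFun z ν b = 0 ↔ z ≠ 0 ∧ M ν b = 1 / z ^ 2 := by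
  have h : charFun z ν b = 0 ↔ z ^ 2 * M ν b = 1 := by
    rw [← mul_right_inj' (Gamma_neg_ne_zero hν), mul_zero, Gamma_mul_charFun hν, sub_eq_zero,
      eq_comm]
  rw [h]
  constructor
  · intro h1
    have hz : z ≠ 0 := by
      rintro rfl
      simp at h1
    exact ⟨hz, by rw [eq_div_iff (pow_ne_zero 2 hz), mul_comm, h1]⟩
  · rintro ⟨hz, h1⟩
    rw [h1, mul_one_div_cancel (pow_ne_zero 2 hz)]

theorem differentiable_inv_Gamma : Differentiable ℂ fun s => (Complex.Gamma s)⁻¹ :=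
  Complex.differentiable_one_div_Gamma

theorem differentiable_dEven : Differentiable ℂ dEven := by
  have h : Differentiable ℂ fun ν : ℂ => (Complex.Gamma (-ν / 2 + 1 / 2))⁻¹ :=
    differentiable_inv_Gamma.comp (by fun_prop)
  have h2 : Differentiable ℂ fun ν : ℂ => (2 : ℂ) ^ (ν / 2) := fun ν =>
    (differentiableAt_id.div_const 2).const_cpow (Or.inl two_ne_zero)
  exact (h2.mul_const _).mul h

theorem differentiable_dOdd : Differentiable ℂ dOdd := by
  have h : dOdd = fun ν => -ν * dEven (ν - 1) := funext dOdd_eq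
  rw [h]
  exact differentiable_id.neg.mul (differentiable_dEven.comp (differentiable_id.sub_const 1))

theorem differentiable_yEven (x : ℂ) : Differentiable ℂ fun ν => yEven ν x := by
  simp only [yEven_eq]
  exact (differentiable_evenSeries x).const_mul _

theorem differentiable_yOdd (x : ℂ) : Differentiable ℂ fun ν => yOdd ν x := by
  simp only [yOdd_eq]
  exact (differentiable_oddSeries x).const_mul _

theorem differentiable_parabolicD (x : ℂ) : Differentiable ℂ fun ν => parabolicD ν x :=
  (differentiable_dEven.mul (differentiable_yEven x)).sub
    (differentiable_dOdd.mul (differentiable_yOdd x))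

/-- The entire factor of `M`. -/
def regularFactor (b : ℝ) (ν : ℂ) : ℂ :=
  (√(2 / Real.pi) : ℂ) * parabolicD ν b ^ 2 * yEven ν b * yOdd ν b

theorem M_eq (ν : ℂ) (b : ℝ) : M ν b = Complex.Gamma (-ν) * regularFactor b ν := by
  rw [M, regularFactor]
  ring

theorem differentiable_regularFactor (b : ℝ) : Differentiable ℂ (regularFactor b) :=
  ((((differentiable_parabolicD b).pow 2).const_mul _).mul (differentiable_yEven b)).mul
    (differentiable_yOdd b)

theorem yEven_zero_left_ne_zero (x : ℂ) : yEven 0 x ≠ 0 := by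
  rw [yEven_eq, evenSeries, tsum_eq_single 0]
  · simp [evenCoeff_zero]
  · rintro (_ | k) hk
    · exact absurd rfl hk
    · simp [evenCoeff_succ']

/-- At `ν = 0` all terms of the series are positive reals. -/
theorem yOdd_zero_left_ne_zero {b : ℝ} (hb : 0 < b) : yOdd 0 b ≠ 0 := by
  rw [yOdd_eq, oddSeries]
  refine mul_ne_zero (Complex.exp_ne_zero _) ?_
  let r : ℕ → ℝ := fun k =>
    (∏ j ∈ Finset.range k, (1 + 2 * (j : ℝ))) * (b ^ (2 * k + 1) / ((2 * k + 1).factorial : ℝ))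
  have hr : ∀ k, evenCoeff (0 - 1) k * ((b : ℂ) ^ (2 * k + 1) / ((2 * k + 1).factorial : ℂ))
      = (r k : ℂ) := fun k => by
    simp [r, evenCoeff]
  have hpos : ∀ k, 0 < r k := fun k => by
    refine mul_pos (Finset.prod_pos fun j _ => ?_) ?_ <;> positivity
  have hs : Summable r := by
    have := summable_odd (0 - 1) b
    simp only [hr] at this
    exact Complex.summable_ofReal.1 this
  simp only [hr]
  rw [← Complex.ofReal_tsum, Complex.ofReal_ne_zero]
  exact (hs.tsum_pos (fun k => (hpos k).le) 0 (hpos 0)).ne'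

/-- At `ν = 0` the odd part of `D_ν` drops out and the even series reduces to its constant term, so
both `D_0` and `yEven 0` are nonzero multiples of the Gaussian. -/
theorem regularFactor_zero_ne_zero {b : ℝ} (hb : 0 < b) : regularFactor b 0 ≠ 0 := by
  have hodd : dOdd 0 = 0 := by rw [dOdd_eq, neg_zero, zero_mul]
  have heven : dEven 0 ≠ 0 := (dEven_ne_zero_or 0).resolve_right fun h => h hodd
  have hD : parabolicD 0 b ≠ 0 := by
    rw [parabolicD_eq, hodd, zero_mul, sub_zero]
    exact mul_ne_zero heven (yEven_zero_left_ne_zero b)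
  have hs : ((√(2 / Real.pi) : ℝ) : ℂ) ≠ 0 :=
    Complex.ofReal_ne_zero.2 (Real.sqrt_pos.2 (by positivity)).ne'
  exact mul_ne_zero (mul_ne_zero (mul_ne_zero hs (pow_ne_zero 2 hD)) (yEven_zero_left_ne_zero b))
    (yOdd_zero_left_ne_zero hb)

theorem eventually_ne_natCast : ∀ᶠ ν : ℂ in 𝓝[≠] 0, ∀ n : ℕ, ν ≠ n := by
  have h1 : ∀ᶠ ν : ℂ in 𝓝[≠] 0, ‖ν‖ < 1 := by
    refine nhdsWithin_le_nhds ?_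
    filter_upwards [Metric.ball_mem_nhds (0 : ℂ) one_pos] with ν hν
    simpa using hν
  filter_upwards [h1, self_mem_nhdsWithin] with ν h2 h3 n hn
  rw [hn, Complex.norm_natCast] at h2
  have : n = 0 := by
    have : n < 1 := by exact_mod_cast h2
    omega
  exact h3 (by rw [hn, this, Nat.cast_zero]; rfl)

theorem meromorphicAt_M (b : ℝ) : MeromorphicAt (fun ν : ℂ => M ν b) 0 := by
  have h : (fun ν : ℂ => M ν b)
      = (fun ν : ℂ => (Complex.Gamma (-ν))⁻¹)⁻¹ * regularFactor b := by
    funext ν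
    simp [M_eq]
  rw [h]
  refine MeromorphicAt.mul (MeromorphicAt.inv ?_)
    ((differentiable_regularFactor b).analyticAt 0).meromorphicAt
  exact ((differentiable_inv_Gamma.comp differentiable_neg).analyticAt 0).meromorphicAt

/-- It suffices that `M` tends to infinity. Its reciprocal is `1/Γ(-ν)` over `regularFactor`, which
is continuous, zero at `0` and nonzero nearby. -/
theorem meromorphicOrderAt_M_neg {b : ℝ} (hb : 0 < b) :
    meromorphicOrderAt (fun ν : ℂ => M ν b) 0 < 0 := by
  rw [← tendsto_cobounded_iff_meromorphicOrderAt_neg (meromorphicAt_M b)]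
  have hc : Continuous (regularFactor b) := (differentiable_regularFactor b).continuous
  have hg : Continuous fun ν : ℂ => (Complex.Gamma (-ν))⁻¹ :=
    (differentiable_inv_Gamma.comp differentiable_neg).continuous
  have h0 := regularFactor_zero_ne_zero hb
  have hlim : Filter.Tendsto (fun ν : ℂ => (Complex.Gamma (-ν))⁻¹ * (regularFactor b ν)⁻¹)
      (𝓝[≠] 0) (𝓝 0) := by
    have h1 : ContinuousAt (fun ν : ℂ => (Complex.Gamma (-ν))⁻¹ * (regularFactor b ν)⁻¹) 0 :=
      hg.continuousAt.mul (hc.continuousAt.inv₀ h0)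
    have h2 := h1.tendsto
    -- The default value `Γ(0) = 0` gives the inverse the value `0`, which agrees with the entire
    -- function `1/Γ`.
    simp only [neg_zero, Complex.Gamma_zero, inv_zero, zero_mul] at h2
    exact h2.mono_left nhdsWithin_le_nhds
  have hne : ∀ᶠ ν : ℂ in 𝓝[≠] 0,
      (Complex.Gamma (-ν))⁻¹ * (regularFactor b ν)⁻¹ ∈ ({0}ᶜ : Set ℂ) := by
    filter_upwards [eventually_ne_natCast,
      nhdsWithin_le_nhds (hc.continuousAt.eventually_ne h0)] with ν h1 h2
    exact mul_ne_zero (inv_ne_zero (Gamma_neg_ne_zero h1)) (inv_ne_zero h2)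
  have := Filter.tendsto_inv₀_nhdsNE_zero.comp
    (tendsto_nhdsWithin_of_tendsto_nhds_of_eventually_within _ hlim hne)
  refine this.congr fun ν => ?_
  rw [Function.comp_apply, mul_inv, inv_inv, inv_inv, M_eq]

theorem M_not_constant {b : ℝ} (hb : 0 < b) :
    ¬ ∃ c : ℂ, ∀ ν : ℂ, (∀ n : ℕ, ν ≠ n) → M ν b = c := by
  rintro ⟨c, hc⟩
  have h := meromorphicOrderAt_M_neg hb
  have he : (fun ν : ℂ => M ν b) =ᶠ[𝓝[≠] 0] fun _ => c := by
    filter_upwards [eventually_ne_natCast] with ν hν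
    exact hc ν hν
  rw [meromorphicOrderAt_congr he] at h
  exact absurd (analyticAt_const (v := c)).meromorphicOrderAt_nonneg (not_le.2 h)

theorem M_real (ν b : ℝ) : ∃ r : ℝ, M (ν : ℂ) b = (r : ℂ) := by
  rw [← Complex.conj_eq_iff_real]
  have hpow : ∀ s : ℝ, conj ((2 : ℂ) ^ (s : ℂ)) = (2 : ℂ) ^ (s : ℂ) := fun s => by
    have : (2 : ℂ) ^ (s : ℂ) = ((2 ^ s : ℝ) : ℂ) := by
      rw [Complex.ofReal_cpow zero_le_two]
      norm_num
    rw [this, Complex.conj_ofReal]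
  have hG : ∀ s : ℝ, conj (Complex.Gamma (s : ℂ)) = Complex.Gamma (s : ℂ) := fun s => by
    rw [← Complex.Gamma_conj, Complex.conj_ofReal]
  have hE : conj (dEven (ν : ℂ)) = dEven (ν : ℂ) := by
    have h1 := hpow (ν / 2)
    have h2 := hG (-ν / 2 + 1 / 2)
    push_cast at h1 h2
    rw [dEven, map_div₀, map_mul, h1, h2, Complex.conj_ofReal]
  have hO : conj (dOdd (ν : ℂ)) = dOdd (ν : ℂ) := by
    have h1 := hpow ((ν + 1) / 2)
    have h2 := hG (-ν / 2)
    push_cast at h1 h2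
    rw [dOdd, map_div₀, map_mul, h1, h2, Complex.conj_ofReal]
  have hD : conj (parabolicD (ν : ℂ) b) = parabolicD (ν : ℂ) b := by
    rw [parabolicD_eq, map_sub, map_mul, map_mul, hE, hO, conj_yEven, conj_yOdd,
      Complex.conj_ofReal]
  have hΓ := hG (-ν)
  rw [Complex.ofReal_neg] at hΓ
  rw [M]
  simp only [map_mul, map_pow, hΓ, hD, conj_yEven, conj_yOdd, Complex.conj_ofReal]

end PointInteraction

end

theorem mainTheorem3 (b : ℝ) (hb : 0 < b) :
    -- the eigenvalue condition for arbitrary `ν`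
    (∀ z ν : ℂ,
      (ν ∈ PointInteraction.spectrum (PointInteraction.operator z b) ↔
        (Complex.Gamma (-ν))⁻¹ - z ^ 2 * PointInteraction.parabolicD ν b ^ 2 *
          ((√(2 / Real.pi) : ℂ) * PointInteraction.yEven ν b * PointInteraction.yOdd ν b) = 0) ∧
      (PointInteraction.IsEigenvalue (PointInteraction.operator z b) ν ↔
        (Complex.Gamma (-ν))⁻¹ - z ^ 2 * PointInteraction.parabolicD ν b ^ 2 *
          ((√(2 / Real.pi) : ℂ) * PointInteraction.yEven ν b * PointInteraction.yOdd ν b) = 0)) ∧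
    -- the eigenvalue condition for `ν ∉ ℕ₀`; for `z = 0` the equation `M = 1 / z ^ 2` is void
    (∀ z ν : ℂ, (∀ n : ℕ, ν ≠ n) →
      (ν ∈ PointInteraction.spectrum (PointInteraction.operator z b) ↔
        z ≠ 0 ∧ PointInteraction.M ν b = 1 / z ^ 2) ∧
      (PointInteraction.IsEigenvalue (PointInteraction.operator z b) ν ↔
        z ≠ 0 ∧ PointInteraction.M ν b = 1 / z ^ 2)) ∧
    -- the pole at `ν = 0` is not removable
    meromorphicOrderAt (fun ν : ℂ => PointInteraction.M ν b) 0 < 0 ∧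
    -- `M` is not constant in `ν`
    (¬ ∃ c : ℂ, ∀ ν : ℂ, (∀ n : ℕ, ν ≠ n) → PointInteraction.M ν b = c) ∧
    -- `M` is real for real `ν`
    (∀ ν : ℝ, (∀ n : ℕ, ν ≠ n) → ∃ r : ℝ, PointInteraction.M (ν : ℂ) b = (r : ℂ)) := by
  refine ⟨fun z ν => PointInteraction.spectrum_and_eigenvalue_iff hb z ν, fun z ν hν => ?_,
    PointInteraction.meromorphicOrderAt_M_neg hb, PointInteraction.M_not_constant hb,
    fun ν _ => PointInteraction.M_real ν b⟩
  have h := PointInteraction.spectrum_and_eigenvalue_iff hb z ν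
  rwa [PointInteraction.charFun_eq_zero_iff hν] at h
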